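/- Let $K$ be a (commutative) field. A \emph{double poset} is a finite set $P$ with two partial orders $\le_1,\le_2$; isomorphic double posets are identified. A double poset is \emph{plane} if any two distinct elements of it are comparable for exactly one of the two orders. It is \emph{WN} (without N) if it is plane and has no double subposet isomorphic to one of the two plane posets on four elements $a,b,c,d$ whose strict first order is $a<_1c$, $a<_1d$, $b<_1d$ (the strict second order being $a<_2b$, $c<_2b$, $c<_2d$ for the one, and the reverse of this for the other). Let $H_{DP}$, $H_{PP}$, $H_{WNP}$ be the $K$-vector spaces whose bases are respectively all double posets, the plane posets and the WN posets. They are Hopf algebras, graded by cardinality, for the following operations: the product $PQ$ of two double posets is their disjoint union, where $P$ and $Q$ keep their orders and, for all $x\in P$ and $y\in Q$, $x\le_2 y$ and $x,y$ are not $\le_1$-comparable; the coproduct is $\Delta(P)=\sum_I (P\setminus I)\otimes I$, the sum being over the subsets $I$ of $P$ that are upwards closed for $\le_1$. Let $H$ be any of these three Hopf algebras. \begin{enumerate} \item $H$ is free (as an associative unital algebra it is isomorphic to a free one $T(V)$) and cofree (as a coalgebra it is isomorphic to a tensor coalgebra $T(W)$ with the deconcatenation coproduct). \item $H$ is self-dual: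 it is isomorphic, as a graded Hopf algebra, to its graded dual. \item If $K$ has characteristic zero, the Lie algebra $\mathrm{Prim}(H)=\{x\in H : \Delta(x)=x\otimes 1+1\otimes x\}$, with the commutator bracket, is a free Lie algebra. \end{enumerate} -/

import Mathlib

open scoped TensorProduct


/-! ### Double posets -/

/-- A double poset structure on `α`: two partial orders on `α`. -/
structure DoublePoset (α : Type) where
  /-- the first order (`≤_h` for plane posets) -/
  le₁ : α → α → Prop
  /-- the second order (`≤_r` for plane posets) -/
  le₂ : α → α → Prop
  refl₁ : ∀ x, le₁ x x
  trans₁ : ∀ x y z, le₁ x y → le₁ y z → le₁ x z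
  antisymm₁ : ∀ x y, le₁ x y → le₁ y x → x = y
  refl₂ : ∀ x, le₂ x x
  trans₂ : ∀ x y z, le₂ x y → le₂ y z → le₂ x z
  antisymm₂ : ∀ x y, le₂ x y → le₂ y x → x = y

namespace DoublePoset

variable {α β γ δ : Type}

/-- The double poset induced along an injection. -/
def comap (P : DoublePoset α) (f : β ↪ α) : DoublePoset β where
  le₁ x y := P.le₁ (f x) (f y)
  le₂ x y := P.le₂ (f x) (f y)
  refl₁ _ := P.refl₁ _
  trans₁ _ _ _ := P.trans₁ _ _ _
  antisymm₁ _ _ h h' := f.injective (P.antisymm₁ _ _ h h')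
  refl₂ _ := P.refl₂ _
  trans₂ _ _ _ := P.trans₂ _ _ _
  antisymm₂ _ _ h h' := f.injective (P.antisymm₂ _ _ h h')

/-- The double subposet carried by a subset. -/
def restrict (P : DoublePoset α) (s : Set α) : DoublePoset s :=
  P.comap (Function.Embedding.subtype (· ∈ s))

/-- Isomorphism of double posets. -/
def Iso (P : DoublePoset α) (Q : DoublePoset β) : Prop :=
  ∃ e : α ≃ β, (∀ x y, P.le₁ x y ↔ Q.le₁ (e x) (e y)) ∧ (∀ x y, P.le₂ x y ↔ Q.le₂ (e x) (e y))

theorem Iso.refl (P : DoublePoset α) : P.Iso P :=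
  ⟨Equiv.refl _, fun _ _ => Iff.rfl, fun _ _ => Iff.rfl⟩

theorem Iso.symm {P : DoublePoset α} {Q : DoublePoset β} : P.Iso Q → Q.Iso P := by
  rintro ⟨e, h₁, h₂⟩
  exact ⟨e.symm, fun x y => by simp [h₁], fun x y => by simp [h₂]⟩

theorem Iso.trans {P : DoublePoset α} {Q : DoublePoset β} {R : DoublePoset γ} :
    P.Iso Q → Q.Iso R → P.Iso R := by
  rintro ⟨e, h₁, h₂⟩ ⟨f, k₁, k₂⟩
  exact ⟨e.trans f, fun x y => by simp [h₁, k₁], fun x y => by simp [h₂, k₂]⟩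

theorem comap_iso (P : DoublePoset α) (e : β ≃ α) : (P.comap e.toEmbedding).Iso P :=
  ⟨e, fun _ _ => Iff.rfl, fun _ _ => Iff.rfl⟩

/-- The composition of `P` and `Q`: on the disjoint union, every `x ∈ P` and `y ∈ Q` satisfy
`x ≤₂ y` and are not comparable for `≤₁`. -/
def comp (P : DoublePoset α) (Q : DoublePoset β) : DoublePoset (α ⊕ β) where
  le₁ := Sum.LiftRel P.le₁ Q.le₁
  le₂ := Sum.Lex P.le₂ Q.le₂
  refl₁ := by rintro (x | x) <;> simp [P.refl₁, Q.refl₁]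
  trans₁ := by
    rintro (x | x) (y | y) (z | z) <;> simp
    · exact P.trans₁ _ _ _
    · exact Q.trans₁ _ _ _
  antisymm₁ := by
    rintro (x | x) (y | y) <;> simp
    · exact P.antisymm₁ _ _
    · exact Q.antisymm₁ _ _
  refl₂ := by rintro (x | x) <;> simp [P.refl₂, Q.refl₂]
  trans₂ := by
    rintro (x | x) (y | y) (z | z) <;> simp
    · exact P.trans₂ _ _ _
    · exact Q.trans₂ _ _ _
  antisymm₂ := by
    rintro (x | x) (y | y) <;> simp
    · exact P.antisymm₂ _ _
    · exact Q.antisymm₂ _ _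

/-- The empty double poset. -/
def empty : DoublePoset (Fin 0) where
  le₁ _ _ := True
  le₂ _ _ := True
  refl₁ _ := trivial
  trans₁ _ _ _ _ _ := trivial
  antisymm₁ x := x.elim0
  refl₂ _ := trivial
  trans₂ _ _ _ _ _ := trivial
  antisymm₂ x := x.elim0

theorem iso_of_isEmpty [IsEmpty α] [IsEmpty β] (P : DoublePoset α) (Q : DoublePoset β) :
    P.Iso Q :=
  ⟨Equiv.equivOfIsEmpty α β, fun x => isEmptyElim x, fun x => isEmptyElim x⟩

theorem Iso.comp {P : DoublePoset α} {Q : DoublePoset β} {P' : DoublePoset γ}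
    {Q' : DoublePoset δ} (h : P.Iso P') (k : Q.Iso Q') : (P.comp Q).Iso (P'.comp Q') := by
  obtain ⟨e, h₁, h₂⟩ := h
  obtain ⟨f, k₁, k₂⟩ := k
  refine ⟨Equiv.sumCongr e f, ?_, ?_⟩
  · rintro (x | x) (y | y) <;> simp [DoublePoset.comp, h₁, k₁]
  · rintro (x | x) (y | y) <;> simp [DoublePoset.comp, h₂, k₂]

theorem comp_assoc_iso (P : DoublePoset α) (Q : DoublePoset β) (R : DoublePoset γ) :
    ((P.comp Q).comp R).Iso (P.comp (Q.comp R)) := by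
  refine ⟨Equiv.sumAssoc α β γ, ?_, ?_⟩
  · rintro ((x | x) | x) ((y | y) | y) <;> simp [DoublePoset.comp]
  · rintro ((x | x) | x) ((y | y) | y) <;> simp [DoublePoset.comp]

theorem empty_comp_iso [IsEmpty α] (E : DoublePoset α) (P : DoublePoset β) :
    (E.comp P).Iso P := by
  refine ⟨Equiv.emptySum α β, ?_, ?_⟩ <;>
  · rintro (x | x) (y | y)
    all_goals first | exact isEmptyElim x | exact isEmptyElim y | simp [DoublePoset.comp]

theorem comp_empty_iso [IsEmpty α] (E : DoublePoset α) (P : DoublePoset β) :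
    (P.comp E).Iso P := by
  refine ⟨Equiv.sumEmpty β α, ?_, ?_⟩ <;>
  · rintro (x | x) (y | y)
    all_goals first | exact isEmptyElim x | exact isEmptyElim y | simp [DoublePoset.comp]

theorem restrict_restrict_iso (P : DoublePoset α) (s : Set α) (t : Set s) (u : Set α)
    (h : u = Subtype.val '' t) : ((P.restrict s).restrict t).Iso (P.restrict u) := by
  subst h
  refine ⟨Equiv.Set.image _ t Subtype.val_injective, fun _ _ => Iff.rfl, fun _ _ => Iff.rfl⟩

theorem restrict_univ_iso (P : DoublePoset α) : (P.restrict Set.univ).Iso P :=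
  ⟨Equiv.Set.univ α, fun _ _ => Iff.rfl, fun _ _ => Iff.rfl⟩

theorem restrict_comp_iso (P : DoublePoset α) (Q : DoublePoset β) (s : Set (α ⊕ β))
    (t : Set α) (u : Set β) (ht : t = Sum.inl ⁻¹' s) (hu : u = Sum.inr ⁻¹' s) :
    ((P.comp Q).restrict s).Iso ((P.restrict t).comp (Q.restrict u)) := by
  subst ht hu
  refine Iso.symm ⟨⟨Sum.elim (fun x => ⟨.inl x.1, x.2⟩) (fun x => ⟨.inr x.1, x.2⟩),
    fun x => match x with
      | ⟨.inl a, h⟩ => .inl ⟨a, h⟩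
      | ⟨.inr a, h⟩ => .inr ⟨a, h⟩, ?_, ?_⟩, ?_, ?_⟩
  · rintro (x | x) <;> rfl
  · rintro ⟨x | x, h⟩ <;> rfl
  · rintro (x | x) (y | y) <;> simp [DoublePoset.comp, restrict, comap]
  · rintro (x | x) (y | y) <;> simp [DoublePoset.comp, restrict, comap]

/-- (`1`-)ideals: subsets that are upwards closed for `≤₁`. -/
def IsIdeal (P : DoublePoset α) (I : Set α) : Prop :=
  ∀ x ∈ I, ∀ y, P.le₁ x y → y ∈ I

/-- The type of ideals of `P`. -/
def Ideals (P : DoublePoset α) : Type := {I : Set α // P.IsIdeal I}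

noncomputable instance [Finite α] (P : DoublePoset α) : Fintype P.Ideals :=
  @Fintype.ofFinite _ (inferInstanceAs (Finite {I : Set α // P.IsIdeal I}))

/-! ### Plane posets and WN posets -/

/-- Plane: two distinct elements are comparable for exactly one of the two orders. -/
def IsPlane (P : DoublePoset α) : Prop :=
  ∀ x y, x ≠ y → ((P.le₁ x y ∨ P.le₁ y x) ↔ ¬ (P.le₂ x y ∨ P.le₂ y x))

/-- `Q` is isomorphic to a double subposet of `P`. -/
def Contains (P : DoublePoset α) (Q : DoublePoset β) : Prop :=
  ∃ s : Set α, (P.restrict s).Iso Q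

/-- The first plane poset whose Hasse graph is the letter N:
`0 <₁ 2`, `0 <₁ 3`, `1 <₁ 3` and `0 <₂ 1`, `2 <₂ 1`, `2 <₂ 3`. -/
def N₁ : DoublePoset (Fin 4) where
  le₁ i j := i = j ∨ (i, j) ∈ [((0 : Fin 4), (2 : Fin 4)), (0, 3), (1, 3)]
  le₂ i j := i = j ∨ (i, j) ∈ [((0 : Fin 4), (1 : Fin 4)), (2, 1), (2, 3)]
  refl₁ := by decide
  trans₁ := by decide
  antisymm₁ := by decide
  refl₂ := by decide
  trans₂ := by decide
  antisymm₂ := by decide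

/-- The second one, obtained from the first by reversing the second order. -/
def N₂ : DoublePoset (Fin 4) where
  le₁ i j := i = j ∨ (i, j) ∈ [((0 : Fin 4), (2 : Fin 4)), (0, 3), (1, 3)]
  le₂ i j := i = j ∨ (i, j) ∈ [((1 : Fin 4), (0 : Fin 4)), (1, 2), (3, 2)]
  refl₁ := by decide
  trans₁ := by decide
  antisymm₁ := by decide
  refl₂ := by decide
  trans₂ := by decide
  antisymm₂ := by decide

/-- WN ("without N") posets. -/
def IsWN (P : DoublePoset α) : Prop := P.IsPlane ∧ ¬ P.Contains N₁ ∧ ¬ P.Contains N₂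

theorem Iso.isPlane {P : DoublePoset α} {Q : DoublePoset β} (h : P.Iso Q) (hP : P.IsPlane) :
    Q.IsPlane := by
  obtain ⟨e, h₁, h₂⟩ := h.symm
  intro x y hxy
  simpa [h₁, h₂] using hP (e x) (e y) (by simpa using hxy)

theorem IsPlane.restrict {P : DoublePoset α} (h : P.IsPlane) (s : Set α) :
    (P.restrict s).IsPlane := fun x y hxy => h x y (by simpa [Subtype.ext_iff] using hxy)

theorem IsPlane.comp {P : DoublePoset α} {Q : DoublePoset β} (h : P.IsPlane) (k : Q.IsPlane) :
    (P.comp Q).IsPlane := by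
  rintro (x | x) (y | y) hxy
  · simpa [DoublePoset.comp] using h x y (by simpa using hxy)
  · simp [DoublePoset.comp]
  · simp [DoublePoset.comp]
  · simpa [DoublePoset.comp] using k x y (by simpa using hxy)

theorem contains_iff {P : DoublePoset α} {Q : DoublePoset β} : P.Contains Q ↔
    ∃ f : β → α, Function.Injective f ∧ (∀ x y, Q.le₁ x y ↔ P.le₁ (f x) (f y)) ∧
      (∀ x y, Q.le₂ x y ↔ P.le₂ (f x) (f y)) := by
  constructor
  · rintro ⟨s, h⟩
    obtain ⟨e, h₁, h₂⟩ := h.symm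
    exact ⟨fun x => (e x).1, Subtype.val_injective.comp e.injective, h₁, h₂⟩
  · rintro ⟨f, hf, h₁, h₂⟩
    exact ⟨Set.range f, Iso.symm ⟨Equiv.ofInjective f hf, h₁, h₂⟩⟩

theorem Iso.contains {P : DoublePoset α} {Q : DoublePoset β} {R : DoublePoset γ} (h : P.Iso Q)
    (hP : P.Contains R) : Q.Contains R := by
  obtain ⟨e, h₁, h₂⟩ := h
  obtain ⟨f, hf, k₁, k₂⟩ := contains_iff.1 hP
  exact contains_iff.2 ⟨e ∘ f, e.injective.comp hf, fun x y => by simp [k₁, h₁],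
    fun x y => by simp [k₂, h₂]⟩

theorem Contains.of_restrict {P : DoublePoset α} {R : DoublePoset γ} {s : Set α}
    (h : (P.restrict s).Contains R) : P.Contains R := by
  obtain ⟨f, hf, k₁, k₂⟩ := contains_iff.1 h
  exact contains_iff.2 ⟨fun x => (f x).1, Subtype.val_injective.comp hf, k₁, k₂⟩

/-- A double poset on `Fin 4` whose first order contains `0 < 2`, `0 < 3`, `1 < 3` can only be
contained in a composition if it is contained in one of the two factors. -/
theorem Contains.of_comp {P : DoublePoset α} {Q : DoublePoset β} {R : DoublePoset (Fin 4)}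
    (h02 : R.le₁ 0 2) (h03 : R.le₁ 0 3) (h13 : R.le₁ 1 3)
    (h : (P.comp Q).Contains R) : P.Contains R ∨ Q.Contains R := by
  obtain ⟨f, hf, k₁, k₂⟩ := contains_iff.1 h
  have a02 := (k₁ 0 2).1 h02
  have a03 := (k₁ 0 3).1 h03
  have a13 := (k₁ 1 3).1 h13
  rcases h0 : f 0 with x | x
  · left
    have key : ∀ i, ∃ y, f i = Sum.inl y := by
      rw [h0] at a02 a03
      rcases h2 : f 2 with y2 | y2
      · rcases h3 : f 3 with y3 | y3
        · rcases h1 : f 1 with y1 | y1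
          · intro i; fin_cases i
            exacts [⟨_, h0⟩, ⟨_, h1⟩, ⟨_, h2⟩, ⟨_, h3⟩]
          · simp [h1, h3, DoublePoset.comp] at a13
        · simp [h3, DoublePoset.comp] at a03
      · simp [h2, DoublePoset.comp] at a02
    choose g hg using key
    refine contains_iff.2 ⟨g, fun i j hij => hf (by rw [hg, hg, hij]), ?_, ?_⟩
    · intro i j; rw [k₁, hg, hg]; simp [DoublePoset.comp]
    · intro i j; rw [k₂, hg, hg]; simp [DoublePoset.comp]
  · right
    have key : ∀ i, ∃ y, f i = Sum.inr y := by
      rw [h0] at a02 a03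
      rcases h2 : f 2 with y2 | y2
      · simp [h2, DoublePoset.comp] at a02
      · rcases h3 : f 3 with y3 | y3
        · simp [h3, DoublePoset.comp] at a03
        · rcases h1 : f 1 with y1 | y1
          · simp [h1, h3, DoublePoset.comp] at a13
          · intro i; fin_cases i
            exacts [⟨_, h0⟩, ⟨_, h1⟩, ⟨_, h2⟩, ⟨_, h3⟩]
    choose g hg using key
    refine contains_iff.2 ⟨g, fun i j hij => hf (by rw [hg, hg, hij]), ?_, ?_⟩
    · intro i j; rw [k₁, hg, hg]; simp [DoublePoset.comp]
    · intro i j; rw [k₂, hg, hg]; simp [DoublePoset.comp]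

theorem Iso.isWN {P : DoublePoset α} {Q : DoublePoset β} (h : P.Iso Q) (hP : P.IsWN) :
    Q.IsWN :=
  ⟨h.isPlane hP.1, fun k => hP.2.1 (h.symm.contains k), fun k => hP.2.2 (h.symm.contains k)⟩

theorem IsWN.restrict {P : DoublePoset α} (h : P.IsWN) (s : Set α) : (P.restrict s).IsWN :=
  ⟨h.1.restrict s, fun k => h.2.1 k.of_restrict, fun k => h.2.2 k.of_restrict⟩

theorem IsWN.comp {P : DoublePoset α} {Q : DoublePoset β} (h : P.IsWN) (k : Q.IsWN) :
    (P.comp Q).IsWN := by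
  refine ⟨h.1.comp k.1, fun c => ?_, fun c => ?_⟩
  · rcases c.of_comp (by simp [N₁]) (by simp [N₁]) (by simp [N₁]) with c | c
    exacts [h.2.1 c, k.2.1 c]
  · rcases c.of_comp (by simp [N₂]) (by simp [N₂]) (by simp [N₂]) with c | c
    exacts [h.2.2 c, k.2.2 c]

theorem IsPlane.of_isEmpty [IsEmpty α] (P : DoublePoset α) : P.IsPlane :=
  fun x => isEmptyElim x

theorem IsWN.of_isEmpty [IsEmpty α] (P : DoublePoset α) : P.IsWN := by
  refine ⟨.of_isEmpty P, fun c => ?_, fun c => ?_⟩ <;>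
  · obtain ⟨f, -⟩ := contains_iff.1 c
    exact isEmptyElim (f 0)

end DoublePoset

/-! ### Isoclasses of finite double posets -/

/-- Isomorphism, as an equivalence relation on the double posets with underlying set `Fin n`. -/
instance doublePosetSetoid : Setoid (Σ n : ℕ, DoublePoset (Fin n)) where
  r P Q := P.2.Iso Q.2
  iseqv := ⟨fun P => .refl P.2, fun h => h.symm, fun h k => h.trans k⟩

/-- The set of isoclasses of finite double posets. -/
def DP : Type := Quotient doublePosetSetoid

namespace DP

open DoublePoset

variable {α β γ : Type} [Finite α] [Finite β] [Finite γ]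

/-- The isoclass of a finite double poset. -/
noncomputable def cls (P : DoublePoset α) : DP :=
  Quotient.mk _ ⟨Nat.card α, P.comap (Finite.equivFin α).symm.toEmbedding⟩

theorem cls_eq_iff {P : DoublePoset α} {Q : DoublePoset β} : cls P = cls Q ↔ P.Iso Q := by
  constructor
  · intro h
    exact ((comap_iso P _).symm.trans (Quotient.exact h)).trans (comap_iso Q _)
  · intro h
    exact Quotient.sound (((comap_iso P _).trans h).trans (comap_iso Q _).symm)

/-- A representative of an isoclass. -/
noncomputable def rep (x : DP) : DoublePoset (Fin (Quotient.out x).1) := (Quotient.out x).2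

theorem cls_mk {n : ℕ} (P : DoublePoset (Fin n)) :
    cls P = Quotient.mk doublePosetSetoid ⟨n, P⟩ :=
  Quotient.sound (comap_iso P _)

@[simp] theorem cls_rep (x : DP) : cls x.rep = x := by
  rw [cls_mk]
  exact Quotient.out_eq x

theorem rep_cls_iso (P : DoublePoset α) : (cls P).rep.Iso P := cls_eq_iff.1 (cls_rep _)

/-- The cardinality of an isoclass. -/
noncomputable def card (x : DP) : ℕ := (Quotient.out x).1

theorem card_cls (P : DoublePoset α) : (cls P).card = Nat.card α := by
  obtain ⟨e, -⟩ := rep_cls_iso P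
  exact (Nat.card_fin _).symm.trans (Nat.card_congr e)

/-- The composition product on isoclasses, with unit the empty double poset. -/
noncomputable instance : Monoid DP where
  mul x y := cls (x.rep.comp y.rep)
  one := cls DoublePoset.empty
  mul_assoc x y z := cls_eq_iff.2
    ((((rep_cls_iso _).comp (.refl _)).trans (comp_assoc_iso _ _ _)).trans
      ((Iso.refl _).comp (rep_cls_iso _)).symm)
  one_mul x := by
    change cls ((cls DoublePoset.empty).rep.comp x.rep) = x
    conv_rhs => rw [← cls_rep x]
    exact cls_eq_iff.2 (((rep_cls_iso _).comp (.refl _)).trans (empty_comp_iso _ _))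
  mul_one x := by
    change cls (x.rep.comp (cls DoublePoset.empty).rep) = x
    conv_rhs => rw [← cls_rep x]
    exact cls_eq_iff.2 (((Iso.refl _).comp (rep_cls_iso _)).trans (comp_empty_iso _ _))

theorem cls_mul_cls (P : DoublePoset α) (Q : DoublePoset β) : cls P * cls Q = cls (P.comp Q) :=
  cls_eq_iff.2 ((rep_cls_iso P).comp (rep_cls_iso Q))

theorem cls_of_isEmpty [IsEmpty α] (P : DoublePoset α) : cls P = 1 :=
  cls_eq_iff.2 (iso_of_isEmpty _ _)

end DP

/-- A set of isoclasses of double posets that contains the empty one and is stable under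
composition and under taking double subposets. -/
structure PosetFamily extends Submonoid DP where
  restrict_rep_mem : ∀ x ∈ carrier, ∀ s, DP.cls (x.rep.restrict s) ∈ carrier

namespace PosetFamily

open DoublePoset DP

theorem restrict_mem (C : PosetFamily) {α : Type} [Finite α] {P : DoublePoset α}
    (h : cls P ∈ C.toSubmonoid) (s : Set α) : cls (P.restrict s) ∈ C.toSubmonoid := by
  obtain ⟨e, h₁, h₂⟩ := (rep_cls_iso P).symm
  have := C.restrict_rep_mem _ h (e '' s)
  rw [cls_eq_iff.2 (_ : ((cls P).rep.restrict (e '' s)).Iso (P.restrict s))] at this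
  · exact this
  · exact Iso.symm ⟨e.image s, fun x y => h₁ x y, fun x y => h₂ x y⟩

/-- All double posets. -/
noncomputable def all : PosetFamily where
  toSubmonoid := ⊤
  restrict_rep_mem := fun _ _ _ => trivial

/-- The isoclasses of plane posets. -/
noncomputable def plane : PosetFamily where
  carrier := {x | x.rep.IsPlane}
  one_mem' := (rep_cls_iso DoublePoset.empty).symm.isPlane (.of_isEmpty _)
  mul_mem' := fun h k => (rep_cls_iso _).symm.isPlane (IsPlane.comp h k)
  restrict_rep_mem := fun _ h s => (rep_cls_iso _).symm.isPlane (IsPlane.restrict h s)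

/-- The isoclasses of WN posets. -/
noncomputable def wn : PosetFamily where
  carrier := {x | x.rep.IsWN}
  one_mem' := (rep_cls_iso DoublePoset.empty).symm.isWN (.of_isEmpty _)
  mul_mem' := fun h k => (rep_cls_iso _).symm.isWN (IsWN.comp h k)
  restrict_rep_mem := fun _ h s => (rep_cls_iso _).symm.isWN (IsWN.restrict h s)

end PosetFamily

/-! ### The Hopf algebras -/

/-- The vector space with basis the isoclasses in `C`, with the product extending the composition
of double posets. -/
def HopfOf (K : Type*) [Field K] (C : PosetFamily) := MonoidAlgebra K C.toSubmonoid

namespace HopfOf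

open DoublePoset DP

variable (K : Type*) [Field K] (C : PosetFamily)

noncomputable instance : Ring (HopfOf K C) :=
  inferInstanceAs (Ring (MonoidAlgebra K C.toSubmonoid))

noncomputable instance : Algebra K (HopfOf K C) :=
  inferInstanceAs (Algebra K (MonoidAlgebra K C.toSubmonoid))

variable {C}

/-- The basis element given by an isoclass. -/
noncomputable def of (x : C.toSubmonoid) : HopfOf K C := MonoidAlgebra.single x 1

variable {α β γ : Type} [Finite α] [Finite β] [Finite γ]

/-- The basis element given by a double poset. -/
noncomputable def elt (P : DoublePoset α) (h : cls P ∈ C.toSubmonoid) : HopfOf K C :=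
  of K ⟨cls P, h⟩

theorem elt_congr {P : DoublePoset α} {Q : DoublePoset β} (h : cls P ∈ C.toSubmonoid)
    (k : cls Q ∈ C.toSubmonoid) (e : P.Iso Q) : elt K P h = elt K Q k := by
  unfold elt
  congr 2
  exact cls_eq_iff.2 e

/-- The coproduct of a double poset: the sum of `(P \ I) ⊗ I` over the ideals `I` of `P`. -/
noncomputable def coprod (P : DoublePoset α) (h : cls P ∈ C.toSubmonoid) :
    HopfOf K C ⊗[K] HopfOf K C :=
  ∑ I : P.Ideals, elt K (P.restrict I.1ᶜ) (C.restrict_mem h _) ⊗ₜ[K]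
    elt K (P.restrict I.1) (C.restrict_mem h _)

theorem coprod_congr {P : DoublePoset α} {Q : DoublePoset β} (h : cls P ∈ C.toSubmonoid)
    (k : cls Q ∈ C.toSubmonoid) (e : P.Iso Q) : coprod K P h = coprod K Q k := by
  obtain ⟨e, h₁, h₂⟩ := e
  unfold coprod
  let E : P.Ideals ≃ Q.Ideals := (Equiv.Set.congr e).subtypeEquiv (by
    intro I
    constructor
    · rintro hI _ ⟨x, hx, rfl⟩ y hy
      exact ⟨e.symm y, hI x hx _ ((h₁ _ _).2 (by simpa using hy)), by simp⟩
    · intro hI x hx y hxy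
      obtain ⟨z, hz, hzy⟩ := hI (e x) ⟨x, hx, rfl⟩ (e y) ((h₁ _ _).1 hxy)
      rwa [← e.injective hzy])
  have key : ∀ s : Set α, (P.restrict s).Iso (Q.restrict (e '' s)) := fun s =>
    ⟨e.image s, fun x y => h₁ x y, fun x y => h₂ x y⟩
  refine Fintype.sum_equiv E _ _ fun I => ?_
  have hE : (E I).1 = e '' I.1 := rfl
  congr 1
  · apply elt_congr
    rw [hE, ← Set.image_compl_eq e.bijective]
    exact key _
  · apply elt_congr
    rw [hE]
    exact key _

theorem elt_mul_elt {P : DoublePoset α} {Q : DoublePoset β} (h : cls P ∈ C.toSubmonoid)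
    (k : cls Q ∈ C.toSubmonoid) (hk : cls (P.comp Q) ∈ C.toSubmonoid) :
    elt K P h * elt K Q k = elt K (P.comp Q) hk := by
  refine (MonoidAlgebra.single_mul_single ..).trans ?_
  unfold elt of
  congr 1
  · exact Subtype.ext (cls_mul_cls P Q)
  · simp

theorem of_eq_elt (x : C.toSubmonoid) : of K x = elt K x.1.rep (by simp) := by
  unfold elt
  congr 1
  exact Subtype.ext (by simp)

theorem one_eq_elt [IsEmpty α] (P : DoublePoset α) (h : cls P ∈ C.toSubmonoid) :
    (1 : HopfOf K C) = elt K P h := by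
  unfold elt of
  refine MonoidAlgebra.one_def.trans ?_
  congr 1
  exact Subtype.ext (cls_of_isEmpty P).symm

theorem comp_mem {P : DoublePoset α} {Q : DoublePoset β} (h : cls P ∈ C.toSubmonoid)
    (k : cls Q ∈ C.toSubmonoid) : cls (P.comp Q) ∈ C.toSubmonoid :=
  cls_mul_cls P Q ▸ C.toSubmonoid.mul_mem h k

theorem coprod_comp {P : DoublePoset α} {Q : DoublePoset β} (h : cls P ∈ C.toSubmonoid)
    (k : cls Q ∈ C.toSubmonoid) :
    coprod K (P.comp Q) (comp_mem h k) = coprod K P h * coprod K Q k := by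
  unfold coprod
  rw [Finset.sum_mul_sum, ← Fintype.sum_prod_type']
  let E : (P.comp Q).Ideals ≃ P.Ideals × Q.Ideals :=
    { toFun := fun I => (⟨Sum.inl ⁻¹' I.1, fun x hx y hxy => I.2 _ hx _ (by simpa [comp] using hxy)⟩,
        ⟨Sum.inr ⁻¹' I.1, fun x hx y hxy => I.2 _ hx _ (by simpa [comp] using hxy)⟩)
      invFun := fun J => ⟨Sum.inl '' J.1.1 ∪ Sum.inr '' J.2.1, by
        rintro (x | x) hx (y | y) hxy
        · simp [comp] at hx hxy ⊢; exact J.1.2 x hx y hxy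
        · simp [comp] at hxy
        · simp [comp] at hxy
        · simp [comp] at hx hxy ⊢; exact J.2.2 x hx y hxy⟩
      left_inv := fun I => Subtype.ext (by ext (x | x) <;> simp)
      right_inv := fun J => Prod.ext (Subtype.ext (by ext x; simp)) (Subtype.ext (by ext x; simp)) }
  refine Fintype.sum_equiv E _ _ fun I => ?_
  rw [Algebra.TensorProduct.tmul_mul_tmul,
    elt_mul_elt K _ _ (comp_mem (C.restrict_mem h _) (C.restrict_mem k _)),
    elt_mul_elt K _ _ (comp_mem (C.restrict_mem h _) (C.restrict_mem k _))]
  congr 1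
  · exact elt_congr K _ _ (restrict_comp_iso _ _ _ _ _ rfl rfl)
  · exact elt_congr K _ _ (restrict_comp_iso _ _ _ _ _ rfl rfl)

theorem coprod_of_isEmpty [IsEmpty α] (P : DoublePoset α) (h : cls P ∈ C.toSubmonoid) :
    coprod K P h = 1 := by
  unfold coprod
  have : Unique P.Ideals :=
    { default := ⟨∅, fun x => isEmptyElim x⟩
      uniq := fun I => Subtype.ext (Subsingleton.elim _ _) }
  rw [Fintype.sum_unique, ← one_eq_elt, ← one_eq_elt]
  rfl

variable (C)

/-- The coproduct, as a morphism of algebras. -/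
noncomputable def comulHom : HopfOf K C →ₐ[K] HopfOf K C ⊗[K] HopfOf K C :=
  MonoidAlgebra.lift K (HopfOf K C ⊗[K] HopfOf K C) C.toSubmonoid
    { toFun := fun x => coprod K x.1.rep (by simp)
      map_one' := (coprod_congr K _ (by rw [cls_of_isEmpty]; exact one_mem _)
        (rep_cls_iso DoublePoset.empty)).trans (coprod_of_isEmpty K _ _)
      map_mul' := fun x y => (coprod_congr K _ _ (rep_cls_iso _)).trans
        (coprod_comp K (by simp) (by simp)) }

theorem card_mul (x y : DP) : (x * y).card = x.card + y.card := by
  refine (card_cls (x.rep.comp y.rep)).trans ?_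
  rw [Nat.card_sum, Nat.card_fin, Nat.card_fin]
  rfl

theorem card_one : (1 : DP).card = 0 := by
  rw [← cls_of_isEmpty DoublePoset.empty, card_cls]
  simp

open Classical in
/-- The counit, as a morphism of algebras: it is `1` on the empty double poset and `0` on the
other double posets. -/
noncomputable def counitHom : HopfOf K C →ₐ[K] K :=
  MonoidAlgebra.lift K K C.toSubmonoid
    { toFun := fun x => if x.1.card = 0 then 1 else 0
      map_one' := by simp [card_one]
      map_mul' := fun x y => by
        by_cases hx : x.1.card = 0 <;> by_cases hy : y.1.card = 0 <;> simp [card_mul, hx, hy] }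

variable {C}

theorem comulHom_elt (P : DoublePoset α) (h : cls P ∈ C.toSubmonoid) :
    comulHom K C (elt K P h) = coprod K P h := by
  refine (MonoidAlgebra.lift_single ..).trans ?_
  rw [one_smul]
  exact coprod_congr K (by simpa using h) h (rep_cls_iso P)

open Classical in
theorem counitHom_elt (P : DoublePoset α) (h : cls P ∈ C.toSubmonoid) :
    counitHom K C (elt K P h) = if Nat.card α = 0 then 1 else 0 := by
  refine (MonoidAlgebra.lift_single ..).trans ?_
  rw [one_smul]
  simp [card_cls]

theorem linearMap_ext {M : Type*} [AddCommMonoid M] [Module K M] {f g : HopfOf K C →ₗ[K] M}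
    (h : ∀ (n : ℕ) (P : DoublePoset (Fin n)) (hP : cls P ∈ C.toSubmonoid),
      f (elt K P hP) = g (elt K P hP)) : f = g := by
  refine MonoidAlgebra.lhom_ext' fun x => LinearMap.ext_ring ?_
  have := h _ x.1.rep (by simp)
  rw [← of_eq_elt] at this
  exact this

theorem algHom_ext' {M : Type*} [Semiring M] [Algebra K M] {f g : HopfOf K C →ₐ[K] M}
    (h : ∀ (n : ℕ) (P : DoublePoset (Fin n)) (hP : cls P ∈ C.toSubmonoid),
      f (elt K P hP) = g (elt K P hP)) : f = g :=
  AlgHom.toLinearMap_injective (linearMap_ext K h)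

theorem elt_eq_one {P : DoublePoset α} (h : cls P ∈ C.toSubmonoid) (hα : Nat.card α = 0) :
    elt K P h = 1 := by
  have : IsEmpty α := (Nat.card_eq_zero.1 hα).resolve_right (not_infinite_iff_finite.2 ‹_›)
  exact (one_eq_elt K P h).symm

/-- Pairs of ideals `A ⊆ B` of `P`. -/
def IdealPairs (P : DoublePoset α) : Type :=
  {p : Set α × Set α // P.IsIdeal p.1 ∧ P.IsIdeal p.2 ∧ p.1 ⊆ p.2}

noncomputable instance (P : DoublePoset α) : Fintype (IdealPairs P) :=
  @Fintype.ofFinite _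
    (inferInstanceAs (Finite {p : Set α × Set α // P.IsIdeal p.1 ∧ P.IsIdeal p.2 ∧ p.1 ⊆ p.2}))

/-- An ideal `I` of `P` and an ideal `J` of `P \ I` give the pair `I ⊆ I ∪ J`. -/
def pairOfLeft (P : DoublePoset α) (p : Σ I : P.Ideals, (P.restrict I.1ᶜ).Ideals) :
    IdealPairs P :=
  ⟨(p.1.1, p.1.1 ∪ Subtype.val '' p.2.1), p.1.2, by
      intro x hx y hxy
      by_cases hy : y ∈ p.1.1
      · exact Or.inl hy
      · rcases hx with hx | ⟨x, hx, rfl⟩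
        · exact absurd (p.1.2 _ hx _ hxy) hy
        · exact Or.inr ⟨⟨y, hy⟩, p.2.2 x hx ⟨y, hy⟩ hxy, rfl⟩, Set.subset_union_left⟩

/-- An ideal `I` of `P` and an ideal `J` of `I` give the pair `J ⊆ I`. -/
def pairOfRight (P : DoublePoset α) (p : Σ I : P.Ideals, (P.restrict I.1).Ideals) :
    IdealPairs P :=
  ⟨(Subtype.val '' p.2.1, p.1.1), by
      rintro _ ⟨x, hx, rfl⟩ y hxy
      exact ⟨⟨y, p.1.2 _ x.2 _ hxy⟩, p.2.2 x hx ⟨y, _⟩ hxy, rfl⟩, p.1.2, by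
      rintro _ ⟨x, hx, rfl⟩
      exact x.2⟩

theorem pairOfLeft_bijective (P : DoublePoset α) : Function.Bijective (pairOfLeft P) := by
  constructor
  · rintro ⟨⟨I, hI⟩, ⟨J, hJ⟩⟩ ⟨⟨I', hI'⟩, ⟨J', hJ'⟩⟩ h
    have h1 : I = I' := congrArg (fun p => p.1.1) h
    subst h1
    have h2 : I ∪ Subtype.val '' J = I ∪ Subtype.val '' J' := congrArg (fun p => p.1.2) h
    have h3 : J = J' := by
      ext x
      have := Set.ext_iff.1 h2 x.1
      have hx : x.1 ∉ I := x.2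
      simpa [hx] using this
    subst h3
    rfl
  · rintro ⟨⟨A, B⟩, hA, hB, hAB⟩
    refine ⟨⟨⟨A, hA⟩, ⟨Subtype.val ⁻¹' B, fun x hx y hxy => hB _ hx _ hxy⟩⟩,
      Subtype.ext (Prod.ext rfl ?_)⟩
    ext x
    have := @hAB x
    by_cases hx : x ∈ A <;> simp_all [pairOfLeft]

theorem pairOfRight_bijective (P : DoublePoset α) : Function.Bijective (pairOfRight P) := by
  constructor
  · rintro ⟨⟨I, hI⟩, ⟨J, hJ⟩⟩ ⟨⟨I', hI'⟩, ⟨J', hJ'⟩⟩ h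
    have h1 : I = I' := congrArg (fun p => p.1.2) h
    subst h1
    have h2 : Subtype.val '' J = Subtype.val '' J' := congrArg (fun p => p.1.1) h
    have h3 : J = J' := Subtype.val_injective.image_injective h2
    subst h3
    rfl
  · rintro ⟨⟨A, B⟩, hA, hB, hAB⟩
    refine ⟨⟨⟨B, hB⟩, ⟨Subtype.val ⁻¹' A, fun x hx y hxy => hA _ hx _ hxy⟩⟩,
      Subtype.ext (Prod.ext ?_ rfl)⟩
    change Subtype.val '' ((Subtype.val : B → α) ⁻¹' A) = A
    simpa using hAB

theorem left_coassoc (P : DoublePoset α) (h : cls P ∈ C.toSubmonoid) :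
    TensorProduct.assoc K _ _ _ ((comulHom K C).toLinearMap.rTensor _ (coprod K P h)) =
    ∑ p : IdealPairs P, elt K (P.restrict p.1.2ᶜ) (C.restrict_mem h _) ⊗ₜ[K]
      (elt K (P.restrict (p.1.2 \ p.1.1)) (C.restrict_mem h _) ⊗ₜ[K]
        elt K (P.restrict p.1.1) (C.restrict_mem h _)) := by
  simp only [coprod, map_sum, LinearMap.rTensor_tmul, AlgHom.toLinearMap_apply, comulHom_elt,
    TensorProduct.sum_tmul, TensorProduct.assoc_tmul]
  rw [← Fintype.sum_sigma']
  refine Fintype.sum_bijective _ (pairOfLeft_bijective P) _ _ ?_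
  rintro ⟨I, J⟩
  congr 1
  · refine elt_congr K _ _ (restrict_restrict_iso _ _ _ _ ?_)
    ext x; simp [pairOfLeft]
  · congr 1
    refine elt_congr K _ _ (restrict_restrict_iso _ _ _ _ ?_)
    ext x
    simp only [pairOfLeft, Set.mem_sdiff, Set.mem_union, Set.mem_image]
    constructor
    · rintro ⟨h1 | h1, h2⟩
      · exact absurd h1 h2
      · exact h1
    · rintro ⟨y, hy, rfl⟩
      exact ⟨Or.inr ⟨y, hy, rfl⟩, y.2⟩

theorem right_coassoc (P : DoublePoset α) (h : cls P ∈ C.toSubmonoid) :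
    (comulHom K C).toLinearMap.lTensor _ (coprod K P h) =
    ∑ p : IdealPairs P, elt K (P.restrict p.1.2ᶜ) (C.restrict_mem h _) ⊗ₜ[K]
      (elt K (P.restrict (p.1.2 \ p.1.1)) (C.restrict_mem h _) ⊗ₜ[K]
        elt K (P.restrict p.1.1) (C.restrict_mem h _)) := by
  simp only [coprod, map_sum, LinearMap.lTensor_tmul, AlgHom.toLinearMap_apply, comulHom_elt,
    TensorProduct.tmul_sum]
  rw [← Fintype.sum_sigma']
  refine Fintype.sum_bijective _ (pairOfRight_bijective P) _ _ ?_
  rintro ⟨I, J⟩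
  congr 2
  · refine elt_congr K _ _ (restrict_restrict_iso _ _ _ _ ?_)
    ext x; simp [pairOfRight]
  · refine elt_congr K _ _ (restrict_restrict_iso _ _ _ _ rfl)

theorem counit_left (P : DoublePoset α) (h : cls P ∈ C.toSubmonoid) :
    (counitHom K C).toLinearMap.rTensor _ (coprod K P h) = 1 ⊗ₜ[K] elt K P h := by
  simp only [coprod, map_sum, LinearMap.rTensor_tmul, AlgHom.toLinearMap_apply]
  rw [Finset.sum_eq_single_of_mem (show P.Ideals from ⟨Set.univ, fun _ _ _ _ => trivial⟩) (Finset.mem_univ _)]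
  · congr 1
    · rw [counitHom_elt, if_pos]
      simp
    · exact elt_congr K _ _ (restrict_univ_iso P)
  · intro I _ hI
    rw [counitHom_elt, if_neg, TensorProduct.zero_tmul]
    intro h0
    refine hI (Subtype.ext (Set.compl_empty_iff.1 ?_))
    rwa [Nat.card_coe_set_eq, Set.ncard_eq_zero] at h0

theorem counit_right (P : DoublePoset α) (h : cls P ∈ C.toSubmonoid) :
    (counitHom K C).toLinearMap.lTensor _ (coprod K P h) = elt K P h ⊗ₜ[K] 1 := by
  simp only [coprod, map_sum, LinearMap.lTensor_tmul, AlgHom.toLinearMap_apply]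
  rw [Finset.sum_eq_single_of_mem (show P.Ideals from ⟨∅, fun _ h => h.elim⟩) (Finset.mem_univ _)]
  · congr 1
    · refine elt_congr K _ _ (Iso.trans ?_ (restrict_univ_iso P))
      rw [Set.compl_empty]
      exact .refl _
    · rw [counitHom_elt, if_pos]
      simp
  · intro I _ hI
    rw [counitHom_elt, if_neg, TensorProduct.tmul_zero]
    intro h0
    refine hI (Subtype.ext ?_)
    rwa [Nat.card_coe_set_eq, Set.ncard_eq_zero] at h0

variable (C)

/-- The bialgebra structure. -/
noncomputable instance : Bialgebra K (HopfOf K C) :=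
  Bialgebra.ofAlgHom (comulHom K C) (counitHom K C)
    (algHom_ext' K fun n P hP => by
      have h1 := left_coassoc K P hP
      have h2 := right_coassoc K P hP
      rw [← comulHom_elt] at h1 h2
      exact h1.trans h2.symm)
    (algHom_ext' K fun n P hP => by
      have h1 := counit_left K P hP
      rw [← comulHom_elt] at h1
      exact h1)
    (algHom_ext' K fun n P hP => by
      have h1 := counit_right K P hP
      rw [← comulHom_elt] at h1
      exact h1)

variable {C}

theorem comul_elt (P : DoublePoset α) (h : cls P ∈ C.toSubmonoid) :
    Coalgebra.comul (R := K) (elt K P h) = ∑ I : P.Ideals,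
      elt K (P.restrict I.1ᶜ) (C.restrict_mem h _) ⊗ₜ[K]
        elt K (P.restrict I.1) (C.restrict_mem h _) :=
  comulHom_elt K P h

open Classical in
theorem counit_elt (P : DoublePoset α) (h : cls P ∈ C.toSubmonoid) :
    Coalgebra.counit (R := K) (elt K P h) = if Nat.card α = 0 then (1 : K) else 0 :=
  counitHom_elt K P h

/-! The antipode is the (locally finite) sum of the convolution powers of `1 - id`. -/

open WithConv in
theorem conv_elt (f g : WithConv (HopfOf K C →ₗ[K] HopfOf K C)) (P : DoublePoset α)
    (h : cls P ∈ C.toSubmonoid) :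
    (f * g) (elt K P h) = ∑ I : P.Ideals, f (elt K (P.restrict I.1ᶜ) (C.restrict_mem h _)) *
        g (elt K (P.restrict I.1) (C.restrict_mem h _)) := by
  rw [LinearMap.convMul_apply, comul_elt]
  simp

variable (C) in
/-- The map `1 - id` in the convolution algebra. -/
noncomputable def oneSubId : WithConv (HopfOf K C →ₗ[K] HopfOf K C) :=
  1 - WithConv.toConv LinearMap.id

theorem oneSubId_elt_of_card_eq_zero (P : DoublePoset α) (h : cls P ∈ C.toSubmonoid)
    (hα : Nat.card α = 0) : oneSubId K C (elt K P h) = 0 := by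
  rw [elt_eq_one K h hα]
  change (algebraMap K (HopfOf K C)) (Coalgebra.counit 1) - 1 = 0
  simp

theorem oneSubId_pow_elt (k : ℕ) : ∀ {α : Type} [Finite α] (P : DoublePoset α)
    (h : cls P ∈ C.toSubmonoid), Nat.card α < k → (oneSubId K C ^ k) (elt K P h) = 0 := by
  induction k with
  | zero => intro α _ P h hk; omega
  | succ k ih =>
    intro α _ P h hk
    rw [pow_succ', conv_elt]
    refine Finset.sum_eq_zero fun I _ => ?_
    by_cases h0 : Nat.card ↥(I.1ᶜ) = 0
    · rw [oneSubId_elt_of_card_eq_zero K _ _ h0, zero_mul]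
    · rw [ih, mul_zero]
      have := Set.ncard_add_ncard_compl I.1
      rw [Nat.card_coe_set_eq] at h0 ⊢
      omega

variable (C) in
/-- The partial sums of the geometric series. -/
noncomputable def geom (k : ℕ) : WithConv (HopfOf K C →ₗ[K] HopfOf K C) :=
  ∑ i ∈ Finset.range k, oneSubId K C ^ i

theorem geom_elt (P : DoublePoset α) (h : cls P ∈ C.toSubmonoid) (k : ℕ)
    (hk : Nat.card α < k) : geom K C k (elt K P h) = geom K C (Nat.card α + 1) (elt K P h) := by
  obtain ⟨m, rfl⟩ := Nat.exists_eq_add_of_lt hk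
  induction m with
  | zero => rfl
  | succ m ih =>
    have : geom K C (Nat.card α + (m + 1) + 1) =
      geom K C (Nat.card α + m + 1) + oneSubId K C ^ (Nat.card α + m + 1) :=
      Finset.sum_range_succ _ _
    rw [this]
    refine Eq.trans (b := geom K C (Nat.card α + m + 1) (elt K P h) +
      (oneSubId K C ^ (Nat.card α + m + 1)) (elt K P h)) rfl ?_
    rw [oneSubId_pow_elt K _ P h (by omega), add_zero, ih (by omega)]

variable (C) in
/-- The antipode. -/
noncomputable def antipodeMap : HopfOf K C →ₗ[K] HopfOf K C :=
  (MonoidAlgebra.basis C.toSubmonoid K).constr K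
    fun x => geom K C (x.1.card + 1) (of K x)

theorem antipodeMap_elt (P : DoublePoset α) (h : cls P ∈ C.toSubmonoid) (k : ℕ)
    (hk : Nat.card α < k) : antipodeMap K C (elt K P h) = geom K C k (elt K P h) := by
  rw [geom_elt K P h k hk, ← card_cls P]
  refine Eq.trans (congrArg (antipodeMap K C) ?_) 
    (Module.Basis.constr_basis (MonoidAlgebra.basis C.toSubmonoid K) K
      (fun x => geom K C (x.1.card + 1) (of K x)) ⟨cls P, h⟩)
  exact (MonoidAlgebra.basis_apply K _).symm

theorem geom_mul_id (k : ℕ) :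
    geom K C k * WithConv.toConv LinearMap.id = 1 - oneSubId K C ^ k := by
  have h : WithConv.toConv LinearMap.id = 1 - oneSubId K C := (sub_sub_cancel _ _).symm
  rw [h]
  exact geom_sum_mul_neg _ _

theorem id_mul_geom (k : ℕ) :
    WithConv.toConv LinearMap.id * geom K C k = 1 - oneSubId K C ^ k := by
  have h : WithConv.toConv LinearMap.id = 1 - oneSubId K C := (sub_sub_cancel _ _).symm
  rw [h]
  exact mul_neg_geom_sum _ _

theorem one_sub_pow_elt (P : DoublePoset α) (h : cls P ∈ C.toSubmonoid) :
    (1 - oneSubId K C ^ (Nat.card α + 1)) (elt K P h) =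
      algebraMap K _ (Coalgebra.counit (R := K) (elt K P h)) := by
  refine Eq.trans (b := algebraMap K _ (Coalgebra.counit (R := K) (elt K P h)) -
    (oneSubId K C ^ (Nat.card α + 1)) (elt K P h)) rfl ?_
  rw [oneSubId_pow_elt K _ P h (Nat.lt_succ_self _), sub_zero]

variable (C)

/-- The Hopf algebra structure. -/
noncomputable instance : HopfAlgebra K (HopfOf K C) where
  antipode := antipodeMap K C
  mul_antipode_rTensor_comul := linearMap_ext K fun n P hP => by
    refine Eq.trans ?_ (one_sub_pow_elt K P hP)
    rw [← geom_mul_id, conv_elt]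
    simp only [LinearMap.comp_apply, comul_elt, map_sum, LinearMap.rTensor_tmul,
      LinearMap.mul'_apply]
    refine Finset.sum_congr rfl fun I _ => ?_
    rw [antipodeMap_elt K _ _ (Nat.card (Fin n) + 1)
      (Nat.lt_succ_of_le (Finite.card_subtype_le _))]
    rfl
  mul_antipode_lTensor_comul := linearMap_ext K fun n P hP => by
    refine Eq.trans ?_ (one_sub_pow_elt K P hP)
    rw [← id_mul_geom, conv_elt]
    simp only [LinearMap.comp_apply, comul_elt, map_sum, LinearMap.lTensor_tmul,
      LinearMap.mul'_apply]
    refine Finset.sum_congr rfl fun I _ => ?_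
    rw [antipodeMap_elt K _ _ (Nat.card (Fin n) + 1)
      (Nat.lt_succ_of_le (Finite.card_subtype_le _))]
    rfl

/-- The homogeneous component of degree `n`: the span of the double posets of cardinality `n`. -/
noncomputable def degree (n : ℕ) : Submodule K (HopfOf K C) :=
  Submodule.span K {y | ∃ x : C.toSubmonoid, x.1.card = n ∧ y = of K x}

/-- The inclusion in the space generated by all double posets, as a morphism of algebras. -/
noncomputable def inclusionHom : HopfOf K C →ₐ[K] HopfOf K PosetFamily.all :=
  MonoidAlgebra.mapDomainAlgHom K K (M := C.toSubmonoid) (N := PosetFamily.all.toSubmonoid)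
    (Submonoid.inclusion le_top)

variable {C} in
theorem inclusionHom_elt (P : DoublePoset α) (h : cls P ∈ C.toSubmonoid) :
    inclusionHom K C (elt K P h) =
      elt K P (C := PosetFamily.all) trivial :=
  MonoidAlgebra.mapDomain_single

/-- The space generated by `C` is a Hopf subalgebra of the space generated by all double posets:
the inclusion is an injective morphism of bialgebras. -/
noncomputable def inclusion : HopfOf K C →ₐc[K] HopfOf K PosetFamily.all :=
  BialgHom.ofAlgHom (inclusionHom K C)
    (algHom_ext' K fun n P hP => by
      simp only [AlgHom.comp_apply, inclusionHom_elt]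
      exact (counit_elt K P _).trans (counit_elt K P _).symm)
    (algHom_ext' K fun n P hP => by
      simp only [AlgHom.comp_apply, inclusionHom_elt]
      refine (congrArg _ (comul_elt K P hP)).trans ((comul_elt K P _).trans ?_).symm
      simp [inclusionHom_elt])

theorem inclusion_injective : Function.Injective (inclusion K C) :=
  MonoidAlgebra.mapDomain_injective (Submonoid.inclusion_injective le_top)

end HopfOf

/-- The Hopf algebra of double posets. -/
abbrev HDP (K : Type*) [Field K] := HopfOf K PosetFamily.all

/-- The Hopf algebra of plane posets. -/
abbrev HPP (K : Type*) [Field K] := HopfOf K PosetFamily.plane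

/-- The Hopf algebra of WN posets. -/
abbrev HWNP (K : Type*) [Field K] := HopfOf K PosetFamily.wn

/-! ### Free algebras, cofree coalgebras, self-duality, primitive elements -/

universe u v

/-- `A` is isomorphic to a free associative unital algebra. -/
def IsFreeAlgebra (K : Type u) (A : Type v) [Field K] [Ring A] [Algebra K A] : Prop :=
  ∃ X : Type v, Nonempty (A ≃ₐ[K] FreeAlgebra K X)

/-- `L` is isomorphic to a free Lie algebra. -/
def IsFreeLieAlgebra (K : Type u) (L : Type v) [Field K] [LieRing L] [LieAlgebra K L] : Prop :=
  ∃ X : Type v, Nonempty (L ≃ₗ⁅K⁆ FreeLieAlgebra K X)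

/-- The tensor space `T(V)` of the vector space `V` with basis `X`: its basis is the set of the
words `x₁ ⊗ ⋯ ⊗ xₙ` in `X`. -/
def TensorCoalgebra (K : Type u) (X : Type v) [Field K] := List X →₀ K

namespace TensorCoalgebra

variable (K : Type u) (X : Type v) [Field K]

noncomputable instance : AddCommGroup (TensorCoalgebra K X) :=
  inferInstanceAs (AddCommGroup (List X →₀ K))

noncomputable instance : Module K (TensorCoalgebra K X) :=
  inferInstanceAs (Module K (List X →₀ K))

variable {X}

/-- The basis element given by a word. -/
noncomputable def word (w : List X) : TensorCoalgebra K X := Finsupp.single w 1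

variable (X) in
theorem linearMap_ext {M : Type*} [AddCommMonoid M] [Module K M]
    {f g : TensorCoalgebra K X →ₗ[K] M} (h : ∀ w, f (word K w) = g (word K w)) : f = g :=
  Finsupp.lhom_ext' fun w => LinearMap.ext_ring (h w)

variable (X) in
/-- The linear map with prescribed values on words. -/
noncomputable def lift {M : Type*} [AddCommMonoid M] [Module K M] (f : List X → M) :
    TensorCoalgebra K X →ₗ[K] M :=
  Finsupp.linearCombination K f

theorem lift_word {M : Type*} [AddCommMonoid M] [Module K M] (f : List X → M) (w : List X) :
    lift K X f (word K w) = f w := by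
  simp only [lift, word]
  exact (Finsupp.linearCombination_single K 1 w).trans (one_smul K _)

/-- The deconcatenation coproduct of a word. -/
noncomputable def deconc (w : List X) : TensorCoalgebra K X ⊗[K] TensorCoalgebra K X :=
  ∑ i ∈ Finset.range (w.length + 1), word K (w.take i) ⊗ₜ[K] word K (w.drop i)

open Classical in
/-- The tensor coalgebra: the coproduct is deconcatenation, the counit is the projection on the
constants. -/
noncomputable instance : Coalgebra K (TensorCoalgebra K X) where
  comul := lift K X (deconc K)
  counit := lift K X fun w => if w.length = 0 then 1 else 0
  coassoc := linearMap_ext K X fun w => by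
    simp only [LinearMap.comp_apply, lift_word, deconc, map_sum, LinearMap.rTensor_tmul,
      LinearMap.lTensor_tmul, TensorProduct.sum_tmul, TensorProduct.tmul_sum,
      LinearEquiv.coe_coe, TensorProduct.assoc_tmul]
    rw [Finset.sum_sigma', Finset.sum_sigma']
    refine Finset.sum_bij' (fun p _ => ⟨p.2, p.1 - p.2⟩) (fun p _ => ⟨p.1 + p.2, p.1⟩)
      ?_ ?_ ?_ ?_ ?_
    · rintro ⟨i, j⟩ h
      simp at h ⊢
      omega
    · rintro ⟨i, j⟩ h
      simp at h ⊢
      omega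
    · rintro ⟨i, j⟩ h
      simp at h ⊢
      omega
    · rintro ⟨i, j⟩ h
      simp at h ⊢
    · rintro ⟨i, j⟩ h
      simp at h
      have hji : j ≤ i := by omega
      simp only [List.take_take, List.drop_drop, List.drop_take, min_eq_left hji,
        Nat.add_sub_cancel' hji]
  rTensor_counit_comp_comul := linearMap_ext K X fun w => by
    simp only [LinearMap.comp_apply, lift_word, deconc, map_sum, LinearMap.rTensor_tmul]
    rw [Finset.sum_eq_single_of_mem 0 (by simp)]
    · simp
    · intro i hi h0
      simp at hi
      rw [if_neg, TensorProduct.zero_tmul]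
      simp only [List.length_take]
      omega
  lTensor_counit_comp_comul := linearMap_ext K X fun w => by
    simp only [LinearMap.comp_apply, lift_word, deconc, map_sum, LinearMap.lTensor_tmul]
    rw [Finset.sum_eq_single_of_mem w.length (by simp)]
    · simp
    · intro i hi h0
      simp at hi
      rw [if_neg, TensorProduct.tmul_zero]
      simp only [List.length_drop]
      omega

end TensorCoalgebra

/-- `C` is a cofree (conilpotent) coalgebra: it is isomorphic to the tensor coalgebra of a vector
space, with the deconcatenation coproduct. -/
def IsCofree (K : Type u) (C : Type v) [Field K] [AddCommGroup C] [Module K C] [Coalgebra K C] :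
    Prop :=
  ∃ X : Type v, Nonempty (C ≃ₗc[K] TensorCoalgebra K X)

section Dual

variable {K : Type u} {A : Type v} [Field K] [Ring A]

/-- The graded dual of a graded vector space: the linear forms that vanish on all but finitely
many homogeneous components. -/
def gradedDual [Module K A] (𝒜 : ℕ → Submodule K A) : Submodule K (Module.Dual K A) where
  carrier := {f | ∃ N, ∀ n, N ≤ n → ∀ x ∈ 𝒜 n, f x = 0}
  zero_mem' := ⟨0, fun _ _ _ _ => rfl⟩
  add_mem' := by
    rintro f g ⟨M, hM⟩ ⟨N, hN⟩
    refine ⟨max M N, fun n hn x hx => ?_⟩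
    simp [hM n (le_trans (le_max_left _ _) hn) x hx, hN n (le_trans (le_max_right _ _) hn) x hx]
  smul_mem' := by
    rintro c f ⟨N, hN⟩
    exact ⟨N, fun n hn x hx => by simp [hN n hn x hx]⟩

/-- The graded bialgebra `A` is self-dual: there is an isomorphism `φ` of graded bialgebras from
`A` onto its graded dual. The unit of the dual is the counit of `A`, its product is the transpose
of the coproduct of `A`, its counit is the evaluation at `1`, its coproduct is the transpose of the
product of `A`, and its component of degree `n` is formed by the linear forms that vanish on the
components of `A` of degree `m ≠ n`. -/
def IsSelfDual [Bialgebra K A] (𝒜 : ℕ → Submodule K A) : Prop :=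
  ∃ φ : A ≃ₗ[K] gradedDual 𝒜,
    (∀ m n, m ≠ n → ∀ x ∈ 𝒜 n, ∀ y ∈ 𝒜 m, (φ x).1 y = 0) ∧
    (φ 1).1 = Coalgebra.counit ∧
    (∀ x y, (φ (x * y)).1 =
      LinearMap.mul' K K ∘ₗ TensorProduct.map (φ x).1 (φ y).1 ∘ₗ Coalgebra.comul) ∧
    (∀ x, (φ x).1 1 = Coalgebra.counit x) ∧
    (∀ x y z, (φ x).1 (y * z) =
      LinearMap.mul' K K (TensorProduct.map
        ((Module.Dual.eval K A y) ∘ₗ (gradedDual 𝒜).subtype ∘ₗ φ.toLinearMap)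
        ((Module.Dual.eval K A z) ∘ₗ (gradedDual 𝒜).subtype ∘ₗ φ.toLinearMap)
        (Coalgebra.comul x)))

end Dual

attribute [local instance] LieRing.ofAssociativeRing

/-- The Lie algebra of primitive elements of a bialgebra, for the commutator bracket. -/
def primitives (K : Type u) (A : Type v) [Field K] [Ring A] [Bialgebra K A] :
    LieSubalgebra K A where
  carrier := {x | Coalgebra.comul (R := K) x = x ⊗ₜ[K] 1 + 1 ⊗ₜ[K] x}
  zero_mem' := by simp
  add_mem' := by
    intro x y hx hy
    simp only [Set.mem_ofPred_eq] at hx hy ⊢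
    rw [map_add, hx, hy, TensorProduct.add_tmul, TensorProduct.tmul_add]
    abel
  smul_mem' := by
    intro c x hx
    simp only [Set.mem_ofPred_eq] at hx ⊢
    rw [map_smul, hx, smul_add, TensorProduct.smul_tmul', TensorProduct.tmul_smul]
  lie_mem' := by
    intro x y hx hy
    simp only [Set.mem_ofPred_eq] at hx hy ⊢
    rw [Ring.lie_def, map_sub, Bialgebra.comul_mul, Bialgebra.comul_mul, hx, hy]
    simp only [mul_add, add_mul, Algebra.TensorProduct.tmul_mul_tmul, mul_one, one_mul,
      TensorProduct.sub_tmul, TensorProduct.tmul_sub]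
    abel

/-!
Exchanging the roles of the two orders in the product of double posets gives a second unital
product `·` on `H`, compatible with the coproduct in the sense of infinitesimal bialgebras:
`Δ(x · y) = (x ⊗ 1) · Δ y + Δ x · (1 ⊗ y) - x ⊗ y`.

*Cofreeness.* The convolution `f ↦ id ∗ f` for `·` is bijective, being unipotent with respect to
the degree. The solution of `id ∗ f = id - η ∘ ε` takes primitive values, and it follows that every
element is in a unique way a combination of the `(⋯(p₁ · p₂) ⋯) · pₙ` with the `pᵢ` in a basis of
the primitive elements. The coproduct deconcatenates these words.

*Freeness.* The isoclasses form a free monoid, because any two decompositions of a double poset as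
a product are nested (Levi's lemma).

*Self-duality.* A symmetric form with `⟨a b, z⟩ = ⟨a ⊗ b, Δ z⟩` is built degree by degree. On
decomposable elements it is given by this formula, which is consistent because `H` is free. The
infinitesimal product makes every linear form `a ⊗ b ↦ l (a b)` equal to `⟨a ⊗ b, Δ z⟩` for some
`z`, so no nonzero decomposable element is in the radical, and the form extends to a nondegenerate
one in the new degree.

*Characteristic zero.* In a free algebra, homogeneous primitive elements that are linearly
independent modulo the products of an element of positive degree and a primitive one generate a free
algebra. The Dynkin operator `S ⋆ D` shows that they generate the Lie algebra of the primitive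
elements.
-/

/-! ### Connected graded bialgebras -/

section ConnectedGraded

open Coalgebra (comul counit)
open TensorProduct

section ReducedComul

variable (K : Type u) (H : Type v) [CommRing K] [Ring H] [Bialgebra K H]

/-- The projection of a bialgebra onto the kernel of its counit, along the scalars. -/
def augProj : H →ₗ[K] H := LinearMap.id - Algebra.linearMap K H ∘ₗ counit

/-- The reduced coproduct, extended by zero to the scalars. -/
noncomputable def reducedComul : H →ₗ[K] H ⊗[K] H := map (augProj K H) (augProj K H) ∘ₗ comul

variable {K H}

theorem augProj_apply (x : H) : augProj K H x = x - algebraMap K H (counit x) :=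
  rfl

@[simp]
theorem augProj_one : augProj K H 1 = 0 := by
  simp [augProj_apply]

@[simp]
theorem counit_augProj (x : H) : counit (R := K) (augProj K H x) = 0 := by
  simp [augProj_apply]

theorem augProj_of_counit_eq_zero {x : H} (hx : counit (R := K) x = 0) : augProj K H x = x := by
  simp [augProj_apply, hx]

@[simp]
theorem augProj_augProj (x : H) : augProj K H (augProj K H x) = augProj K H x :=
  augProj_of_counit_eq_zero (counit_augProj x)

@[simp]
theorem reducedComul_one : reducedComul K H 1 = 0 := by
  simp [reducedComul, Algebra.TensorProduct.one_def]

theorem comul_eq_reducedComul_add (x : H) : comul (R := K) x =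
    reducedComul K H x + x ⊗ₜ 1 + 1 ⊗ₜ x - counit (R := K) x • (1 : H) ⊗ₜ[K] (1 : H) := by
  have expand (t : H ⊗[K] H) : map (augProj K H) (augProj K H) t =
      t - TensorProduct.rid K H (counit.lTensor H t) ⊗ₜ 1 -
        1 ⊗ₜ TensorProduct.lid K H (counit.rTensor H t) +
        (counit (R := K) (TensorProduct.rid K H (counit.lTensor H t))) • 1 ⊗ₜ 1 := by
    induction t with
    | zero => simp
    | add s t hs ht => simp only [map_add, hs, ht, add_tmul, tmul_add, add_smul]; abel
    | tmul a b =>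
      simp only [map_tmul, augProj_apply, LinearMap.lTensor_tmul, LinearMap.rTensor_tmul, rid_tmul,
        lid_tmul, map_smul, sub_tmul, tmul_sub, Algebra.algebraMap_eq_smul_one, ← smul_tmul',
        tmul_smul, smul_sub, smul_smul, smul_eq_mul]
      abel
  rw [reducedComul, LinearMap.comp_apply, expand, Coalgebra.lTensor_counit_comul,
    Coalgebra.rTensor_counit_comul, rid_tmul, lid_tmul, one_smul]
  abel

theorem comul_eq_iff_reducedComul_eq_zero {x : H} (hx : counit (R := K) x = 0) :
    comul (R := K) x = x ⊗ₜ 1 + 1 ⊗ₜ x ↔ reducedComul K H x = 0 := by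
  rw [comul_eq_reducedComul_add, hx, zero_smul, sub_zero, add_assoc, add_eq_right]

theorem reducedComul_augProj (x : H) : reducedComul K H (augProj K H x) = reducedComul K H x := by
  simp [augProj_apply, Algebra.algebraMap_eq_smul_one]

theorem map_augProj_reducedComul (x : H) :
    map (augProj K H) (augProj K H) (reducedComul K H x) = reducedComul K H x := by
  rw [reducedComul, ← LinearMap.comp_apply, ← LinearMap.comp_assoc, ← map_comp]
  congr 3 <;> exact LinearMap.ext augProj_augProj

theorem rTensor_augProj_eq_self {t : H ⊗[K] H} (ht : map (augProj K H) (augProj K H) t = t) :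
    (augProj K H).rTensor H t = t := by
  rw [← ht, ← LinearMap.comp_apply ((augProj K H).rTensor H), LinearMap.rTensor_comp_map,
    (LinearMap.ext augProj_augProj : augProj K H ∘ₗ augProj K H = augProj K H)]

theorem lTensor_augProj_eq_self {t : H ⊗[K] H} (ht : map (augProj K H) (augProj K H) t = t) :
    (augProj K H).lTensor H t = t := by
  rw [← ht, ← LinearMap.comp_apply ((augProj K H).lTensor H), LinearMap.lTensor_comp_map,
    (LinearMap.ext augProj_augProj : augProj K H ∘ₗ augProj K H = augProj K H)]

theorem reducedComul_coassoc (x : H) :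
    TensorProduct.assoc K H H H ((reducedComul K H).rTensor H (reducedComul K H x)) =
      (reducedComul K H).lTensor H (reducedComul K H x) := by
  have h : reducedComul K H ∘ₗ augProj K H = map (augProj K H) (augProj K H) ∘ₗ comul :=
    LinearMap.ext reducedComul_augProj
  have left : (reducedComul K H).rTensor H ∘ₗ reducedComul K H =
      map (map (augProj K H) (augProj K H)) (augProj K H) ∘ₗ comul.rTensor H ∘ₗ comul := by
    rw [reducedComul, ← LinearMap.comp_assoc, LinearMap.rTensor_comp_map, ← reducedComul, h,
      ← LinearMap.comp_assoc, LinearMap.map_comp_rTensor]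
  have right : (reducedComul K H).lTensor H ∘ₗ reducedComul K H =
      map (augProj K H) (map (augProj K H) (augProj K H)) ∘ₗ comul.lTensor H ∘ₗ comul := by
    rw [reducedComul, ← LinearMap.comp_assoc, LinearMap.lTensor_comp_map, ← reducedComul, h,
      ← LinearMap.comp_assoc, LinearMap.map_comp_lTensor]
  have h₁ := LinearMap.congr_fun left x
  have h₂ := LinearMap.congr_fun right x
  simp only [LinearMap.comp_apply] at h₁ h₂
  rw [h₁, h₂, ← Coalgebra.coassoc_apply, map_map_assoc]

end ReducedComul

section Grading

variable {K : Type u} {H : Type v} [CommRing K] [Ring H]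

/-- The span of the tensors `a ⊗ b` with `a`, `b` homogeneous and `(deg a, deg b) ∈ s`. -/
def tensorDegree [Module K H] (𝒜 : ℕ → Submodule K H) (s : Set (ℕ × ℕ)) :
    Submodule K (H ⊗[K] H) :=
  Submodule.span K {t | ∃ d ∈ s, ∃ a ∈ 𝒜 d.1, ∃ b ∈ 𝒜 d.2, a ⊗ₜ b = t}

/-- A grading of a bialgebra is connected if it is respected by the coproduct and the counit and
its component of degree zero consists of the scalars. -/
class IsConnectedGraded [Bialgebra K H] (𝒜 : ℕ → Submodule K H) : Prop where
  eq_algebraMap_counit {x : H} : x ∈ 𝒜 0 → x = algebraMap K H (counit x)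
  counit_eq_zero {n : ℕ} {x : H} : n ≠ 0 → x ∈ 𝒜 n → counit (R := K) x = 0
  comul_mem {n : ℕ} {x : H} : x ∈ 𝒜 n → comul x ∈ tensorDegree 𝒜 {d | d.1 + d.2 = n}

variable [Bialgebra K H] {𝒜 : ℕ → Submodule K H}

theorem tmul_mem_tensorDegree {s : Set (ℕ × ℕ)} {i j : ℕ} {a b : H} (h : (i, j) ∈ s)
    (ha : a ∈ 𝒜 i) (hb : b ∈ 𝒜 j) : a ⊗ₜ b ∈ tensorDegree 𝒜 s :=
  Submodule.subset_span ⟨(i, j), h, a, ha, b, hb, rfl⟩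

theorem tensorDegree_le {s : Set (ℕ × ℕ)} {S : Submodule K (H ⊗[K] H)}
    (h : ∀ i j, (i, j) ∈ s → ∀ a ∈ 𝒜 i, ∀ b ∈ 𝒜 j, a ⊗ₜ b ∈ S) : tensorDegree 𝒜 s ≤ S := by
  refine Submodule.span_le.2 ?_
  rintro _ ⟨⟨i, j⟩, hd, a, ha, b, hb, rfl⟩
  exact h i j hd a ha b hb

theorem eq_of_mem_tensorDegree {N : Type*} [AddCommGroup N] [Module K N] {s : Set (ℕ × ℕ)}
    {f g : H ⊗[K] H →ₗ[K] N}
    (h : ∀ i j, (i, j) ∈ s → ∀ a ∈ 𝒜 i, ∀ b ∈ 𝒜 j, f (a ⊗ₜ b) = g (a ⊗ₜ b))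
    {t : H ⊗[K] H} (ht : t ∈ tensorDegree 𝒜 s) : f t = g t :=
  tensorDegree_le (S := LinearMap.eqLocus f g) h ht

theorem augProj_of_mem [IsConnectedGraded 𝒜] {n : ℕ} {x : H} (hn : n ≠ 0) (hx : x ∈ 𝒜 n) :
    augProj K H x = x :=
  augProj_of_counit_eq_zero (IsConnectedGraded.counit_eq_zero hn hx)

theorem augProj_of_mem_zero [IsConnectedGraded 𝒜] {x : H} (hx : x ∈ 𝒜 0) : augProj K H x = 0 := by
  rw [augProj_apply, ← IsConnectedGraded.eq_algebraMap_counit hx, sub_self]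

theorem augProj_mem [IsConnectedGraded 𝒜] {n : ℕ} {x : H} (hx : x ∈ 𝒜 n) :
    augProj K H x ∈ 𝒜 n := by
  obtain rfl | hn := eq_or_ne n 0
  · exact augProj_of_mem_zero hx ▸ zero_mem _
  · rwa [augProj_of_mem hn hx]

theorem reducedComul_mem [IsConnectedGraded 𝒜] {n : ℕ} {x : H} (hx : x ∈ 𝒜 n) :
    reducedComul K H x ∈ tensorDegree 𝒜 {d | d.1 + d.2 = n ∧ d.1 ≠ 0 ∧ d.2 ≠ 0} := by
  have le : tensorDegree 𝒜 {d | d.1 + d.2 = n} ≤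
      (tensorDegree 𝒜 {d | d.1 + d.2 = n ∧ d.1 ≠ 0 ∧ d.2 ≠ 0}).comap
        (map (augProj K H) (augProj K H)) := by
    refine tensorDegree_le fun i j hij a ha b hb => ?_
    rw [Submodule.mem_comap, map_tmul]
    obtain rfl | hi := eq_or_ne i 0
    · simp [augProj_of_mem_zero ha]
    obtain rfl | hj := eq_or_ne j 0
    · simp [augProj_of_mem_zero hb]
    · exact tmul_mem_tensorDegree ⟨hij, hi, hj⟩ (augProj_mem ha) (augProj_mem hb)
  exact le (IsConnectedGraded.comul_mem hx)

end Grading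

end ConnectedGraded

/-! ### Infinitesimal products -/

section GradedLinearMaps

variable {K M N : Type*} [CommRing K] [AddCommGroup M] [Module K M] [AddCommGroup N] [Module K N]
  (𝒜 : ℕ → Submodule K M) [DirectSum.Decomposition 𝒜]

theorem exists_linearMap_eq_on_components (f : ℕ → M →ₗ[K] N) :
    ∃ F : M →ₗ[K] N, ∀ n, ∀ x ∈ 𝒜 n, F x = f n x := by
  refine ⟨DirectSum.toModule K ℕ N (fun n => f n ∘ₗ (𝒜 n).subtype) ∘ₗ
    (DirectSum.decomposeLinearEquiv 𝒜).toLinearMap, fun n x hx => ?_⟩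
  rw [LinearMap.comp_apply, LinearEquiv.coe_coe, DirectSum.decomposeLinearEquiv_apply,
    DirectSum.decompose_of_mem 𝒜 hx, ← DirectSum.lof_eq_of K, DirectSum.toModule_lof]
  rfl

variable {𝒜} in
theorem linearMap_ext_on_components {f g : M →ₗ[K] N} (h : ∀ n, ∀ x ∈ 𝒜 n, f x = g x) : f = g :=
  DirectSum.decompose_lhom_ext 𝒜 fun n => LinearMap.ext fun x => h n x x.2

/-- The projection of a graded module onto its component of degree `n`. -/
def degreeProj (n : ℕ) : M →ₗ[K] 𝒜 n :=
  DirectSum.component K ℕ (fun k => 𝒜 k) n ∘ₗ (DirectSum.decomposeLinearEquiv 𝒜).toLinearMap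

variable {𝒜}

@[simp]
theorem degreeProj_coe {n : ℕ} (x : 𝒜 n) : degreeProj 𝒜 n x = x :=
  Subtype.ext (DirectSum.decompose_of_mem_same 𝒜 x.2)

theorem degreeProj_of_mem_ne {n k : ℕ} (hk : k ≠ n) {x : M} (hx : x ∈ 𝒜 k) :
    degreeProj 𝒜 n x = 0 :=
  Subtype.ext (DirectSum.decompose_of_mem_ne 𝒜 hx hk)

variable (𝒜) in
theorem eq_of_degreeProj_eq {x y : M} (h : ∀ n, degreeProj 𝒜 n x = degreeProj 𝒜 n y) : x = y :=
  (DirectSum.decompose 𝒜).injective (DFinsupp.ext h)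

theorem apply_degreeProj {n : ℕ} {f : M →ₗ[K] N} (hf : ∀ k ≠ n, ∀ x ∈ 𝒜 k, f x = 0) (x : M) :
    f (degreeProj 𝒜 n x) = f x := by
  refine LinearMap.congr_fun (f := f ∘ₗ (𝒜 n).subtype ∘ₗ degreeProj 𝒜 n) (g := f)
    (linearMap_ext_on_components (𝒜 := 𝒜) fun k x hx => ?_) x
  obtain rfl | hk := eq_or_ne k n
  · exact congrArg (fun y : 𝒜 k => f y) (degreeProj_coe ⟨x, hx⟩)
  · simp [degreeProj_of_mem_ne hk hx, hf k hk x hx]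

variable (𝒜) in
theorem bijective_of_unipotent_on_components (F : (M →ₗ[K] N) →ₗ[K] M →ₗ[K] N)
    (hF : ∀ n f, (∀ k < n, ∀ x ∈ 𝒜 k, f x = 0) → ∀ k ≤ n, ∀ x ∈ 𝒜 k, F f x = f x) :
    Function.Bijective F := by
  refine ⟨(injective_iff_map_eq_zero F).2 fun f hf => linearMap_ext_on_components (𝒜 := 𝒜) ?_,
    fun g => ?_⟩
  · intro n
    induction n using Nat.strong_induction_on with
    | h n ih => intro x hx; rw [← hF n f ih n le_rfl x hx, hf]
  let s : ℕ → M →ₗ[K] N := fun n => n.rec 0 fun _ f => f + (g - F f)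
  have residue (n : ℕ) : ∀ k < n, ∀ x ∈ 𝒜 k, (g - F (s n)) x = 0 := by
    induction n with
    | zero => simp
    | succ n ih =>
      intro k hk x hx
      have := hF n _ ih k (Nat.lt_succ_iff.1 hk) x hx
      rw [show s (n + 1) = s n + (g - F (s n)) from rfl, map_add, ← sub_sub, LinearMap.sub_apply,
        this, sub_self]
  have stable (n k : ℕ) : ∀ x ∈ 𝒜 n, s (n + 1 + k) x = s (n + 1) x := by
    induction k with
    | zero => simp
    | succ k ih =>
      intro x hx
      rw [← ih x hx, ← sub_eq_zero, ← LinearMap.sub_apply, ← residue (n + 1 + k) n (by lia) x hx]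
      exact LinearMap.congr_fun (add_sub_cancel_left _ _) x
  obtain ⟨f, hf⟩ := exists_linearMap_eq_on_components 𝒜 fun n => s (n + 1)
  refine ⟨f, linearMap_ext_on_components (𝒜 := 𝒜) fun n x hx => ?_⟩
  have close : ∀ k < n + 1, ∀ x ∈ 𝒜 k, (f - s (n + 1)) x = 0 := by
    intro k hk x hx
    obtain ⟨d, hd⟩ := Nat.exists_eq_add_of_le (Nat.succ_le_of_lt hk)
    rw [LinearMap.sub_apply, hf k x hx, hd, stable k d x hx, sub_self]
  have hsum : F f x = F (f - s (n + 1)) x + F (s (n + 1)) x := by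
    rw [map_sub, LinearMap.sub_apply, sub_add_cancel]
  have hres := residue (n + 1) n n.lt_succ_self x hx
  rw [hsum, hF _ _ close n n.le_succ x hx, close n n.lt_succ_self x hx, zero_add]
  exact (sub_eq_zero.1 hres).symm

end GradedLinearMaps

section InfinitesimalProduct

open Coalgebra (comul counit)
open TensorProduct

/-- A unital operation on a bialgebra satisfying the compatibility of infinitesimal bialgebras,
`Δ(x · y) = (x ⊗ 1) · Δ y + Δ x · (1 ⊗ y) - x ⊗ y`. Associativity is not required. -/
structure InfinitesimalProduct (K : Type u) (H : Type v) [Field K] [Ring H] [Bialgebra K H] where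
  op : H →ₗ[K] H →ₗ[K] H
  one_op (x : H) : op 1 x = x
  op_one (x : H) : op x 1 = x
  comul_op (x y : H) : comul (op x y) =
    (op x).rTensor H (comul y) + (op.flip y).lTensor H (comul x) - x ⊗ₜ[K] y

variable {K : Type u} {H : Type v} [Field K] [Ring H] [Bialgebra K H]

theorem mem_primitives {x : H} :
    x ∈ primitives K H ↔ comul (R := K) x = x ⊗ₜ 1 + 1 ⊗ₜ x :=
  Iff.rfl

theorem counit_of_mem_primitives {x : H} (hx : x ∈ primitives K H) : counit (R := K) x = 0 := by
  have h := congrArg (fun t => counit (R := K) (TensorProduct.lid K H (counit.rTensor H t)))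
    (mem_primitives.1 hx)
  simpa using h

theorem mem_primitives_iff_reducedComul {x : H} :
    x ∈ primitives K H ↔ counit (R := K) x = 0 ∧ reducedComul K H x = 0 :=
  ⟨fun hx => ⟨counit_of_mem_primitives hx,
    (comul_eq_iff_reducedComul_eq_zero (counit_of_mem_primitives hx)).1 hx⟩,
    fun hx => (comul_eq_iff_reducedComul_eq_zero hx.1).2 hx.2⟩

namespace InfinitesimalProduct

variable (r : InfinitesimalProduct K H)

/-- The map `x ⊗ y ↦ x · f y`. -/
def twist (f : H →ₗ[K] H) : H ⊗[K] H →ₗ[K] H := TensorProduct.lift (r.op.compl₂ f)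

/-- The convolution of the identity and `f` for the infinitesimal product. -/
def conv : (H →ₗ[K] H) →ₗ[K] H →ₗ[K] H where
  toFun f := r.twist f ∘ₗ comul
  map_add' f g := by
    rw [← LinearMap.add_comp]; congr 1; ext; simp [twist]
  map_smul' c f := by
    rw [RingHom.id_apply, ← LinearMap.smul_comp]; congr 1; ext; simp [twist]

@[simp]
theorem twist_tmul (f : H →ₗ[K] H) (x y : H) : r.twist f (x ⊗ₜ y) = r.op x (f y) :=
  rfl

theorem conv_apply (f : H →ₗ[K] H) (x : H) : r.conv f x = r.twist f (comul x) :=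
  rfl

theorem conv_eq_add (f : H →ₗ[K] H) (x : H) : r.conv f x =
    r.twist f (reducedComul K H x) + f x + r.op (augProj K H x) (f 1) := by
  simp only [conv_apply, comul_eq_reducedComul_add x, map_sub, map_add, twist_tmul, one_op,
    map_smul, augProj_apply, Algebra.algebraMap_eq_smul_one, LinearMap.sub_apply,
    LinearMap.smul_apply]
  abel

theorem conv_bijective (𝒜 : ℕ → Submodule K H) [GradedAlgebra 𝒜] [IsConnectedGraded 𝒜] :
    Function.Bijective r.conv := by
  refine bijective_of_unipotent_on_components 𝒜 r.conv fun n f hf k hk x hx => ?_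
  have twist_eq_zero : r.twist f (reducedComul K H x) = 0 :=
    eq_of_mem_tensorDegree (g := 0)
      (fun i j hij a _ b hb => by simp [hf j (by have := hij.1; have := hij.2.1; lia) b hb])
      (reducedComul_mem hx)
  have op_eq_zero : r.op (augProj K H x) (f 1) = 0 := by
    obtain rfl | hk₀ := eq_or_ne k 0
    · simp [augProj_of_mem_zero hx]
    · simp [hf 0 (by lia) 1 SetLike.GradedOne.one_mem]
  rw [conv_eq_add, twist_eq_zero, op_eq_zero, zero_add, add_zero]

theorem comul_op_of_mem_primitives (x : H) {p : H} (hp : p ∈ primitives K H) :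
    comul (r.op x p) = r.op x p ⊗ₜ 1 + (r.op.flip p).lTensor H (comul x) := by
  rw [comul_op, mem_primitives.1 hp]
  simp only [map_add, LinearMap.rTensor_tmul, op_one]
  abel

theorem counit_op_of_mem_primitives (x : H) {p : H} (hp : p ∈ primitives K H) :
    counit (R := K) (r.op x p) = 0 := by
  have h := congrArg (fun t => TensorProduct.lid K H (counit.rTensor H t))
    (r.comul_op_of_mem_primitives x hp)
  have h' : TensorProduct.lid K H (counit.rTensor H ((r.op.flip p).lTensor H (comul x))) =
      r.op x p := by
    rw [← LinearMap.comp_apply (counit.rTensor H), LinearMap.rTensor_comp_lTensor,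
      ← LinearMap.lTensor_comp_rTensor, LinearMap.comp_apply, Coalgebra.rTensor_counit_comul]
    simp
  simp only [map_add, Coalgebra.rTensor_counit_comul, LinearMap.rTensor_tmul, lid_tmul, one_smul,
    h', right_eq_add] at h
  simpa using congrArg (counit (R := K)) h

theorem reducedComul_op_of_mem_primitives (x : H) {p : H} (hp : p ∈ primitives K H) :
    reducedComul K H (r.op x p) =
      (r.op.flip p).lTensor H (reducedComul K H x) + augProj K H x ⊗ₜ p := by
  have aug_op : augProj K H ∘ₗ r.op.flip p = r.op.flip p := LinearMap.ext fun y =>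
    augProj_of_counit_eq_zero (r.counit_op_of_mem_primitives y hp)
  have h : (augProj K H).rTensor H (comul x) =
      (reducedComul K H x) + augProj K H x ⊗ₜ 1 := by
    rw [comul_eq_reducedComul_add x, map_sub, map_add, map_add,
      rTensor_augProj_eq_self (map_augProj_reducedComul x)]
    simp
  rw [reducedComul, LinearMap.comp_apply, comul_op_of_mem_primitives r x hp, map_add, map_tmul,
    augProj_one, tmul_zero, zero_add, ← LinearMap.comp_apply (map _ _), LinearMap.map_comp_lTensor,
    aug_op, ← LinearMap.lTensor_comp_rTensor, LinearMap.comp_apply, h, map_add,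
    LinearMap.lTensor_tmul, LinearMap.flip_apply, one_op]
  rfl

/-- The tensors `∑ xᵢ ⊗ yᵢ` such that each `f yᵢ` is primitive. -/
def primitiveTensors (f : H →ₗ[K] H) : Submodule K (H ⊗[K] H) :=
  LinearMap.range (((primitives K H).toSubmodule.comap f).subtype.lTensor H)

theorem tmul_mem_primitiveTensors {f : H →ₗ[K] H} (x : H) {y : H} (hy : f y ∈ primitives K H) :
    x ⊗ₜ y ∈ primitiveTensors f :=
  ⟨x ⊗ₜ ⟨y, hy⟩, rfl⟩

variable {r} {f : H →ₗ[K] H} {t : H ⊗[K] H}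

theorem eq_of_mem_primitiveTensors {N : Type*} [AddCommGroup N] [Module K N]
    {φ ψ : H ⊗[K] H →ₗ[K] N}
    (h : ∀ x y, f y ∈ primitives K H → φ (x ⊗ₜ y) = ψ (x ⊗ₜ y)) (ht : t ∈ primitiveTensors f) :
    φ t = ψ t := by
  obtain ⟨s, rfl⟩ := ht
  rw [← LinearMap.comp_apply, ← LinearMap.comp_apply]
  congr 1
  ext x y
  exact h x y y.2

theorem counit_twist (ht : t ∈ primitiveTensors f) : counit (R := K) (r.twist f t) = 0 :=
  eq_of_mem_primitiveTensors (φ := counit ∘ₗ r.twist f) (ψ := 0)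
    (fun x _ hy => r.counit_op_of_mem_primitives x hy) ht

theorem reducedComul_twist (ht : t ∈ primitiveTensors f) : reducedComul K H (r.twist f t) =
    (r.twist f).lTensor H (TensorProduct.assoc K H H H ((reducedComul K H).rTensor H t)) +
      map (augProj K H) f t := by
  refine eq_of_mem_primitiveTensors (φ := reducedComul K H ∘ₗ r.twist f)
    (ψ := (r.twist f).lTensor H ∘ₗ (TensorProduct.assoc K H H H).toLinearMap ∘ₗ
      (reducedComul K H).rTensor H + map (augProj K H) f) (fun x y hy => ?_) ht
  have assoc_tmul (s : H ⊗[K] H) : (r.twist f).lTensor H (TensorProduct.assoc K H H H (s ⊗ₜ y)) =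
      (r.op.flip (f y)).lTensor H s := by
    induction s with
    | zero => simp
    | add s₁ s₂ h₁ h₂ => simp only [add_tmul, map_add, h₁, h₂]
    | tmul a b => rfl
  simp only [LinearMap.comp_apply, LinearMap.add_apply, LinearEquiv.coe_coe,
    LinearMap.rTensor_tmul, assoc_tmul, map_tmul, twist_tmul]
  exact r.reducedComul_op_of_mem_primitives x hy

section PrimitiveProjection

variable (hf : r.conv f = augProj K H)
include hf

theorem apply_one_of_conv_eq : f 1 = 0 := by
  have h := LinearMap.congr_fun hf 1
  rwa [conv_eq_add, reducedComul_one, map_zero, zero_add, augProj_one, map_zero,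
    LinearMap.zero_apply, add_zero] at h

theorem twist_reducedComul (x : H) :
    r.twist f (reducedComul K H x) = augProj K H x - f x := by
  rw [← hf, conv_eq_add, apply_one_of_conv_eq hf, map_zero, add_zero, add_sub_cancel_right]

theorem reducedComul_twist_eq_self (ht : t ∈ primitiveTensors f)
    (pos : map (augProj K H) (augProj K H) t = t)
    (coassoc : TensorProduct.assoc K H H H ((reducedComul K H).rTensor H t) =
      (reducedComul K H).lTensor H t) :
    reducedComul K H (r.twist f t) = t := by
  have h : r.twist f ∘ₗ reducedComul K H = augProj K H - f := LinearMap.ext (twist_reducedComul hf)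
  rw [reducedComul_twist ht, coassoc, ← LinearMap.comp_apply, ← LinearMap.lTensor_comp, h,
    LinearMap.lTensor_sub, LinearMap.sub_apply, lTensor_augProj_eq_self pos,
    ← LinearMap.lTensor_comp_rTensor, LinearMap.comp_apply, rTensor_augProj_eq_self pos,
    sub_add_cancel]

theorem apply_mem_primitives_of_conv_eq (𝒜 : ℕ → Submodule K H) [GradedAlgebra 𝒜]
    [IsConnectedGraded 𝒜] (x : H) : f x ∈ primitives K H := by
  suffices h : ∀ n, ∀ x ∈ 𝒜 n, f x ∈ primitives K H from
    DirectSum.Decomposition.inductionOn 𝒜 (by simp) (fun y => h _ y y.2)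
      (fun x y hx hy => by rw [map_add]; exact add_mem hx hy) x
  intro n
  induction n using Nat.strong_induction_on with
  | h n ih =>
  intro x hx
  have ht : reducedComul K H x ∈ primitiveTensors f :=
    tensorDegree_le (fun i j hij a _ b hb => tmul_mem_primitiveTensors a
      (ih j (by have := hij.1; have := hij.2.1; lia) b hb)) (reducedComul_mem hx)
  have f_eq : f x = augProj K H x - r.twist f (reducedComul K H x) := by
    rw [twist_reducedComul hf, sub_sub_cancel]
  rw [mem_primitives_iff_reducedComul, f_eq, map_sub, map_sub, counit_augProj, counit_twist ht,
    reducedComul_augProj, reducedComul_twist_eq_self hf ht (map_augProj_reducedComul x)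
      (reducedComul_coassoc x), sub_self, sub_self]
  exact ⟨rfl, rfl⟩

end PrimitiveProjection

end InfinitesimalProduct

end InfinitesimalProduct

section Cofree

open Coalgebra (comul counit)
open TensorProduct

theorem TensorCoalgebra.deconc_append_singleton (K : Type u) {X : Type v} [Field K] (w : List X)
    (x : X) : deconc K (w ++ [x]) =
      (lift K X fun v => word K (v ++ [x])).lTensor _ (deconc K w) +
        word K (w ++ [x]) ⊗ₜ word K [] := by
  rw [deconc, List.length_append, List.length_singleton, Finset.sum_range_succ, deconc, map_sum,
    List.take_of_length_le (by simp), List.drop_of_length_le (by simp)]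
  congr 1
  refine Finset.sum_congr rfl fun i hi => ?_
  have hi : i ≤ w.length := Nat.lt_succ_iff.1 (Finset.mem_range.1 hi)
  rw [List.take_append_of_le_length hi, List.drop_append_of_le_length hi, LinearMap.lTensor_tmul,
    lift_word]

variable {K : Type u} {H : Type v} [Field K] [Ring H] [Bialgebra K H]
  (r : InfinitesimalProduct K H)

/-- The action `x ↦ ∑ c(x₂) x₁` of a functional `c` on a coalgebra. -/
noncomputable def peel (c : Module.Dual K H) : H →ₗ[K] H :=
  (TensorProduct.rid K H).toLinearMap ∘ₗ c.lTensor H ∘ₗ comul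

theorem peel_counit : peel (counit : Module.Dual K H) = LinearMap.id := by
  ext x; simp [peel]

namespace InfinitesimalProduct

theorem peel_op_of_mem_primitives {c : Module.Dual K H} (c_one : c 1 = 0) (x : H) {p : H}
    (hp : p ∈ primitives K H) : peel c (r.op x p) = peel (c ∘ₗ r.op.flip p) x := by
  rw [peel, LinearMap.comp_apply, LinearMap.comp_apply, r.comul_op_of_mem_primitives x hp, map_add,
    LinearMap.lTensor_tmul, c_one, tmul_zero, zero_add, ← LinearMap.comp_apply (c.lTensor H),
    ← LinearMap.lTensor_comp]
  rfl

section Words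

variable {X : Type*} (p : X → H)

/-- The map `T(X) → H` sending a word `x₁ ⋯ xₙ` to `(⋯(p x₁ · p x₂) ⋯) · p xₙ`. -/
noncomputable def wordMap : TensorCoalgebra K X →ₗ[K] H :=
  TensorCoalgebra.lift K X (List.foldl (fun h x => r.op h (p x)) 1)

@[simp]
theorem wordMap_nil : r.wordMap p (TensorCoalgebra.word K []) = 1 :=
  TensorCoalgebra.lift_word K _ []

theorem wordMap_append_singleton (w : List X) (x : X) :
    r.wordMap p (TensorCoalgebra.word K (w ++ [x])) =
      r.op (r.wordMap p (TensorCoalgebra.word K w)) (p x) := by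
  rw [wordMap, TensorCoalgebra.lift_word, TensorCoalgebra.lift_word, List.foldl_append]
  rfl

variable {p} (hp : ∀ x, p x ∈ primitives K H)
include hp

theorem comul_wordMap (w : List X) : comul (r.wordMap p (TensorCoalgebra.word K w)) =
    map (r.wordMap p) (r.wordMap p) (TensorCoalgebra.deconc K w) := by
  have append (x : X) : r.wordMap p ∘ₗ TensorCoalgebra.lift K X
      (fun v => TensorCoalgebra.word K (v ++ [x])) = r.op.flip (p x) ∘ₗ r.wordMap p := by
    refine TensorCoalgebra.linearMap_ext K X fun v => ?_
    rw [LinearMap.comp_apply, TensorCoalgebra.lift_word, wordMap_append_singleton]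
    rfl
  induction w using List.reverseRecOn with
  | nil => simp [TensorCoalgebra.deconc, Algebra.TensorProduct.one_def]
  | append_singleton w x ih =>
    rw [wordMap_append_singleton, r.comul_op_of_mem_primitives _ (hp x), ih,
      TensorCoalgebra.deconc_append_singleton, map_add, map_tmul, wordMap_nil,
      wordMap_append_singleton, add_comm, ← LinearMap.comp_apply (LinearMap.lTensor _ _),
      LinearMap.lTensor_comp_map, ← append, ← LinearMap.comp_apply (map _ _),
      LinearMap.map_comp_lTensor]

theorem counit_wordMap (w : List X) : counit (R := K) (r.wordMap p (TensorCoalgebra.word K w)) =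
    counit (TensorCoalgebra.word K w) := by
  rw [show counit (TensorCoalgebra.word K w) = _ from TensorCoalgebra.lift_word K _ w]
  induction w using List.reverseRecOn with
  | nil => simp
  | append_singleton w x => simp [wordMap_append_singleton, r.counit_op_of_mem_primitives _ (hp x)]

/-- The map `T(X) → H` attached to a family of primitive elements is a morphism of coalgebras. -/
noncomputable def wordCoalgHom : TensorCoalgebra K X →ₗc[K] H where
  toLinearMap := r.wordMap p
  counit_comp := TensorCoalgebra.linearMap_ext K X (r.counit_wordMap hp)
  map_comp_comul := TensorCoalgebra.linearMap_ext K X fun w => by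
    simp only [LinearMap.comp_apply, comul_wordMap r hp]
    rw [show comul (TensorCoalgebra.word K w) = _ from TensorCoalgebra.lift_word K _ w]

open Classical in
theorem wordMap_injective {c : X → Module.Dual K H} (c_one : ∀ x, c x 1 = 0)
    (c_op : ∀ x y h, c x (r.op h (p y)) = if x = y then counit (R := K) h else 0) :
    Function.Injective (r.wordMap p) := by
  have peel_op (x y : X) (h : H) : peel (c x) (r.op h (p y)) = if x = y then h else 0 := by
    have comp_eq : c x ∘ₗ r.op.flip (p y) = if x = y then counit else 0 := by
      ext h; rw [LinearMap.comp_apply, LinearMap.flip_apply, c_op]; split_ifs <;> rfl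
    rw [r.peel_op_of_mem_primitives (c_one x) h (hp y), comp_eq]
    split_ifs
    · rw [peel_counit, LinearMap.id_apply]
    · simp [peel]
  let coeff (w : List X) : Module.Dual K H := w.foldl (fun l x => l ∘ₗ peel (c x)) counit
  have coeff_append (w : List X) (x : X) : coeff (w ++ [x]) = coeff w ∘ₗ peel (c x) := by
    simp only [coeff, List.foldl_append]; rfl
  have peel_one (x : X) : peel (c x) 1 = 0 := by
    simp [peel, Algebra.TensorProduct.one_def, c_one]
  have coeff_wordMap (v w : List X) :
      coeff v (r.wordMap p (TensorCoalgebra.word K w)) = if w = v then 1 else 0 := by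
    induction v using List.reverseRecOn generalizing w with
    | nil =>
      refine (r.counit_wordMap hp w).trans ((TensorCoalgebra.lift_word K _ w).trans ?_)
      simp
    | append_singleton v x ih =>
      rw [coeff_append, LinearMap.comp_apply]
      induction w using List.reverseRecOn with
      | nil => simp [peel_one]
      | append_singleton w y _ =>
        rw [wordMap_append_singleton, peel_op]
        split_ifs with hxy hw hw <;> simp_all
  have coeff_comp (v : List X) : coeff v ∘ₗ r.wordMap p = Finsupp.lapply v :=
    TensorCoalgebra.linearMap_ext K X fun w =>
      (coeff_wordMap v w).trans Finsupp.single_apply.symm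
  refine (injective_iff_map_eq_zero _).2 fun s hs => Finsupp.ext fun v => ?_
  have := LinearMap.congr_fun (coeff_comp v) s
  rw [LinearMap.comp_apply, hs, map_zero] at this
  exact this.symm

end Words

section Graded

variable (𝒜 : ℕ → Submodule K H) [GradedAlgebra 𝒜] [IsConnectedGraded 𝒜]
  {f : H →ₗ[K] H} (hf : r.conv f = augProj K H)
include 𝒜 hf

theorem apply_op_of_mem_primitives (x : H) {p : H} (hp : p ∈ primitives K H) :
    f (r.op x p) = counit (R := K) x • p := by
  have left : r.conv (f ∘ₗ r.op.flip p) = r.op.flip p := by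
    ext x
    have h (t : H ⊗[K] H) :
        r.twist (f ∘ₗ r.op.flip p) t = r.twist f ((r.op.flip p).lTensor H t) := by
      rw [← LinearMap.comp_apply (r.twist f)]; congr 1; ext; rfl
    have key := LinearMap.congr_fun hf (r.op x p)
    rwa [conv_apply, r.comul_op_of_mem_primitives x hp, map_add, twist_tmul,
      apply_one_of_conv_eq hf, map_zero, zero_add, ← h,
      augProj_of_counit_eq_zero (r.counit_op_of_mem_primitives x hp)] at key
  have right : r.conv (counit.smulRight p) = r.op.flip p := by
    ext x
    have h (t : H ⊗[K] H) : r.twist (counit.smulRight p) t =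
        r.op (TensorProduct.rid K H (counit.lTensor H t)) p := by
      induction t with
      | zero => simp
      | add s t hs ht => simp only [map_add, hs, ht, LinearMap.add_apply]
      | tmul a b => simp
    simp [conv_apply, h]
  exact LinearMap.congr_fun ((r.conv_bijective 𝒜).1 (left.trans right.symm)) x

theorem wordMap_surjective {X : Type*} (b : Module.Basis X K (primitives K H)) :
    Function.Surjective (r.wordMap fun x => (b x : H)) := by
  set Φ := r.wordMap fun x => (b x : H)
  have op_mem {h q : H} (hh : h ∈ LinearMap.range Φ) (hq : q ∈ primitives K H) :
      r.op h q ∈ LinearMap.range Φ := by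
    obtain ⟨s, rfl⟩ := hh
    have span_le : (⊤ : Submodule K (primitives K H)) ≤
        (LinearMap.range Φ).comap (r.op (Φ s) ∘ₗ (primitives K H).toSubmodule.subtype) := by
      rw [← b.span_eq, Submodule.span_le]
      rintro _ ⟨x, rfl⟩
      refine ⟨TensorCoalgebra.lift K X (fun v => TensorCoalgebra.word K (v ++ [x])) s, ?_⟩
      rw [← LinearMap.comp_apply, (TensorCoalgebra.linearMap_ext K X fun v => ?_ :
        Φ ∘ₗ _ = r.op.flip (b x : H) ∘ₗ Φ)]
      · rfl
      · rw [LinearMap.comp_apply, TensorCoalgebra.lift_word]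
        exact r.wordMap_append_singleton _ v x
    exact span_le (Submodule.mem_top (x := ⟨q, hq⟩))
  have one_mem : 1 ∈ LinearMap.range Φ := ⟨_, r.wordMap_nil _⟩
  rw [← LinearMap.range_eq_top, eq_top_iff]
  suffices h : ∀ n, 𝒜 n ≤ LinearMap.range Φ from fun x _ =>
    DirectSum.Decomposition.inductionOn 𝒜 (zero_mem _) (fun y => h _ y.2)
      (fun x y => add_mem) x
  intro n
  induction n using Nat.strong_induction_on with
  | h n ih =>
  intro x hx
  have aug_mem : augProj K H x ∈ LinearMap.range Φ := by
    rw [← hf, conv_apply]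
    refine tensorDegree_le (S := (LinearMap.range Φ).comap (r.twist f))
      (fun i j hij a ha b hb => ?_) (IsConnectedGraded.comul_mem hx)
    obtain rfl | hj := eq_or_ne j 0
    · rw [IsConnectedGraded.eq_algebraMap_counit hb, Algebra.algebraMap_eq_smul_one,
        Submodule.mem_comap, twist_tmul, map_smul, apply_one_of_conv_eq hf]
      simp
    · exact op_mem (ih i (by have : i + j = n := hij; lia) ha)
        (apply_mem_primitives_of_conv_eq hf 𝒜 b)
  rw [augProj_apply, Algebra.algebraMap_eq_smul_one] at aug_mem
  exact (Submodule.sub_mem_iff_left _ (Submodule.smul_mem _ _ one_mem)).1 aug_mem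

end Graded

end InfinitesimalProduct

include r in
theorem isCofree_of_infinitesimalProduct (𝒜 : ℕ → Submodule K H) [GradedAlgebra 𝒜]
    [IsConnectedGraded 𝒜] : IsCofree K H := by
  classical
  obtain ⟨f, hf⟩ := (r.conv_bijective 𝒜).2 (augProj K H)
  let b := Module.Basis.ofVectorSpace K (primitives K H)
  let f' : H →ₗ[K] primitives K H := f.codRestrict (primitives K H).toSubmodule
    (InfinitesimalProduct.apply_mem_primitives_of_conv_eq hf 𝒜)
  have f'_one : f' 1 = 0 := Subtype.ext (InfinitesimalProduct.apply_one_of_conv_eq hf)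
  have f'_op (x : H) (p : primitives K H) : f' (r.op x p) = counit (R := K) x • p :=
    Subtype.ext (r.apply_op_of_mem_primitives 𝒜 hf x p.2)
  have inj := r.wordMap_injective (p := fun x => (b x : H)) (fun x => (b x).2)
    (c := fun x => b.coord x ∘ₗ f') (fun x => by simp [f'_one])
    (fun x y h => by simp [f'_op, Finsupp.single_apply, eq_comm])
  exact ⟨_, ⟨(CoalgEquiv.ofBijective (f := r.wordCoalgHom fun x => (b x).2)
    ⟨inj, r.wordMap_surjective 𝒜 hf b⟩).symm⟩⟩

end Cofree

/-! ### Free generators of an augmented algebra -/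

section FreeGenerators

theorem exists_free_generators {K : Type u} {A : Type v} [Field K] [Ring A] [Algebra K A]
    (h : IsFreeAlgebra K A) (ε : A →ₐ[K] K) : ∃ (X : Type v) (g : X → A),
      Function.Bijective (FreeAlgebra.lift K g) ∧ ∀ x, ε (g x) = 0 := by
  obtain ⟨X, ⟨e⟩⟩ := h
  let c (x : X) : K := ε (e.symm (FreeAlgebra.ι K x))
  let shift (s : X → K) : FreeAlgebra K X →ₐ[K] FreeAlgebra K X :=
    FreeAlgebra.lift K fun x => FreeAlgebra.ι K x + algebraMap K _ (s x)
  have shift_neg (s : X → K) : (shift s).comp (shift (-s)) = AlgHom.id K _ := by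
    ext x; simp [shift]
  let τ : FreeAlgebra K X ≃ₐ[K] FreeAlgebra K X := AlgEquiv.ofAlgHom (shift (-c)) (shift c)
    (by simpa using shift_neg (-c)) (shift_neg c)
  refine ⟨X, fun x => e.symm (τ (FreeAlgebra.ι K x)), ?_, fun x => ?_⟩
  · convert (τ.trans e.symm).bijective using 1
    refine congrArg DFunLike.coe (?_ : _ = (τ.trans e.symm).toAlgHom)
    ext x
    simp
  · simp [τ, shift, c]

variable {K : Type*} {A : Type*} {N : Type*} {X : Type*} [Field K] [Ring A] [Algebra K A]
  [AddCommGroup N] [Module K N] {g : X → A}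

/-- The basis of the words in free generators. -/
noncomputable def wordBasis (hg : Function.Bijective (FreeAlgebra.lift K g)) :
    Module.Basis (List X) K A :=
  ((FreeAlgebra.basisFreeMonoid K X).map
    (AlgEquiv.ofBijective (FreeAlgebra.lift K g) hg).toLinearEquiv).reindex FreeMonoid.toList

theorem wordBasis_apply (hg : Function.Bijective (FreeAlgebra.lift K g)) (w : List X) :
    wordBasis hg w = (w.map g).prod := by
  simp [wordBasis, FreeAlgebra.basisFreeMonoid, FreeAlgebra.equivMonoidAlgebraFreeMonoid,
    map_list_prod, Function.comp_def]

variable (hg : Function.Bijective (FreeAlgebra.lift K g))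
include hg

theorem linearMap_ext_generator_mul {f f' : A →ₗ[K] N} (h_one : f 1 = f' 1)
    (h_mul : ∀ x a, f (g x * a) = f' (g x * a)) : f = f' := by
  refine (wordBasis hg).ext fun w => ?_
  cases w with
  | nil => simpa [wordBasis_apply] using h_one
  | cons x w => simpa [wordBasis_apply] using h_mul x (w.map g).prod

theorem exists_linearMap_generator_mul (T : X → A →ₗ[K] N) :
    ∃ l : A →ₗ[K] N, l 1 = 0 ∧ ∀ x a, l (g x * a) = T x a := by
  let l : A →ₗ[K] N := (wordBasis hg).constr K fun
    | [] => 0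
    | x :: w => T x (wordBasis hg w)
  have l_cons (x : X) : l ∘ₗ LinearMap.mulLeft K (g x) = T x := by
    refine (wordBasis hg).ext fun w => ?_
    have : g x * wordBasis hg w = wordBasis hg (x :: w) := by simp [wordBasis_apply]
    rw [LinearMap.comp_apply, LinearMap.mulLeft_apply, this, Module.Basis.constr_basis]
  have l_nil := (wordBasis hg).constr_basis K (M' := N) (fun
    | [] => 0
    | x :: w => T x (wordBasis hg w)) []
  rw [wordBasis_apply, List.map_nil, List.prod_nil] at l_nil
  exact ⟨l, l_nil, fun x => LinearMap.congr_fun (l_cons x)⟩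

theorem exists_linearMap_mul_eq {ε : A →ₐ[K] K} (hε : ∀ x, ε (g x) = 0) (B : A →ₗ[K] A →ₗ[K] N)
    (hB : ∀ a b c, ε a = 0 → ε b = 0 → ε c = 0 → B (a * b) c = B a (b * c)) :
    ∃ l : A →ₗ[K] N, ∀ a b, ε a = 0 → ε b = 0 → l (a * b) = B a b := by
  let π : A →ₗ[K] A := LinearMap.id - Algebra.linearMap K A ∘ₗ ε.toLinearMap
  have π_apply (a : A) : π a = a - algebraMap K A (ε a) := rfl
  have ε_π (a : A) : ε (π a) = 0 := by simp [π_apply]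
  obtain ⟨l, -, l_mul⟩ := exists_linearMap_generator_mul hg fun x => B (g x) ∘ₗ π
  refine ⟨l, fun a b ha hb => ?_⟩
  suffices h : l ∘ₗ LinearMap.mulRight K b = ε.toLinearMap.smulRight (l b) + B.flip b ∘ₗ π by
    simpa [ha, π_apply] using LinearMap.congr_fun h a
  refine linearMap_ext_generator_mul hg (by simp [π_apply]) fun x a => ?_
  have π_mul : π (a * b) = π a * b + ε a • b := by
    simp [π_apply, hb, sub_mul, Algebra.smul_def]
  have g_mul : g x * a = g x * π a + ε a • g x := by
    simp [π_apply, mul_sub, Algebra.smul_def, Algebra.commutes]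
  have π_g : π (g x * a) = g x * a := by simp [π_apply, hε]
  simp only [LinearMap.comp_apply, LinearMap.mulRight_apply, mul_assoc, l_mul, π_mul, map_add,
    map_smul, LinearMap.add_apply, LinearMap.smulRight_apply, AlgHom.toLinearMap_apply, map_mul,
    hε, zero_mul, zero_smul, zero_add, π_g, LinearMap.flip_apply]
  conv_rhs => rw [g_mul]
  rw [map_add, LinearMap.add_apply, map_smul, LinearMap.smul_apply, hB _ _ _ (hε x) (ε_π a) hb]

section Fox

variable {ε : A →ₐ[K] K} (hε : ∀ x, ε (g x) = 0)
include hε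

open Classical in
theorem exists_foxDerivative : ∃ D : X → A →ₗ[K] A,
    (∀ x a b, D x (a * b) = D x a * b + ε a • D x b) ∧
    (wordBasis hg).coord [] = ε ∧
    ∀ x w, (wordBasis hg).coord (x :: w) = (wordBasis hg).coord w ∘ₗ D x := by
  choose D D_one D_mul using fun x => exists_linearMap_generator_mul hg (N := A)
    fun y => if y = x then LinearMap.id else 0
  refine ⟨D, fun x a b => ?_, ?_, fun x w => ?_⟩
  · suffices h : D x ∘ₗ LinearMap.mulRight K b =
        LinearMap.mulRight K b ∘ₗ D x + ε.toLinearMap.smulRight (D x b) from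
      LinearMap.congr_fun h a
    refine linearMap_ext_generator_mul hg (by simp [D_one]) fun y a => ?_
    simp only [LinearMap.comp_apply, LinearMap.mulRight_apply, mul_assoc, D_mul,
      LinearMap.add_apply, LinearMap.smulRight_apply, AlgHom.toLinearMap_apply, map_mul, hε,
      zero_mul, zero_smul, add_zero]
    split_ifs <;> simp
  · refine (wordBasis hg).ext fun w => ?_
    rw [Module.Basis.coord_apply, Module.Basis.repr_self]
    cases w <;> simp [wordBasis_apply, hε]
  · refine (wordBasis hg).ext fun v => ?_
    rw [LinearMap.comp_apply, Module.Basis.coord_apply, Module.Basis.repr_self]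
    cases v with
    | nil => simp [wordBasis_apply, D_one]
    | cons y v =>
      rw [show wordBasis hg (y :: v) = g y * wordBasis hg v by simp [wordBasis_apply], D_mul]
      by_cases hyx : y = x <;> simp [hyx, Finsupp.single_apply]

theorem linearIndependent_of_linearIndependent_mkQ {ι : Type*} {p : ι → A} (D : Submodule K A)
    (hD : ∀ i a, ε a = 0 → a * p i ∈ D) (hp : LinearIndependent K fun i => D.mkQ (p i)) :
    LinearIndependent A p := by
  obtain ⟨d, d_mul, coord_nil, coord_cons⟩ := exists_foxDerivative hg hε
  have ε_eq_zero (h : ι →₀ A) (hh : Finsupp.linearCombination A p h = 0) (i : ι) :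
      ε (h i) = 0 := by
    have mem : (h.sum fun i a => ε a • p i) - h.sum (fun i a => a • p i) ∈ D := by
      rw [← Finsupp.sum_sub]
      refine sum_mem fun i _ => ?_
      rw [← neg_mem_iff, neg_sub, Algebra.smul_def, smul_eq_mul, ← sub_mul]
      exact hD i _ (by simp)
    have sum_eq : Finsupp.linearCombination K (fun i => D.mkQ (p i))
        (h.mapRange ε (map_zero ε)) = 0 := by
      rw [← Finsupp.linearCombination_apply, hh, sub_zero] at mem
      rw [Finsupp.linearCombination_apply, Finsupp.sum_mapRange_index (by simp),
        ← (Submodule.Quotient.mk_eq_zero D).2 mem, ← Submodule.mkQ_apply, map_finsuppSum]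
      simp only [map_smul]
    exact DFunLike.congr_fun (linearIndependent_iff.1 hp _ sum_eq) i
  have d_mem (x : X) (h : ι →₀ A) (hh : Finsupp.linearCombination A p h = 0) :
      Finsupp.linearCombination A p (h.mapRange (d x) (map_zero _)) = 0 := by
    rw [Finsupp.linearCombination_apply, Finsupp.sum_mapRange_index (by simp),
      ← map_zero (d x), ← hh, Finsupp.linearCombination_apply, map_finsuppSum]
    refine Finsupp.sum_congr fun i _ => ?_
    rw [smul_eq_mul, smul_eq_mul, d_mul, ε_eq_zero h hh, zero_smul, add_zero]
  have coord_eq_zero (w : List X) (i : ι) (h : ι →₀ A)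
      (hh : Finsupp.linearCombination A p h = 0) : (wordBasis hg).coord w (h i) = 0 := by
    induction w generalizing h with
    | nil => rw [coord_nil]; exact ε_eq_zero h hh i
    | cons x w ih => rw [coord_cons]; exact ih _ (d_mem x h hh)
  rw [linearIndependent_iff]
  intro h hh
  ext i
  exact (wordBasis hg).forall_coord_eq_zero_iff.1 fun w => coord_eq_zero w i h hh

end Fox

omit hg in
theorem lift_injective_of_linearIndependent {ι : Type*} {p : ι → A} (ε : A →ₐ[K] K)
    (hp : ∀ i, ε (p i) = 0) (ind : LinearIndependent A p) :
    Function.Injective (FreeAlgebra.lift K p) := by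
  have hι : Function.Bijective (FreeAlgebra.lift K (FreeAlgebra.ι K (X := ι))) := by
    rw [show FreeAlgebra.lift K (FreeAlgebra.ι K) = AlgHom.id K _ by ext; simp]
    exact Function.bijective_id
  let b := (wordBasis hι).reindex (List.reverse_involutive.toPerm _)
  have b_nil : b [] = 1 := by simp [b, wordBasis_apply]
  have b_cons (i : ι) (w : List ι) : b (i :: w) = b w * FreeAlgebra.ι K i := by
    simp [b, wordBasis_apply, Function.Involutive.toPerm]
  let F := (FreeAlgebra.lift K p).toLinearMap
  let cut : FreeAlgebra K ι →ₗ[K] ι →₀ FreeAlgebra K ι := b.constr K fun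
    | [] => 0
    | i :: w => Finsupp.single i (b w)
  have cut_b (w : List ι) : cut (b w) = _ := Module.Basis.constr_basis _ _ _ w
  have coord_nil : b.coord [] = ε.toLinearMap ∘ₗ F := b.ext fun w => by
    rw [Module.Basis.coord_apply, Module.Basis.repr_self]
    cases w <;> simp [b_nil, b_cons, F, hp]
  have coord_cons (i : ι) (w : List ι) : b.coord (i :: w) = b.coord w ∘ₗ Finsupp.lapply i ∘ₗ cut :=
    b.ext fun v => by
      classical
      rw [Module.Basis.coord_apply, Module.Basis.repr_self, LinearMap.comp_apply,
        LinearMap.comp_apply, cut_b]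
      cases v with
      | nil => simp
      | cons j v => by_cases hij : j = i <;> simp [hij, Finsupp.single_apply]
  have F_eq : F = Algebra.linearMap K A ∘ₗ ε.toLinearMap ∘ₗ F +
      (Finsupp.linearCombination A p).restrictScalars K ∘ₗ Finsupp.mapRange.linearMap F ∘ₗ cut :=
    b.ext fun v => by
      simp only [LinearMap.add_apply, LinearMap.comp_apply, cut_b]
      cases v <;> simp [b_nil, b_cons, F, hp]
  have coord_eq_zero (w : List ι) (f : FreeAlgebra K ι) (hf : F f = 0) : b.coord w f = 0 := by
    induction w generalizing f with
    | nil => rw [coord_nil, LinearMap.comp_apply, hf, map_zero]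
    | cons i w ih =>
      rw [coord_cons]
      refine ih _ ?_
      have h := LinearMap.congr_fun F_eq f
      simp only [LinearMap.add_apply, LinearMap.comp_apply, hf, map_zero, zero_add] at h
      exact DFunLike.congr_fun (linearIndependent_iff.1 ind _ h.symm) i
  exact (injective_iff_map_eq_zero _).2 fun f hf =>
    b.forall_coord_eq_zero_iff.1 fun w => coord_eq_zero w f hf

end FreeGenerators

/-! ### Pairings of a graded bialgebra with itself -/

section SymmetricForms

variable {K V : Type*} [Field K] [AddCommGroup V] [Module K V]

theorem exists_symm_separating : ∃ s : V →ₗ[K] V →ₗ[K] K,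
    (∀ x y, s x y = s y x) ∧ ∀ x, s x = 0 → x = 0 := by
  classical
  let b := Module.Basis.ofVectorSpace K V
  refine ⟨b.toDual, LinearMap.congr_fun₂ (f := b.toDual) (g := b.toDual.flip)
    (b.ext fun i => b.ext fun j => ?_), fun x hx => b.toDual_injective (hx.trans (map_zero _).symm)⟩
  rw [LinearMap.flip_apply, b.toDual_apply, b.toDual_apply]
  simp only [eq_comm]

/-- Any extension of the form has a left radical `L` meeting `M` trivially; adding a separating form
on `L`, pulled back along a projection onto `L` that kills `M`, removes this radical. -/
theorem exists_symm_separating_extension (M : Submodule K V) (Λ : V →ₗ[K] V →ₗ[K] K)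
    (symm : ∀ x ∈ M, ∀ y ∈ M, Λ x y = Λ y x) (separating : ∀ x ∈ M, Λ x = 0 → x = 0) :
    ∃ G : V →ₗ[K] V →ₗ[K] K, (∀ x y, G x y = G y x) ∧ (∀ x, G x = 0 → x = 0) ∧
      ∀ x ∈ M, G x = Λ x := by
  obtain ⟨p, hp⟩ := M.subtype.exists_leftInverse_of_injective M.ker_subtype
  have p_coe (x : M) : p x = x := LinearMap.congr_fun hp x
  let q : V →ₗ[K] V := M.subtype ∘ₗ p
  let G : V →ₗ[K] V →ₗ[K] K := Λ ∘ₗ q + (Λ ∘ₗ q).flip - Λ.compl₁₂ q q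
  have G_apply (x y : V) : G x y = Λ (q x) y + Λ (q y) x - Λ (q x) (q y) := rfl
  have q_of_mem {x : V} (hx : x ∈ M) : q x = x := congrArg M.subtype (p_coe ⟨x, hx⟩)
  have G_symm (x y : V) : G x y = G y x := by
    rw [G_apply, G_apply, symm (q x) (p x).2 (q y) (p y).2, add_comm (Λ (q x) y)]
  have G_of_mem {x : V} (hx : x ∈ M) : G x = Λ x := LinearMap.ext fun y => by
    rw [G_apply, q_of_mem hx, symm (q y) (p y).2 x hx, add_sub_cancel_right]
  let L := LinearMap.ker G
  have disjoint : Disjoint L M := Submodule.disjoint_def.2 fun x hx hxM =>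
    separating x hxM ((G_of_mem hxM).symm.trans hx)
  obtain ⟨F, hF⟩ := (M.mkQ ∘ₗ L.subtype).exists_leftInverse_of_injective (by
    rw [LinearMap.ker_comp, M.ker_mkQ, ← Submodule.disjoint_iff_comap_eq_bot]
    exact disjoint)
  obtain ⟨s, s_symm, s_separating⟩ := exists_symm_separating (K := K) (V := L)
  let P : V →ₗ[K] L := F ∘ₗ M.mkQ
  have P_coe (x : L) : P x = x := LinearMap.congr_fun hF x
  have P_of_mem {x : V} (hx : x ∈ M) : P x = 0 := by
    rw [LinearMap.comp_apply, Submodule.mkQ_apply, (Submodule.Quotient.mk_eq_zero M).2 hx, map_zero]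
  refine ⟨G + s.compl₁₂ P P, fun x y => ?_, fun x hx => ?_, fun x hx => ?_⟩
  · exact congrArg₂ (· + ·) (G_symm x y) (s_symm _ _)
  · have P_x : P x = 0 := s_separating _ (LinearMap.ext fun y => by
      have G_x_y : G x y = 0 := (G_symm x y).trans (LinearMap.congr_fun y.2 x)
      simpa [G_x_y, P_coe] using LinearMap.congr_fun hx y)
    have x_mem : x ∈ L := LinearMap.ext fun y => by
      simpa [P_x] using LinearMap.congr_fun hx y
    exact congrArg L.subtype ((P_coe ⟨x, x_mem⟩).symm.trans P_x)
  · ext y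
    simp [G_of_mem hx, P_of_mem hx]

end SymmetricForms

section Pairing

open Coalgebra (comul counit)
open TensorProduct
open LinearMap (BilinForm)

variable {K : Type u} {H : Type v} [Field K] [Ring H] [Bialgebra K H]

/-- A symmetric homogeneous form on a graded bialgebra for which the product and the coproduct are
transposes of each other up to degree `n`, and which is nondegenerate up to degree `n`. The elements
`x ⊗ y` and `z ⊗ w` are paired by `β.tmul β`. -/
structure IsPairing (𝒜 : ℕ → Submodule K H) (n : ℕ) (β : BilinForm K H) : Prop where
  symm (x y : H) : β x y = β y x
  homogeneous {i j : ℕ} {x y : H} : i ≠ j → x ∈ 𝒜 i → y ∈ 𝒜 j → β x y = 0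
  apply_one : β 1 = counit
  apply_mul_of_mem {i j : ℕ} {a b z : H} : i ≠ 0 → j ≠ 0 → i + j ≤ n → a ∈ 𝒜 i → b ∈ 𝒜 j →
    z ∈ 𝒜 (i + j) → β (a * b) z = β.tmul β (a ⊗ₜ b) (reducedComul K H z)
  separating {k : ℕ} {x : H} : k ≤ n → x ∈ 𝒜 k → β x = 0 → x = 0

variable {𝒜 : ℕ → Submodule K H} {n : ℕ} {β : BilinForm K H}

theorem isPairing_zero [IsConnectedGraded 𝒜] :
    IsPairing 𝒜 0 ((LinearMap.toSpanSingleton K (H →ₗ[K] K) counit) ∘ₗ counit) where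
  symm x y := by simp [mul_comm]
  homogeneous {i j x y} hij hx hy := by
    obtain rfl | hi := eq_or_ne i 0
    · simp [IsConnectedGraded.counit_eq_zero hij.symm hy]
    · simp [IsConnectedGraded.counit_eq_zero hi hx]
  apply_one := by simp
  apply_mul_of_mem hi _ hij := absurd (Nat.le_zero.1 hij) (by lia)
  separating {k x} hk hx h := by
    obtain rfl := Nat.le_zero.1 hk
    have counit_x : counit (R := K) x = 0 := by simpa using LinearMap.congr_fun h 1
    rw [IsConnectedGraded.eq_algebraMap_counit hx, counit_x, map_zero]

theorem tmul_self_congr {γ : BilinForm K H} {a b : H} (ha : β a = γ a) (hb : β b = γ b) :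
    β.tmul β (a ⊗ₜ b) = γ.tmul γ (a ⊗ₜ b) := by
  ext; simp [ha, hb]

namespace IsPairing

variable (h : IsPairing 𝒜 n β)
include h

theorem apply_one_right (x : H) : β x 1 = counit x := by
  rw [h.symm, h.apply_one]

theorem tmul_comul {a b : H} (ha : counit (R := K) a = 0) (hb : counit (R := K) b = 0) (z : H) :
    β.tmul β (a ⊗ₜ b) (comul z) = β.tmul β (a ⊗ₜ b) (reducedComul K H z) := by
  simp [comul_eq_reducedComul_add z, h.apply_one_right, ha, hb]

theorem tmul_one_comul (b z : H) : β.tmul β (1 ⊗ₜ b) (comul z) = β b z := by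
  have : β.tmul β (1 ⊗ₜ b) = β b ∘ₗ (TensorProduct.lid K H).toLinearMap ∘ₗ counit.rTensor H := by
    ext; simp [h.apply_one, mul_comm]
  simp [this]

theorem tmul_comul_one (a z : H) : β.tmul β (a ⊗ₜ 1) (comul z) = β a z := by
  have : β.tmul β (a ⊗ₜ 1) = β a ∘ₗ (TensorProduct.rid K H).toLinearMap ∘ₗ counit.lTensor H := by
    ext; simp [h.apply_one]
  simp [this]

section Homogeneous

variable [IsConnectedGraded 𝒜]

theorem tmul_comul_eq_zero {i j k : ℕ} {a b z : H} (hk : i + j ≠ k) (ha : a ∈ 𝒜 i) (hb : b ∈ 𝒜 j)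
    (hz : z ∈ 𝒜 k) : β.tmul β (a ⊗ₜ b) (comul z) = 0 := by
  refine eq_of_mem_tensorDegree (g := 0) (fun i' j' hij a' ha' b' hb' => ?_)
    (IsConnectedGraded.comul_mem hz)
  rw [BilinForm.tensorDistrib_tmul, LinearMap.zero_apply]
  obtain hi | hi := eq_or_ne i i'
  · rw [h.homogeneous (by have : i' + j' = k := hij; lia) hb hb', zero_smul]
  · rw [h.homogeneous hi ha ha', smul_zero]

theorem tmul_reducedComul_eq_zero {i j k : ℕ} {a b z : H} (hi : i ≠ 0) (hj : j ≠ 0)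
    (hk : i + j ≠ k) (ha : a ∈ 𝒜 i) (hb : b ∈ 𝒜 j) (hz : z ∈ 𝒜 k) :
    β.tmul β (a ⊗ₜ b) (reducedComul K H z) = 0 := by
  rw [← h.tmul_comul (IsConnectedGraded.counit_eq_zero hi ha)
    (IsConnectedGraded.counit_eq_zero hj hb), h.tmul_comul_eq_zero hk ha hb hz]

theorem apply_mul [GradedAlgebra 𝒜] {k : ℕ} (hk : k ≤ n) {z : H} (hz : z ∈ 𝒜 k) (a b : H) :
    β (a * b) z = β.tmul β (a ⊗ₜ b) (comul z) := by
  have bilinear : (LinearMap.mul K H).compr₂ (β.flip z) =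
      (TensorProduct.mk K H H).compr₂ ((β.tmul β).flip (comul z)) := by
    refine linearMap_ext_on_components (𝒜 := 𝒜) fun i a ha =>
      linearMap_ext_on_components (𝒜 := 𝒜) fun j b hb => ?_
    change β (a * b) z = β.tmul β (a ⊗ₜ b) (comul z)
    obtain hij | rfl := ne_or_eq (i + j) k
    · rw [h.tmul_comul_eq_zero hij ha hb hz,
        h.homogeneous hij (SetLike.GradedMul.mul_mem ha hb) hz]
    obtain rfl | hi := eq_or_ne i 0
    · rw [IsConnectedGraded.eq_algebraMap_counit ha, Algebra.algebraMap_eq_smul_one, smul_mul_assoc,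
        one_mul, ← smul_tmul', map_smul, map_smul, LinearMap.smul_apply, LinearMap.smul_apply,
        h.tmul_one_comul]
    obtain rfl | hj := eq_or_ne j 0
    · rw [IsConnectedGraded.eq_algebraMap_counit hb, Algebra.algebraMap_eq_smul_one, mul_smul_comm,
        mul_one, tmul_smul, map_smul, map_smul, LinearMap.smul_apply, LinearMap.smul_apply,
        h.tmul_comul_one]
    · rw [h.apply_mul_of_mem hi hj hk ha hb hz, h.tmul_comul
        (IsConnectedGraded.counit_eq_zero hi ha) (IsConnectedGraded.counit_eq_zero hj hb)]
  exact LinearMap.congr_fun₂ bilinear a b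

theorem apply_mul_of_counit_eq_zero [GradedAlgebra 𝒜] {k : ℕ} (hk : k ≤ n) {z : H} (hz : z ∈ 𝒜 k)
    {a b : H} (ha : counit (R := K) a = 0) (hb : counit (R := K) b = 0) :
    β (a * b) z = β.tmul β (a ⊗ₜ b) (reducedComul K H z) := by
  rw [h.apply_mul hk hz, h.tmul_comul ha hb]

/-- Both sides are the value of the form on `H ⊗ H ⊗ H ⊗ H` at `Δ a ⊗ Δ b` and the transpose of
the middle factors of `Δ c ⊗ Δ d`. -/
theorem tmul_comul_mul_symm [GradedAlgebra 𝒜] {i j k l : ℕ} (hi : i ≤ n) (hj : j ≤ n) (hk : k ≤ n)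
    (hl : l ≤ n) {a b c d : H} (ha : a ∈ 𝒜 i) (hb : b ∈ 𝒜 j) (hc : c ∈ 𝒜 k) (hd : d ∈ 𝒜 l) :
    β.tmul β (a ⊗ₜ b) (comul (c * d)) = β.tmul β (c ⊗ₜ d) (comul (a * b)) := by
  have isSymm : (β.tmul β).IsSymm := LinearMap.IsSymm.tmul ⟨h.symm⟩ ⟨h.symm⟩
  have symm₂ (x y) : β.tmul β x y = β.tmul β y x := isSymm.eq x y
  let β₄ : BilinForm K ((H ⊗[K] H) ⊗[K] (H ⊗[K] H)) := BilinForm.tmul (β.tmul β) (β.tmul β)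
  have symm₄ (x y) : β₄ x y = β₄ y x := (isSymm.tmul isSymm).eq x y
  let τ := (tensorTensorTensorComm K H H H H).toLinearMap
  have τ_adjoint (x y : (H ⊗[K] H) ⊗[K] (H ⊗[K] H)) :
      β₄ x (τ y) = β₄ (τ x) y := by
    refine LinearMap.congr_fun₂ (f := β₄.compl₂ τ) (g := β₄ ∘ₗ τ) ?_ x y
    ext
    simp [τ, β₄, mul_mul_mul_comm]
  have expand {i j : ℕ} (hi : i ≤ n) (hj : j ≤ n) {a b : H} (ha : a ∈ 𝒜 i) (hb : b ∈ 𝒜 j)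
      (s t : H ⊗[K] H) : β.tmul β (a ⊗ₜ b) (s * t) =
      β₄ (comul a ⊗ₜ comul b) (τ (s ⊗ₜ t)) := by
    refine LinearMap.congr_fun₂
      (f := (LinearMap.mul K (H ⊗[K] H)).compr₂ (β.tmul β (a ⊗ₜ b)))
      (g := (TensorProduct.mk K _ _).compr₂ (β₄ (comul a ⊗ₜ comul b) ∘ₗ τ)) ?_ s t
    ext x y z w
    simp [τ, β₄, h.symm a, h.symm b, h.apply_mul hi ha, h.apply_mul hj hb, symm₂ (comul _)]
  rw [Bialgebra.comul_mul, Bialgebra.comul_mul, expand hi hj ha hb, expand hk hl hc hd, τ_adjoint,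
    symm₄ (τ _), τ_adjoint]

end Homogeneous

theorem restrict_separating [GradedAlgebra 𝒜] {k : ℕ} (hk : k ≤ n) {x : 𝒜 k}
    (hx : β.restrict (𝒜 k) x = 0) : x = 0 := by
  refine Subtype.ext (h.separating hk x.2 (linearMap_ext_on_components (𝒜 := 𝒜) ?_))
  intro j y hy
  obtain rfl | hj := eq_or_ne k j
  · exact LinearMap.congr_fun hx ⟨y, hy⟩
  · exact h.homogeneous hj x.2 hy

end IsPairing

section DualFamilies

variable {ι : Type} [Fintype ι]

/-- Two finite families of homogeneous elements of degrees `1, …, n` that expand every homogeneous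
element of these degrees with respect to each other, as dual bases do. -/
structure IsDualPair (𝒜 : ℕ → Submodule K H) (n : ℕ) (β : BilinForm K H) (u v : ι → H) :
    Prop where
  exists_degree (i : ι) : ∃ k, k ≠ 0 ∧ k ≤ n ∧ u i ∈ 𝒜 k ∧ v i ∈ 𝒜 k
  sum_left {k : ℕ} {x : H} : k ≠ 0 → k ≤ n → x ∈ 𝒜 k → ∑ i, β x (v i) • u i = x
  sum_right {k : ℕ} {x : H} : k ≠ 0 → k ≤ n → x ∈ 𝒜 k → ∑ i, β x (u i) • v i = x

theorem exists_dual_bases {V : Type*} [AddCommGroup V] [Module K V] [FiniteDimensional K V]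
    {β : BilinForm K V} (symm : ∀ x y, β x y = β y x) (separating : ∀ x, β x = 0 → x = 0) :
    ∃ u v : Fin (Module.finrank K V) → V,
      (∀ x, ∑ i, β x (v i) • u i = x) ∧ ∀ x, ∑ i, β x (u i) • v i = x := by
  have isSymm : β.IsSymm := ⟨symm⟩
  have nondegenerate : β.Nondegenerate :=
    isSymm.isRefl.nondegenerate_iff_separatingLeft.2 fun x hx =>
      separating x (LinearMap.ext hx)
  let b := Module.finBasis K V
  have expand (c : Module.Basis (Fin (Module.finrank K V)) K V) (x : V) :
      ∑ i, β x (c i) • β.dualBasis nondegenerate c i = x := by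
    conv_rhs => rw [← (β.dualBasis nondegenerate c).sum_repr x]
    simp only [BilinForm.dualBasis_repr_apply]
  refine ⟨β.dualBasis nondegenerate b, b, expand b, fun x => ?_⟩
  conv_rhs => rw [← expand (β.dualBasis nondegenerate b) x]
  rw [BilinForm.dualBasis_dualBasis nondegenerate isSymm]

theorem IsPairing.exists_isDualPair [∀ k, FiniteDimensional K (𝒜 k)] [GradedAlgebra 𝒜]
    (h : IsPairing 𝒜 n β) :
    ∃ (ι : Type) (_ : Fintype ι) (u v : ι → H), IsDualPair 𝒜 n β u v := by
  choose u v hu hv using fun k : Fin n =>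
    exists_dual_bases (β := β.restrict (𝒜 (k + 1))) (fun x y => h.symm x y) fun x hx =>
      h.restrict_separating k.2 hx
  have expand {w w' : ∀ k : Fin n, Fin (Module.finrank K (𝒜 (k + 1))) → 𝒜 (k + 1)}
      (hw : ∀ (k : Fin n) x, ∑ i, β.restrict (𝒜 (k + 1)) x (w' k i) • w k i = x) {k : ℕ} {x : H}
      (hk : k ≠ 0) (hkn : k ≤ n) (hx : x ∈ 𝒜 k) :
      ∑ i : (k : Fin n) × Fin (Module.finrank K (𝒜 (k + 1))),
        β x (w' i.1 i.2) • (w i.1 i.2 : H) = x := by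
    obtain ⟨k, rfl⟩ := Nat.exists_eq_succ_of_ne_zero hk
    rw [Fintype.sum_sigma, Fintype.sum_eq_single ⟨k, hkn⟩ fun j hj =>
      Finset.sum_eq_zero fun i _ => ?_]
    · simpa using congrArg (𝒜 (k + 1)).subtype (hw ⟨k, hkn⟩ ⟨x, hx⟩)
    · have ne : k + 1 ≠ j + 1 := fun e => hj (Fin.ext (Nat.succ_injective e.symm))
      rw [h.homogeneous ne hx (w' j i).2, zero_smul]
  exact ⟨(k : Fin n) × Fin (Module.finrank K (𝒜 (k + 1))), inferInstance,
    fun i => u i.1 i.2, fun i => v i.1 i.2,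
    fun i => ⟨i.1 + 1, i.1.1.succ_ne_zero, i.1.2, (u i.1 i.2).2, (v i.1 i.2).2⟩,
    expand hu, expand hv⟩

namespace IsDualPair

variable {u v : ι → H} (d : IsDualPair 𝒜 n β u v)
include d

theorem sum_tmul {t : H ⊗[K] H} {k : ℕ} (hk : k ≤ n)
    (ht : t ∈ tensorDegree 𝒜 {e | e.1 + e.2 = k ∧ e.1 ≠ 0 ∧ e.2 ≠ 0}) :
    ∑ i, ∑ j, β.tmul β t (u i ⊗ₜ u j) • v i ⊗ₜ v j = t := by
  have expand := eq_of_mem_tensorDegree (g := LinearMap.id)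
    (f := ∑ i, ∑ j, ((β.tmul β).flip (u i ⊗ₜ u j)).smulRight (v i ⊗ₜ[K] v j))
    (fun p q hpq a ha b hb => ?_) ht
  · simpa using expand
  · obtain ⟨hpq : p + q = k, hp, hq⟩ := hpq
    have a_eq := d.sum_right hp (by lia) ha
    have b_eq := d.sum_right hq (by lia) hb
    conv_rhs => rw [LinearMap.id_apply, ← a_eq, ← b_eq, TensorProduct.sum_tmul]
    simp only [tmul_sum, smul_tmul_smul]
    simp [mul_comm]

variable (h : IsPairing 𝒜 n β)
include h

theorem sum_reducedComul [GradedAlgebra 𝒜] [IsConnectedGraded 𝒜] (i : ι) :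
    ∑ x, ∑ y, β (u x * u y) (v i) • v x ⊗ₜ v y = reducedComul K H (v i) := by
  have counit_u (j : ι) : counit (R := K) (u j) = 0 := by
    obtain ⟨k, hk, -, hu, -⟩ := d.exists_degree j
    exact IsConnectedGraded.counit_eq_zero hk hu
  have isSymm : (β.tmul β).IsSymm := LinearMap.IsSymm.tmul ⟨h.symm⟩ ⟨h.symm⟩
  obtain ⟨k, -, hkn, -, hv⟩ := d.exists_degree i
  rw [← d.sum_tmul hkn (reducedComul_mem hv)]
  refine Finset.sum_congr rfl fun x _ => Finset.sum_congr rfl fun y _ => ?_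
  rw [h.apply_mul_of_counit_eq_zero hkn hv (counit_u x) (counit_u y)]
  exact congrArg (· • _) (isSymm.eq _ _)

variable [GradedAlgebra 𝒜] {l : H →ₗ[K] K} (hl : ∀ k ≠ n + 1, ∀ x ∈ 𝒜 k, l x = 0)
include hl

theorem sum_apply_mul_left {p q : ℕ} {a b : H} (hp : p ≠ 0) (hq : q ≠ 0) (ha : a ∈ 𝒜 p)
    (hb : b ∈ 𝒜 q) : ∑ i, β a (v i) * l (u i * b) = l (a * b) := by
  obtain hpn | hpn := le_or_gt p n
  · conv_rhs => rw [← d.sum_left hp hpn ha]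
    simp [Finset.sum_mul]
  · rw [hl (p + q) (by lia) _ (SetLike.GradedMul.mul_mem ha hb)]
    refine Finset.sum_eq_zero fun i _ => ?_
    obtain ⟨k, -, hk, -, hv⟩ := d.exists_degree i
    rw [h.homogeneous (by lia) ha hv, zero_mul]

theorem sum_apply_mul_right {p q : ℕ} {a b : H} (hp : p ≠ 0) (hq : q ≠ 0) (ha : a ∈ 𝒜 p)
    (hb : b ∈ 𝒜 q) : ∑ i, β b (v i) * l (a * u i) = l (a * b) := by
  obtain hqn | hqn := le_or_gt q n
  · conv_rhs => rw [← d.sum_left hq hqn hb]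
    simp [Finset.mul_sum]
  · rw [hl (p + q) (by lia) _ (SetLike.GradedMul.mul_mem ha hb)]
    refine Finset.sum_eq_zero fun i _ => ?_
    obtain ⟨k, -, hk, -, hv⟩ := d.exists_degree i
    rw [h.homogeneous (by lia) hb hv, zero_mul]

theorem tmul_sum_mul {p q : ℕ} {a b : H} (hp : p ≠ 0) (hq : q ≠ 0) (ha : a ∈ 𝒜 p)
    (hb : b ∈ 𝒜 q) :
    β.tmul β (a ⊗ₜ b) (∑ i, ∑ j, l (u i * u j) • v i ⊗ₜ v j) = l (a * b) := by
  rw [← d.sum_apply_mul_left h hl hp hq ha hb, map_sum]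
  refine Finset.sum_congr rfl fun i _ => ?_
  obtain ⟨k, hk, -, hu, -⟩ := d.exists_degree i
  rw [← d.sum_apply_mul_right h hl hk hq hu hb, map_sum, Finset.mul_sum]
  refine Finset.sum_congr rfl fun j _ => ?_
  rw [map_smul, BilinForm.tensorDistrib_tmul, smul_eq_mul, smul_eq_mul]
  ring

theorem sum_smul_reducedComul_left [IsConnectedGraded 𝒜] {q : ℕ} {b : H} (hq : q ≠ 0)
    (hb : b ∈ 𝒜 q) : ∑ i, l (u i * b) • reducedComul K H (v i) =
      ∑ x, ∑ y, l (u x * u y * b) • v x ⊗ₜ v y := by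
  simp only [← d.sum_reducedComul h, Finset.smul_sum, smul_smul]
  rw [Finset.sum_comm]
  refine Finset.sum_congr rfl fun x _ => Finset.sum_comm.trans (Finset.sum_congr rfl fun y _ => ?_)
  obtain ⟨i, hi, -, hx, -⟩ := d.exists_degree x
  obtain ⟨j, -, -, hy, -⟩ := d.exists_degree y
  rw [← Finset.sum_smul, ← d.sum_apply_mul_left h hl (p := i + j) (by lia) hq
    (SetLike.GradedMul.mul_mem hx hy) hb]
  simp only [mul_comm]

theorem sum_smul_reducedComul_right [IsConnectedGraded 𝒜] {p : ℕ} {a : H} (hp : p ≠ 0)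
    (ha : a ∈ 𝒜 p) : ∑ i, l (a * u i) • reducedComul K H (v i) =
      ∑ x, ∑ y, l (a * (u x * u y)) • v x ⊗ₜ v y := by
  simp only [← d.sum_reducedComul h, Finset.smul_sum, smul_smul]
  rw [Finset.sum_comm]
  refine Finset.sum_congr rfl fun x _ => Finset.sum_comm.trans (Finset.sum_congr rfl fun y _ => ?_)
  obtain ⟨i, hi, -, hx, -⟩ := d.exists_degree x
  obtain ⟨j, -, -, hy, -⟩ := d.exists_degree y
  rw [← Finset.sum_smul, ← d.sum_apply_mul_right h hl (q := i + j) hp (by lia) ha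
    (SetLike.GradedMul.mul_mem hx hy)]
  simp only [mul_comm]

theorem coassoc_sum_mul [IsConnectedGraded 𝒜] :
    TensorProduct.assoc K H H H
      ((reducedComul K H).rTensor H (∑ i, ∑ j, l (u i * u j) • v i ⊗ₜ v j)) =
      (reducedComul K H).lTensor H (∑ i, ∑ j, l (u i * u j) • v i ⊗ₜ v j) := by
  have left (j : ι) : ∑ i, l (u i * u j) • (reducedComul K H (v i) ⊗ₜ[K] v j) =
      ∑ x, ∑ y, l (u x * u y * u j) • (v x ⊗ₜ v y) ⊗ₜ v j := by
    obtain ⟨k, hk, -, hu, -⟩ := d.exists_degree j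
    simpa only [TensorProduct.sum_tmul, ← smul_tmul'] using
      congrArg (· ⊗ₜ[K] v j) (d.sum_smul_reducedComul_left h hl hk hu)
  have right (i : ι) : ∑ j, l (u i * u j) • (v i ⊗ₜ[K] reducedComul K H (v j)) =
      ∑ x, ∑ y, l (u i * (u x * u y)) • v i ⊗ₜ (v x ⊗ₜ v y) := by
    obtain ⟨k, hk, -, hu, -⟩ := d.exists_degree i
    simpa only [tmul_sum, tmul_smul] using
      congrArg (v i ⊗ₜ[K] ·) (d.sum_smul_reducedComul_right h hl hk hu)
  simp only [map_sum, map_smul, LinearMap.rTensor_tmul, LinearMap.lTensor_tmul, right]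
  rw [Finset.sum_comm]
  simp only [← map_smul, ← map_sum, left]
  simp only [map_sum, map_smul, assoc_tmul, mul_assoc]
  rw [Finset.sum_comm]
  exact Finset.sum_congr rfl fun x _ => Finset.sum_comm

end IsDualPair

end DualFamilies

end Pairing

section SelfDual

open Coalgebra (comul counit)
open TensorProduct
open LinearMap (BilinForm)

variable {K : Type u} {H : Type v} [Field K] [Ring H] [Bialgebra K H]
  {𝒜 : ℕ → Submodule K H} {n : ℕ} {β : BilinForm K H}

/-- The span of the products of two homogeneous elements of positive degree, in degree `n`. -/
def decomposables (𝒜 : ℕ → Submodule K H) (n : ℕ) : Submodule K (𝒜 n) :=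
  .span K {x | ∃ i j, i ≠ 0 ∧ j ≠ 0 ∧ i + j = n ∧ ∃ a ∈ 𝒜 i, ∃ b ∈ 𝒜 j, (x : H) = a * b}

/-- On decomposable elements, `Λ` is the form that makes the product and the coproduct transposes
of each other, relatively to the form `β` in lower degrees. -/
def IsProductForm (𝒜 : ℕ → Submodule K H) (n : ℕ) (β : BilinForm K H) (Λ : BilinForm K (𝒜 n)) :
    Prop :=
  ∀ {i j : ℕ} {a b : H} (x z : 𝒜 n), i ≠ 0 → j ≠ 0 → i + j = n → a ∈ 𝒜 i → b ∈ 𝒜 j →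
    (x : H) = a * b → Λ x z = β.tmul β (a ⊗ₜ b) (reducedComul K H z)

theorem eq_of_mem_decomposables {f g : 𝒜 n →ₗ[K] K}
    (h : ∀ i j a b (x : 𝒜 n), i ≠ 0 → j ≠ 0 → i + j = n → a ∈ 𝒜 i → b ∈ 𝒜 j →
      (x : H) = a * b → f x = g x)
    {x : 𝒜 n} (hx : x ∈ decomposables 𝒜 n) : f x = g x := by
  refine LinearMap.eqOn_span ?_ hx
  rintro x ⟨i, j, hi, hj, hij, a, ha, b, hb, hab⟩
  exact h i j a b x hi hj hij ha hb hab

variable [GradedAlgebra 𝒜] [IsConnectedGraded 𝒜]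

namespace IsPairing

variable (h : IsPairing 𝒜 n β)
include h

theorem tmul_mul_reducedComul {z : H} (hz : z ∈ 𝒜 (n + 1)) {a b c : H}
    (ha : counit (R := K) a = 0) (hb : counit (R := K) b = 0) (hc : counit (R := K) c = 0) :
    β.tmul β ((a * b) ⊗ₜ c) (reducedComul K H z) =
      β.tmul β (a ⊗ₜ (b * c)) (reducedComul K H z) := by
  let β₃ : BilinForm K (H ⊗[K] (H ⊗[K] H)) := BilinForm.tmul β (β.tmul β)
  have apply_assoc (t : H ⊗[K] H) (y : H) :
      β₃ (a ⊗ₜ (b ⊗ₜ c)) (TensorProduct.assoc K H H H (t ⊗ₜ y)) =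
        β c y * β.tmul β (a ⊗ₜ b) t := by
    refine LinearMap.congr_fun (f := β₃ (a ⊗ₜ (b ⊗ₜ c)) ∘ₗ
      (TensorProduct.assoc K H H H).toLinearMap ∘ₗ (TensorProduct.mk K _ _).flip y)
      (g := β c y • β.tmul β (a ⊗ₜ b)) ?_ t
    ext; simp [β₃]; ring
  have left : β.tmul β ((a * b) ⊗ₜ c) (reducedComul K H z) = β₃ (a ⊗ₜ (b ⊗ₜ c))
      (TensorProduct.assoc K H H H ((reducedComul K H).rTensor H (reducedComul K H z))) := by
    refine eq_of_mem_tensorDegree (g := β₃ (a ⊗ₜ (b ⊗ₜ c)) ∘ₗ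
      (TensorProduct.assoc K H H H).toLinearMap ∘ₗ (reducedComul K H).rTensor H)
      (fun i j hij x hx y _ => ?_) (reducedComul_mem hz)
    obtain ⟨hij : i + j = n + 1, -, hj⟩ := hij
    simp [apply_assoc, h.apply_mul_of_counit_eq_zero (by lia : i ≤ n) hx ha hb]
  have right : β.tmul β (a ⊗ₜ (b * c)) (reducedComul K H z) = β₃ (a ⊗ₜ (b ⊗ₜ c))
      ((reducedComul K H).lTensor H (reducedComul K H z)) := by
    refine eq_of_mem_tensorDegree (g := β₃ (a ⊗ₜ (b ⊗ₜ c)) ∘ₗ (reducedComul K H).lTensor H)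
      (fun i j hij x _ y hy => ?_) (reducedComul_mem hz)
    obtain ⟨hij : i + j = n + 1, hi, -⟩ := hij
    simp [β₃, h.apply_mul_of_counit_eq_zero (by lia : j ≤ n) hy hb hc]
  rw [left, right, reducedComul_coassoc]

theorem exists_isProductForm (free : IsFreeAlgebra K H) : ∃ Λ, IsProductForm 𝒜 (n + 1) β Λ := by
  obtain ⟨X, g, hg, hε⟩ := exists_free_generators free (Bialgebra.counitAlgHom K H)
  let ρ : Module.Dual K (H ⊗[K] H) →ₗ[K] Module.Dual K (𝒜 (n + 1)) :=
    (reducedComul K H ∘ₗ (𝒜 (n + 1)).subtype).dualMap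
  obtain ⟨Λ, hΛ⟩ := exists_linearMap_mul_eq hg hε
    ((TensorProduct.mk K H H).compr₂ (ρ ∘ₗ β.tmul β)) fun a b c ha hb hc =>
      LinearMap.ext fun z => h.tmul_mul_reducedComul z.2 ha hb hc
  refine ⟨Λ ∘ₗ (𝒜 (n + 1)).subtype, fun {i j a b} x z hi hj _ ha hb hx => ?_⟩
  rw [LinearMap.comp_apply, Submodule.subtype_apply, hx, hΛ a b
    (IsConnectedGraded.counit_eq_zero hi ha) (IsConnectedGraded.counit_eq_zero hj hb)]
  rfl

theorem exists_tmul_reducedComul_eq [∀ k, FiniteDimensional K (𝒜 k)]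
    (r : InfinitesimalProduct K H) {l : H →ₗ[K] K} (hl : ∀ k ≠ n + 1, ∀ x ∈ 𝒜 k, l x = 0) :
    ∃ z, ∀ p q, p ≠ 0 → q ≠ 0 → ∀ a ∈ 𝒜 p, ∀ b ∈ 𝒜 q,
      β.tmul β (a ⊗ₜ b) (reducedComul K H z) = l (a * b) := by
  obtain ⟨f, hf⟩ := (r.conv_bijective 𝒜).2 (augProj K H)
  obtain ⟨ι, _, u, v, d⟩ := h.exists_isDualPair
  let t := ∑ i, ∑ j, l (u i * u j) • v i ⊗ₜ[K] v j
  have t_mem : t ∈ InfinitesimalProduct.primitiveTensors f :=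
    sum_mem fun i _ => sum_mem fun j _ => Submodule.smul_mem _ _ <|
      InfinitesimalProduct.tmul_mem_primitiveTensors _
        (InfinitesimalProduct.apply_mem_primitives_of_conv_eq hf 𝒜 _)
  have augProj_v (i : ι) : augProj K H (v i) = v i := by
    obtain ⟨k, hk, -, -, hv⟩ := d.exists_degree i
    exact augProj_of_mem hk hv
  have pos : map (augProj K H) (augProj K H) t = t := by
    simp only [t, map_sum, map_smul, map_tmul, augProj_v]
  refine ⟨r.twist f t, fun p q hp hq a ha b hb => ?_⟩
  rw [InfinitesimalProduct.reducedComul_twist_eq_self hf t_mem pos (d.coassoc_sum_mul h hl),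
    d.tmul_sum_mul h hl hp hq ha hb]

variable {Λ : BilinForm K (𝒜 (n + 1))} (hΛ : IsProductForm 𝒜 (n + 1) β Λ) {x : 𝒜 (n + 1)}
  (hx : x ∈ decomposables 𝒜 (n + 1))
include hΛ hx

theorem isProductForm_symm {y : 𝒜 (n + 1)} (hy : y ∈ decomposables 𝒜 (n + 1)) :
    Λ x y = Λ y x := by
  refine eq_of_mem_decomposables (f := Λ x) (g := LinearMap.flip Λ x)
    (fun k l c d y hk hl hkl hc hd hy => ?_) hy
  refine eq_of_mem_decomposables (f := LinearMap.flip Λ y) (g := Λ y)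
    (fun i j a b x hi hj hij ha hb hx => ?_) hx
  have counit_eq_zero {i : ℕ} (hi : i ≠ 0) {a : H} (ha : a ∈ 𝒜 i) : counit (R := K) a = 0 :=
    IsConnectedGraded.counit_eq_zero hi ha
  rw [LinearMap.flip_apply, hΛ x y hi hj hij ha hb hx, hΛ y x hk hl hkl hc hd hy, hx, hy,
    ← h.tmul_comul (counit_eq_zero hi ha) (counit_eq_zero hj hb),
    ← h.tmul_comul (counit_eq_zero hk hc) (counit_eq_zero hl hd)]
  exact h.tmul_comul_mul_symm (by lia) (by lia) (by lia) (by lia) ha hb hc hd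

theorem isProductForm_separating [∀ k, FiniteDimensional K (𝒜 k)] (r : InfinitesimalProduct K H)
    (Λ_x : Λ x = 0) : x = 0 := by
  refine (Module.forall_dual_apply_eq_zero_iff K x).1 fun φ => ?_
  obtain ⟨z, hz⟩ := h.exists_tmul_reducedComul_eq r (l := φ ∘ₗ degreeProj 𝒜 (n + 1))
    fun k hk x hx => by simp [degreeProj_of_mem_ne hk hx]
  refine (eq_of_mem_decomposables (g := LinearMap.flip Λ (degreeProj 𝒜 (n + 1) z))
    (fun i j a b x hi hj hij ha hb hx => ?_) hx).trans (LinearMap.congr_fun Λ_x _)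
  rw [LinearMap.flip_apply, hΛ x _ hi hj hij ha hb hx, ← LinearMap.comp_apply,
    apply_degreeProj (fun k hk x hx => h.tmul_reducedComul_eq_zero hi hj (by lia) ha hb hx),
    LinearMap.comp_apply, hz i j hi hj a ha b hb, ← hx, LinearMap.comp_apply, degreeProj_coe]

omit hΛ hx

theorem exists_separating_isProductForm [∀ k, FiniteDimensional K (𝒜 k)]
    (free : IsFreeAlgebra K H) (r : InfinitesimalProduct K H) :
    ∃ G, IsProductForm 𝒜 (n + 1) β G ∧ (∀ x y, G x y = G y x) ∧ ∀ x, G x = 0 → x = 0 := by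
  obtain ⟨Λ, hΛ⟩ := h.exists_isProductForm free
  obtain ⟨G, symm, separating, hG⟩ := exists_symm_separating_extension
    (decomposables 𝒜 (n + 1)) Λ (fun x hx y hy => h.isProductForm_symm hΛ hx hy)
    (fun x hx Λ_x => h.isProductForm_separating hΛ hx r Λ_x)
  refine ⟨G, fun {i j a b} x z hi hj hij ha hb hx => ?_, symm, separating⟩
  rw [hG x (Submodule.subset_span ⟨i, j, hi, hj, hij, a, ha, b, hb, hx⟩),
    hΛ x z hi hj hij ha hb hx]

theorem exists_succ [∀ k, FiniteDimensional K (𝒜 k)] (free : IsFreeAlgebra K H)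
    (r : InfinitesimalProduct K H) :
    ∃ γ : BilinForm K H, IsPairing 𝒜 (n + 1) γ ∧ ∀ k ≤ n, ∀ x ∈ 𝒜 k, γ x = β x := by
  obtain ⟨G, hG, symm, separating⟩ := h.exists_separating_isProductForm free r
  let q : H →ₗ[K] 𝒜 (n + 1) := degreeProj 𝒜 (n + 1)
  have q_of_mem {x : H} (hx : x ∈ 𝒜 (n + 1)) : q x = ⟨x, hx⟩ := degreeProj_coe ⟨x, hx⟩
  let q' : H →ₗ[K] H := (𝒜 (n + 1)).subtype ∘ₗ q
  let γ : BilinForm K H := β - β.compl₁₂ q' q' + G.compl₁₂ q q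
  have γ_of_mem_ne {k : ℕ} (hk : k ≠ n + 1) {x : H} (hx : x ∈ 𝒜 k) : γ x = β x := by
    ext y
    simp [γ, q', q, degreeProj_of_mem_ne hk hx]
  have γ_of_mem {x : H} (hx : x ∈ 𝒜 (n + 1)) (y : H) : γ x y = G ⟨x, hx⟩ (q y) := by
    have β_q' : β x (q' y) = β x y :=
      apply_degreeProj (fun k hk z hz => h.homogeneous hk.symm hx hz) y
    have q'_x : q' x = x := congrArg Subtype.val (q_of_mem hx)
    change β x y - β (q' x) (q' y) + G (q x) (q y) = _
    rw [q'_x, β_q', sub_self, zero_add, q_of_mem hx]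
  refine ⟨γ, ?_, fun k hk x hx => γ_of_mem_ne (by lia) hx⟩
  constructor
  case symm => exact fun x y => by simp [γ, h.symm x, h.symm (q' x), symm (q x)]
  case apply_one =>
    rw [γ_of_mem_ne n.succ_ne_zero.symm SetLike.GradedOne.one_mem, h.apply_one]
  case homogeneous =>
    intro i j x y hij hx hy
    obtain rfl | hi := eq_or_ne i (n + 1)
    · simp [γ_of_mem hx, q, degreeProj_of_mem_ne hij.symm hy]
    · rw [γ_of_mem_ne hi hx, h.homogeneous hij hx hy]
  case apply_mul_of_mem =>
    intro i j a b z hi hj hij ha hb hz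
    have hab := SetLike.GradedMul.mul_mem ha hb
    rw [tmul_self_congr (γ_of_mem_ne (by lia) ha) (γ_of_mem_ne (by lia) hb)]
    obtain hn | hn := eq_or_ne (i + j) (n + 1)
    · rw [hn] at hab hz
      rw [γ_of_mem hab, q_of_mem hz, hG ⟨a * b, hab⟩ ⟨z, hz⟩ hi hj hn ha hb rfl]
    · rw [γ_of_mem_ne hn hab, h.apply_mul_of_mem hi hj (by lia) ha hb hz]
  case separating =>
    intro k x hk hx γ_x
    obtain rfl | hn := eq_or_ne k (n + 1)
    · refine congrArg Subtype.val (separating ⟨x, hx⟩ (LinearMap.ext fun y => ?_))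
      rw [← degreeProj_coe y]
      exact (γ_of_mem hx _).symm.trans (LinearMap.congr_fun γ_x _)
    · exact h.separating (by lia) hx ((γ_of_mem_ne hn hx).symm.trans γ_x)

end IsPairing

theorem exists_forall_isPairing [∀ k, FiniteDimensional K (𝒜 k)] (free : IsFreeAlgebra K H)
    (r : InfinitesimalProduct K H) : ∃ β : BilinForm K H, ∀ n, IsPairing 𝒜 n β := by
  choose! next isPairing_next next_eq using
    fun n (β : BilinForm K H) (h : IsPairing 𝒜 n β) => h.exists_succ free r
  obtain ⟨β₀, hβ₀⟩ : ∃ β : BilinForm K H, IsPairing 𝒜 0 β := ⟨_, isPairing_zero⟩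
  let s : ℕ → BilinForm K H := fun n => n.rec β₀ next
  have hs (n : ℕ) : IsPairing 𝒜 n (s n) := by
    induction n with
    | zero => exact hβ₀
    | succ n ih => exact isPairing_next n _ ih
  have s_eq {k : ℕ} {x : H} (hx : x ∈ 𝒜 k) {n : ℕ} (hk : k ≤ n) : s n x = s k x := by
    induction n, hk using Nat.le_induction with
    | base => rfl
    | succ n hk ih => exact (next_eq n _ (hs n) k hk x hx).trans ih
  obtain ⟨β, hβ⟩ := exists_linearMap_eq_on_components 𝒜 s
  have β_eq {k n : ℕ} (hk : k ≤ n) {x : H} (hx : x ∈ 𝒜 k) : β x = s n x :=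
    (hβ k x hx).trans (s_eq hx hk).symm
  refine ⟨β, fun n => ?_⟩
  constructor
  case symm =>
    refine LinearMap.congr_fun₂ (f := β) (g := LinearMap.flip β)
      (linearMap_ext_on_components (𝒜 := 𝒜) fun i x hx =>
        linearMap_ext_on_components (𝒜 := 𝒜) fun j y hy => ?_)
    rw [LinearMap.flip_apply, β_eq (le_max_left i j) hx, β_eq (le_max_right i j) hy, (hs _).symm]
  case homogeneous => exact fun hij hx hy => hβ _ _ hx ▸ (hs _).homogeneous hij hx hy
  case apply_one => rw [hβ 0 1 SetLike.GradedOne.one_mem, (hs 0).apply_one]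
  case apply_mul_of_mem =>
    intro i j a b z hi hj hij ha hb hz
    rw [β_eq hij (SetLike.GradedMul.mul_mem ha hb), (hs n).apply_mul_of_mem hi hj hij ha hb hz,
      tmul_self_congr (β_eq (n := n) (by lia) ha) (β_eq (by lia) hb)]
  case separating => exact fun hk hx β_x => (hs n).separating hk hx (β_eq hk hx ▸ β_x)

omit [IsConnectedGraded 𝒜] in
theorem exists_equiv_gradedDual [∀ k, FiniteDimensional K (𝒜 k)] (h : ∀ n, IsPairing 𝒜 n β) :
    ∃ φ : H ≃ₗ[K] gradedDual 𝒜, ∀ x, (φ x).1 = β x := by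
  have mem_gradedDual (x : H) : β x ∈ gradedDual 𝒜 := by
    induction x using DirectSum.Decomposition.inductionOn 𝒜 with
    | zero => rw [map_zero]; exact zero_mem _
    | @homogeneous i x => exact ⟨i + 1, fun n hn y hy => (h 0).homogeneous (by lia) x.2 hy⟩
    | add x y hx hy => rw [map_add]; exact add_mem hx hy
  refine ⟨.ofBijective (LinearMap.codRestrict _ β mem_gradedDual) ⟨?_, ?_⟩, fun x => rfl⟩
  · refine (injective_iff_map_eq_zero _).2 fun x hx => eq_of_degreeProj_eq 𝒜 fun n => ?_
    refine ((h n).restrict_separating le_rfl (LinearMap.ext fun y => ?_)).trans (map_zero _).symm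
    refine (apply_degreeProj (f := LinearMap.flip β y)
      (fun k hk z hz => (h n).homogeneous hk hz y.2) x).trans ?_
    exact LinearMap.congr_fun (congrArg Subtype.val hx) y
  · rintro ⟨f, N, hN⟩
    have exists_eq (n : ℕ) : ∃ x : 𝒜 n, β.restrict (𝒜 n) x = f ∘ₗ (𝒜 n).subtype :=
      (LinearMap.injective_iff_surjective_of_finrank_eq_finrank
        Subspace.dual_finrank_eq.symm).1 ((injective_iff_map_eq_zero _).2 fun x =>
          (h n).restrict_separating le_rfl) _
    choose x hx using exists_eq
    refine ⟨∑ n ∈ Finset.range N, x n, Subtype.ext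
      (linearMap_ext_on_components (𝒜 := 𝒜) fun n y hy => ?_)⟩
    change β (∑ n ∈ Finset.range N, x n) y = f y
    rw [map_sum, LinearMap.sum_apply, Finset.sum_eq_single n
      (fun k _ hk => (h n).homogeneous hk (x k).2 hy) fun hn => ?_]
    · exact LinearMap.congr_fun (hx n) ⟨y, hy⟩
    · exact (LinearMap.congr_fun (hx n) ⟨y, hy⟩).trans (hN n (by simpa using hn) y hy)

theorem isSelfDual_of_infinitesimalProduct [∀ k, FiniteDimensional K (𝒜 k)]
    (free : IsFreeAlgebra K H) (r : InfinitesimalProduct K H) : IsSelfDual 𝒜 := by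
  obtain ⟨β, hβ⟩ := exists_forall_isPairing (𝒜 := 𝒜) free r
  obtain ⟨φ, hφ⟩ := exists_equiv_gradedDual hβ
  have apply_mul (a b z : H) : β (a * b) z = β.tmul β (a ⊗ₜ b) (comul z) := by
    refine LinearMap.congr_fun (f := β (a * b)) (g := β.tmul β (a ⊗ₜ b) ∘ₗ comul)
      (linearMap_ext_on_components (𝒜 := 𝒜) fun n z hz => (hβ n).apply_mul le_rfl hz a b) z
  have tmul_eq (a b : H) : LinearMap.mul' K K ∘ₗ map (β a) (β b) = β.tmul β (a ⊗ₜ b) := by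
    ext; simp [mul_comm]
  have eval_comp (y : H) :
      Module.Dual.eval K H y ∘ₗ (gradedDual 𝒜).subtype ∘ₗ φ.toLinearMap = β y :=
    LinearMap.ext fun x => (LinearMap.congr_fun (hφ x) y).trans ((hβ 0).symm x y)
  refine ⟨φ, fun m n hmn x hx y hy => ?_, ?_, fun x y => ?_, fun x => ?_, fun x y z => ?_⟩
  · rw [hφ, (hβ 0).homogeneous hmn.symm hx hy]
  · rw [hφ, (hβ 0).apply_one]
  · ext z
    rw [hφ, hφ, hφ, apply_mul, ← tmul_eq]
    rfl
  · rw [hφ, (hβ 0).apply_one_right]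
  · rw [hφ, eval_comp, eval_comp, (hβ 0).symm, apply_mul, ← tmul_eq]
    rfl

end SelfDual

/-! ### Primitive elements in characteristic zero -/

section FreeLie

variable {K : Type u} {X : Type v} [Field K]

@[elab_as_elim, induction_eliminator]
theorem freeLieAlgebra_induction {motive : FreeLieAlgebra K X → Prop}
    (of : ∀ x, motive (FreeLieAlgebra.of K x)) (zero : motive 0)
    (add : ∀ a b, motive a → motive b → motive (a + b))
    (smul : ∀ (c : K) a, motive a → motive (c • a))
    (lie : ∀ a b, motive a → motive b → motive ⁅a, b⁆) (a : FreeLieAlgebra K X) : motive a := by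
  let S : LieSubalgebra K (FreeLieAlgebra K X) :=
    { carrier := {a | motive a}
      zero_mem' := zero
      add_mem' := add _ _
      smul_mem' := fun c _ => smul c _
      lie_mem' := lie _ _ }
  have incl_lift : S.incl.comp (FreeLieAlgebra.lift K fun x => (⟨.of K x, of x⟩ : S)) =
      LieHom.id := by
    ext x
    simp
  have h := LieHom.congr_fun incl_lift a
  rw [LieHom.comp_apply, LieHom.id_apply] at h
  exact h ▸ Subtype.property _

variable (K X)

/-- The representation of the free Lie algebra `L` on `K × L` given by
`u • (c, l) = (0, c D u + [u, l])`, where `D` is the derivation that fixes the generators. It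
serves to factor `D` through the free associative algebra. -/
noncomputable def eulerAction : FreeLieAlgebra K X →ₗ⁅K⁆ Module.End K (K × FreeLieAlgebra K X) :=
  FreeLieAlgebra.lift K fun x => LinearMap.inr K K (FreeLieAlgebra K X) ∘ₗ
    (LinearMap.toSpanSingleton K _ (.of K x)).coprod (LieAlgebra.ad K _ (.of K x))

/-- The derivation of the free Lie algebra that fixes the generators. -/
noncomputable def eulerDerivation : Module.End K (FreeLieAlgebra K X) :=
  LinearMap.snd K K _ ∘ₗ LinearMap.applyₗ (1, 0) ∘ₗ (eulerAction K X).toLinearMap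

variable {K X}

theorem eulerAction_apply_fst (u : FreeLieAlgebra K X) (z : K × FreeLieAlgebra K X) :
    (eulerAction K X u z).1 = 0 := by
  induction u generalizing z with
  | of x => simp [eulerAction]
  | zero => simp
  | add a b ha hb => simp [ha, hb]
  | smul c a ha => simp [ha]
  | lie a b ha hb => simp [Ring.lie_def, ha, hb]

theorem eulerAction_zero_left (u l : FreeLieAlgebra K X) :
    eulerAction K X u (0, l) = (0, ⁅u, l⁆) := by
  induction u generalizing l with
  | of x => simp [eulerAction]
  | zero => simp [Prod.mk_zero_zero]
  | add a b ha hb => simp [ha, hb]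
  | smul c a ha => simp [ha]
  | lie a b ha hb => simp [Ring.lie_def, ha, hb]

theorem eulerAction_one_zero (u : FreeLieAlgebra K X) :
    eulerAction K X u (1, 0) = (0, eulerDerivation K X u) :=
  Prod.ext (eulerAction_apply_fst u _) rfl

theorem eulerDerivation_of (x : X) : eulerDerivation K X (.of K x) = .of K x := by
  simp [eulerDerivation, eulerAction]

theorem eulerDerivation_lie (u v : FreeLieAlgebra K X) :
    eulerDerivation K X ⁅u, v⁆ = ⁅eulerDerivation K X u, v⁆ + ⁅u, eulerDerivation K X v⁆ := by
  have h := congrArg Prod.snd (eulerAction_one_zero ⁅u, v⁆)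
  simp only [LieHom.map_lie, Ring.lie_def, LinearMap.sub_apply, Module.End.mul_apply,
    eulerAction_one_zero, eulerAction_zero_left, Prod.snd_sub] at h
  rw [← h, ← lie_skew (eulerDerivation K X u) v]
  abel

theorem eulerDerivation_injective [CharZero K] : Function.Injective (eulerDerivation K X) := by
  let D := eulerDerivation K X
  let S : Submodule K (FreeLieAlgebra K X) := ⨆ n : ℕ, D.eigenspace ((n + 1 : ℕ) : K)
  have lie_mem : Submodule.map₂ (LieAlgebra.ad K (FreeLieAlgebra K X)).toLinearMap S S ≤ S := by
    simp only [S, Submodule.map₂_iSup_left, Submodule.map₂_iSup_right, iSup_le_iff]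
    refine fun n m => le_iSup_of_le (m + n + 1) (Submodule.map₂_le.2 fun u hu v hv => ?_)
    rw [Module.End.mem_eigenspace_iff] at hu hv ⊢
    rw [LieHom.coe_toLinearMap, LieAlgebra.ad_apply, eulerDerivation_lie, hu, hv, smul_lie,
      lie_smul, ← add_smul]
    push_cast
    ring_nf
  have mem (u : FreeLieAlgebra K X) : u ∈ S := by
    induction u with
    | of x =>
      refine Submodule.mem_iSup_of_mem 0 (Module.End.mem_eigenspace_iff.2 ?_)
      rw [eulerDerivation_of, zero_add, Nat.cast_one, one_smul]
    | zero => exact zero_mem S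
    | add a b ha hb => exact add_mem ha hb
    | smul c a ha => exact S.smul_mem c ha
    | lie a b ha hb => exact lie_mem (Submodule.apply_mem_map₂ _ ha hb)
  have le : S ≤ ⨆ μ, ⨆ (_ : μ ≠ 0), D.eigenspace μ :=
    iSup_le fun n => le_iSup₂_of_le (n + 1 : ℕ) (Nat.cast_ne_zero.2 n.succ_ne_zero) le_rfl
  refine (injective_iff_map_eq_zero D).2 fun u hu => ?_
  refine Submodule.disjoint_def.1 (D.eigenspaces_iSupIndep 0) u ?_ (le (mem u))
  rw [Module.End.mem_eigenspace_iff, zero_smul, hu]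

theorem freeLieAlgebra_lift_ι_injective [CharZero K] :
    Function.Injective (FreeLieAlgebra.lift K (FreeAlgebra.ι K : X → FreeAlgebra K X)) := by
  let Φ : FreeAlgebra K X →ₐ[K] Module.End K (K × FreeLieAlgebra K X) :=
    FreeAlgebra.lift K fun x => eulerAction K X (.of K x)
  have factor : Φ.toLieHom.comp (FreeLieAlgebra.lift K (FreeAlgebra.ι K)) = eulerAction K X := by
    ext x : 1
    simp [Φ]
  refine (injective_iff_map_eq_zero _).2 fun u hu => ?_
  have action_eq_zero := LieHom.congr_fun factor u
  rw [LieHom.comp_apply, hu, map_zero] at action_eq_zero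
  have h := eulerAction_one_zero u
  rw [← action_eq_zero, LinearMap.zero_apply] at h
  exact eulerDerivation_injective ((congrArg Prod.snd h).symm.trans (map_zero _).symm)

end FreeLie

section Homogeneous

open Finset.HasAntidiagonal (antidiagonal mem_antidiagonal)
open Coalgebra (comul counit)
open TensorProduct

variable {K : Type u} {H : Type v} [Field K] [Ring H] [Bialgebra K H] {𝒜 : ℕ → Submodule K H}
  [GradedAlgebra 𝒜] [IsConnectedGraded 𝒜]

omit [IsConnectedGraded 𝒜] in
theorem degreeProj_apply (n : ℕ) (x : H) : degreeProj 𝒜 n x = DirectSum.decompose 𝒜 x n :=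
  rfl

theorem degreeProj_zero_coe (x : H) :
    (degreeProj 𝒜 0 x : H) = algebraMap K H (counit x) := by
  rw [IsConnectedGraded.eq_algebraMap_counit (degreeProj 𝒜 0 x).2,
    apply_degreeProj fun k hk y hy => IsConnectedGraded.counit_eq_zero hk hy]

variable (𝒜) in
omit [IsConnectedGraded 𝒜] in
theorem sum_degreeProj_tmul_degreeProj (n : ℕ) {i j : ℕ} {a b : H} (ha : a ∈ 𝒜 i) (hb : b ∈ 𝒜 j) :
    ∑ d ∈ antidiagonal n, (degreeProj 𝒜 d.1 a : H) ⊗ₜ[K] (degreeProj 𝒜 d.2 b : H) =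
      if i + j = n then a ⊗ₜ b else 0 := by
  have eq_zero (d : ℕ × ℕ) (hd : d ≠ (i, j)) :
      (degreeProj 𝒜 d.1 a : H) ⊗ₜ[K] (degreeProj 𝒜 d.2 b : H) = 0 := by
    obtain h | h : i ≠ d.1 ∨ j ≠ d.2 := by grind
    · rw [degreeProj_of_mem_ne h ha, ZeroMemClass.coe_zero, zero_tmul]
    · rw [degreeProj_of_mem_ne h hb, ZeroMemClass.coe_zero, tmul_zero]
  split_ifs with h
  · rw [Finset.sum_eq_single_of_mem (i, j) (mem_antidiagonal.2 h) fun d _ => eq_zero d]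
    lift a to 𝒜 i using ha
    lift b to 𝒜 j using hb
    simp
  · refine Finset.sum_eq_zero fun d hd => eq_zero d ?_
    rintro rfl
    exact h (mem_antidiagonal.1 hd)

theorem comul_degreeProj (n : ℕ) (x : H) :
    comul (R := K) (degreeProj 𝒜 n x : H) = (∑ d ∈ antidiagonal n,
      map ((𝒜 d.1).subtype ∘ₗ degreeProj 𝒜 d.1) ((𝒜 d.2).subtype ∘ₗ degreeProj 𝒜 d.2))
        (comul x) := by
  refine LinearMap.congr_fun (f := comul ∘ₗ (𝒜 n).subtype ∘ₗ degreeProj 𝒜 n)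
    (g := (∑ d ∈ antidiagonal n, _) ∘ₗ comul)
    (linearMap_ext_on_components (𝒜 := 𝒜) fun k x hx => ?_) x
  simp only [LinearMap.comp_apply, Submodule.subtype_apply]
  obtain rfl | hk := eq_or_ne k n
  · lift x to 𝒜 k using hx
    rw [degreeProj_coe]
    refine eq_of_mem_tensorDegree (f := LinearMap.id) (fun i j hij a ha b hb => ?_)
      (IsConnectedGraded.comul_mem x.2)
    simpa [show i + j = k from hij] using (sum_degreeProj_tmul_degreeProj 𝒜 k ha hb).symm
  · rw [degreeProj_of_mem_ne hk hx, ZeroMemClass.coe_zero, map_zero]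
    refine eq_of_mem_tensorDegree (f := 0) (fun i j hij a ha b hb => ?_)
      (IsConnectedGraded.comul_mem hx)
    simpa [show i + j ≠ n from hij ▸ hk] using (sum_degreeProj_tmul_degreeProj 𝒜 n ha hb).symm

theorem degreeProj_mem_primitives {x : H} (hx : x ∈ primitives K H) (n : ℕ) :
    (degreeProj 𝒜 n x : H) ∈ primitives K H := by
  have one_eq_zero (k : ℕ) (hk : k ≠ 0) : degreeProj 𝒜 k (1 : H) = 0 :=
    degreeProj_of_mem_ne hk.symm SetLike.GradedOne.one_mem
  have proj_zero_one : (degreeProj 𝒜 0 (1 : H) : H) = 1 := by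
    rw [degreeProj_zero_coe, Bialgebra.counit_one, map_one]
  rw [mem_primitives, comul_degreeProj, mem_primitives.1 hx, map_add, LinearMap.sum_apply,
    LinearMap.sum_apply]
  congr 1
  · rw [Finset.sum_eq_single_of_mem (n, 0) (by simp)]
    · simp [proj_zero_one]
    · intro d hd hne
      have : d.2 ≠ 0 := by grind [mem_antidiagonal]
      simp [one_eq_zero _ this]
  · rw [Finset.sum_eq_single_of_mem (0, n) (by simp)]
    · simp [proj_zero_one]
    · intro d hd hne
      have : d.1 ≠ 0 := by grind [mem_antidiagonal]
      simp [one_eq_zero _ this]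

/-- A graded form of Nakayama's lemma. -/
theorem le_of_le_sup_ker_counit_mul {M : Submodule K H} {N : Ideal H} (hN : N.IsHomogeneous 𝒜)
    (h : M ≤ N.restrictScalars K ⊔ LinearMap.ker (counit (R := K) (A := H)) * M) :
    M ≤ N.restrictScalars K := by
  have mem (n : ℕ) : ∀ x ∈ M, (DirectSum.decompose 𝒜 x n : H) ∈ N := by
    induction n using Nat.strong_induction_on with
    | h n ih =>
      have le : LinearMap.ker (counit (R := K) (A := H)) * M ≤
          (N.restrictScalars K).comap ((𝒜 n).subtype ∘ₗ degreeProj 𝒜 n) := by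
        refine Submodule.mul_le.2 fun a ha x hx => ?_
        change (DirectSum.decompose 𝒜 (a * x) n : H) ∈ N
        rw [DirectSum.decompose_mul, DirectSum.coe_mul_apply_eq_sum_antidiagonal]
        refine sum_mem fun d hd => ?_
        obtain hd₁ | hd₁ := eq_or_ne d.1 0
        · rw [hd₁, ← degreeProj_apply, degreeProj_zero_coe, LinearMap.mem_ker.1 ha, map_zero,
            zero_mul]
          exact zero_mem N
        · rw [mem_antidiagonal] at hd
          exact N.mul_mem_left _ (ih d.2 (by lia) x hx)
      intro x hx
      obtain ⟨y, hy, z, hz, rfl⟩ := Submodule.mem_sup.1 (h hx)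
      rw [DirectSum.decompose_add]
      exact add_mem (hN n hy) (le hz)
  classical
  intro x hx
  rw [← DirectSum.sum_support_decompose 𝒜 x]
  exact sum_mem fun n _ => mem n x hx

variable (𝒜) in
theorem exists_homogeneous_primitives : ∃ (κ : Type v) (w : κ → H),
    (∀ i, w i ∈ primitives K H ∧ SetLike.IsHomogeneousElem 𝒜 (w i)) ∧
    LinearIndependent K (fun i => (LinearMap.ker (counit (R := K) (A := H)) *
      (primitives K H).toSubmodule).mkQ (w i)) ∧
    (primitives K H).toSubmodule ≤ (Ideal.span (Set.range w)).restrictScalars K := by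
  let D : Submodule K H := LinearMap.ker (counit (R := K) (A := H)) * (primitives K H).toSubmodule
  obtain ⟨κ, a, -, span_eq, ind⟩ := exists_linearIndependent' K
    fun x : {x : H // x ∈ primitives K H ∧ SetLike.IsHomogeneousElem 𝒜 x} => D.mkQ x
  let w (i : κ) : H := a i
  let N : Ideal H := Ideal.span (Set.range w)
  have span_le : Submodule.span K (Set.range w) ≤ N.restrictScalars K :=
    Submodule.span_le.2 Ideal.subset_span
  have mem {x : H} (hx : x ∈ primitives K H) (hx' : SetLike.IsHomogeneousElem 𝒜 x) :
      x ∈ N.restrictScalars K ⊔ D := by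
    have h : D.mkQ x ∈ (Submodule.span K (Set.range w)).map D.mkQ := by
      rw [Submodule.map_span, ← Set.range_comp]
      exact span_eq ▸ Submodule.subset_span ⟨⟨x, hx, hx'⟩, rfl⟩
    rw [← Submodule.mem_comap, Submodule.comap_map_mkQ, sup_comm] at h
    exact sup_le_sup_right span_le D h
  refine ⟨κ, w, fun i => (a i).2, ind, le_of_le_sup_ker_counit_mul (𝒜 := 𝒜)
    (Ideal.homogeneous_span _ _ (Set.forall_mem_range.2 fun i => (a i).2.2)) fun x hx => ?_⟩
  classical
  rw [← DirectSum.sum_support_decompose 𝒜 x]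
  exact sum_mem fun n _ => mem (degreeProj_mem_primitives hx n) ⟨n, SetLike.coe_mem _⟩

end Homogeneous

section Coinvariants

open Coalgebra (comul counit)
open TensorProduct

variable {K : Type u} {H : Type v} [Field K] [Ring H] [Bialgebra K H]

/-- The linear map `x ↦ ∑ θ(x₁) x₂`. -/
def leftContract (θ : Module.Dual K H) : H →ₗ[K] H :=
  (TensorProduct.lid K H).toLinearMap ∘ₗ θ.rTensor H ∘ₗ comul

variable (K H) in
/-- The elements of `H` that are coinvariant under the left coaction of the quotient `H / H P`,
where `P` is the space of primitive elements. The coaction is tested on the linear forms `θ` of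
the quotient. -/
def coinvariants : Submodule K H :=
  ⨅ θ ∈ (⊤ * (primitives K H).toSubmodule).dualAnnihilator,
    LinearMap.eqLocus (leftContract θ) (θ 1 • LinearMap.id)

theorem mem_coinvariants {y : H} : y ∈ coinvariants K H ↔
    ∀ θ ∈ (⊤ * (primitives K H).toSubmodule).dualAnnihilator, leftContract θ y = θ 1 • y := by
  simp [coinvariants]

theorem leftContract_one (θ : Module.Dual K H) : leftContract θ 1 = θ 1 • (1 : H) := by
  simp [leftContract, Algebra.TensorProduct.one_def]

theorem leftContract_mul_of_mem_primitives {θ : Module.Dual K H}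
    (hθ : θ ∈ (⊤ * (primitives K H).toSubmodule).dualAnnihilator) (x : H) {p : H}
    (hp : p ∈ primitives K H) : leftContract θ (x * p) = leftContract θ x * p := by
  suffices h : ∀ t : H ⊗[K] H, TensorProduct.lid K H (θ.rTensor H (t * (p ⊗ₜ 1 + 1 ⊗ₜ p))) =
      TensorProduct.lid K H (θ.rTensor H t) * p by
    simpa [leftContract, mem_primitives.1 hp] using h (comul x)
  intro t
  induction t with
  | zero => simp
  | tmul a b =>
    simp [mul_add, (Submodule.mem_dualAnnihilator θ).1 hθ _
      (Submodule.mul_mem_mul (Submodule.mem_top (x := a)) hp)]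
  | add s t hs ht => rw [add_mul, map_add, map_add, map_add, map_add, hs, ht, add_mul]

theorem primitives_le_coinvariants : (primitives K H).toSubmodule ≤ coinvariants K H := by
  refine fun p hp => mem_coinvariants.2 fun θ hθ => ?_
  rw [← one_mul p, leftContract_mul_of_mem_primitives hθ 1 hp, leftContract_one, smul_mul_assoc]

theorem counit_leftContract (θ : Module.Dual K H) (y : H) :
    counit (R := K) (leftContract θ y) = θ y := by
  suffices h : ∀ t : H ⊗[K] H, counit (R := K) (TensorProduct.lid K H (θ.rTensor H t)) =
      θ (TensorProduct.rid K H ((counit (R := K)).lTensor H t)) by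
    simpa [leftContract] using h (comul y)
  intro t
  induction t with
  | zero => simp
  | tmul a b => simp [mul_comm]
  | add s t hs ht => simp only [map_add, hs, ht]

theorem sub_counit_mem_of_mem_coinvariants {y : H} (hy : y ∈ coinvariants K H) :
    y - algebraMap K H (counit y) ∈ ⊤ * (primitives K H).toSubmodule := by
  rw [← Subspace.dualAnnihilator_dualCoannihilator_eq (W := ⊤ * (primitives K H).toSubmodule),
    Submodule.mem_dualCoannihilator]
  intro θ hθ
  rw [map_sub, ← counit_leftContract θ y, mem_coinvariants.1 hy θ hθ,
    Algebra.algebraMap_eq_smul_one, map_smul, map_smul, smul_eq_mul, smul_eq_mul, mul_comm,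
    sub_self]

theorem eq_zero_of_mem_primitives_of_mem_zero {𝒜 : ℕ → Submodule K H} [IsConnectedGraded 𝒜] {p : H}
    (hp : p ∈ primitives K H) (h₀ : p ∈ 𝒜 0) : p = 0 := by
  rw [IsConnectedGraded.eq_algebraMap_counit h₀, counit_of_mem_primitives hp, map_zero]

variable {κ : Type*} {w : κ → H} (hw : ∀ i, w i ∈ primitives K H)
include hw

theorem mem_coinvariants_of_linearCombination_mem (ind : LinearIndependent H w) {h : κ →₀ H}
    (hh : Finsupp.linearCombination H w h ∈ coinvariants K H) (i : κ) :
    h i ∈ coinvariants K H := by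
  refine mem_coinvariants.2 fun θ hθ => ?_
  have key : Finsupp.linearCombination H w
      (h.mapRange (leftContract θ) (map_zero _) - θ 1 • h) = 0 := by
    rw [map_sub, LinearMap.map_smul_of_tower, ← mem_coinvariants.1 hh θ hθ, sub_eq_zero,
      Finsupp.linearCombination_apply, Finsupp.sum_mapRange_index (by simp),
      Finsupp.linearCombination_apply, map_finsuppSum]
    refine Finsupp.sum_congr fun i _ => ?_
    rw [smul_eq_mul, smul_eq_mul, leftContract_mul_of_mem_primitives hθ _ (hw i)]
  exact sub_eq_zero.1 (DFunLike.congr_fun (linearIndependent_iff.1 ind _ key) i)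

theorem coinvariants_le {𝒜 : ℕ → Submodule K H} [GradedAlgebra 𝒜] [IsConnectedGraded 𝒜]
    (homogeneous : ∀ i, SetLike.IsHomogeneousElem 𝒜 (w i)) (ind : LinearIndependent H w)
    (primitives_le : (primitives K H).toSubmodule ≤ (Ideal.span (Set.range w)).restrictScalars K)
    {S : Submodule K H} (one_mem : 1 ∈ S) (mul_mem : ∀ x ∈ S, ∀ i, x * w i ∈ S) :
    coinvariants K H ≤ S := by
  classical
  have mul_le : ⊤ * (primitives K H).toSubmodule ≤ (Ideal.span (Set.range w)).restrictScalars K :=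
    Submodule.mul_le.2 fun x _ p hp => Ideal.mul_mem_left _ x (primitives_le hp)
  have mem (n : ℕ) : ∀ y ∈ coinvariants K H, (DirectSum.decompose 𝒜 y n : H) ∈ S := by
    induction n using Nat.strong_induction_on with
    | h n ih =>
      intro y hy
      have scalar_mem : algebraMap K H (counit y) ∈ coinvariants K H ⊓ S := by
        rw [Algebra.algebraMap_eq_smul_one]
        exact Submodule.smul_mem _ _
          ⟨mem_coinvariants.2 fun θ _ => leftContract_one θ, one_mem⟩
      obtain ⟨h, hh⟩ := (Finsupp.mem_span_range_iff_exists_finsupp (R := H)).1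
        (mul_le (sub_counit_mem_of_mem_coinvariants hy))
      have hh' : Finsupp.linearCombination H w h ∈ coinvariants K H := by
        rw [Finsupp.linearCombination_apply, hh]
        exact sub_mem hy scalar_mem.1
      rw [← sub_add_cancel y (algebraMap K H (counit y)), ← hh, DirectSum.decompose_add,
        DirectSum.add_apply, Submodule.coe_add, Finsupp.sum, DirectSum.decompose_sum,
        DFinsupp.finsetSum_apply, AddSubmonoidClass.coe_finsetSum]
      refine add_mem (sum_mem fun i _ => ?_) ?_
      · obtain ⟨d, hd⟩ := homogeneous i
        rw [smul_eq_mul, DirectSum.coe_decompose_mul_of_right_mem 𝒜 n hd]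
        split_ifs with hdn
        · obtain rfl | hd₀ := eq_or_ne d 0
          · rw [eq_zero_of_mem_primitives_of_mem_zero (hw i) hd, mul_zero]
            exact zero_mem S
          · exact mul_mem _
              (ih _ (by lia) _ (mem_coinvariants_of_linearCombination_mem hw ind hh' i)) i
        · exact zero_mem S
      · obtain rfl | hn := eq_or_ne n 0
        · rw [DirectSum.decompose_of_mem_same 𝒜 (SetLike.algebraMap_mem_graded 𝒜 _)]
          exact scalar_mem.2
        · rw [DirectSum.decompose_of_mem_ne 𝒜 (SetLike.algebraMap_mem_graded 𝒜 _) hn.symm]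
          exact zero_mem S
  intro y hy
  rw [← DirectSum.sum_support_decompose 𝒜 y]
  exact sum_mem fun n _ => mem n y hy

end Coinvariants

section Dynkin

open Coalgebra (comul counit)
open TensorProduct

variable {K : Type u} {H : Type v} [Field K] [Ring H] [HopfAlgebra K H] (𝒜 : ℕ → Submodule K H)
  [GradedAlgebra 𝒜]

/-- The derivation that multiplies the homogeneous elements of degree `n` by `n`. -/
noncomputable def degreeDerivation : H →ₗ[K] H :=
  DirectSum.toModule K ℕ H (fun n => (n : K) • (𝒜 n).subtype) ∘ₗ
    (DirectSum.decomposeLinearEquiv 𝒜).toLinearMap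

/-- The Dynkin operator `S ⋆ D`, the convolution product of the antipode and of the derivation given
by the degree. -/
noncomputable def dynkinOperator : H →ₗ[K] H :=
  LinearMap.mul' K H ∘ₗ map (HopfAlgebra.antipode K) (degreeDerivation 𝒜) ∘ₗ comul

variable {𝒜}

theorem degreeDerivation_of_mem {n : ℕ} {x : H} (hx : x ∈ 𝒜 n) :
    degreeDerivation 𝒜 x = (n : K) • x := by
  lift x to 𝒜 n using hx
  simp [degreeDerivation]

theorem degreeDerivation_mul (x y : H) : degreeDerivation 𝒜 (x * y) =
    degreeDerivation 𝒜 x * y + x * degreeDerivation 𝒜 y := by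
  refine LinearMap.congr_fun₂ (f := (LinearMap.mul K H).compr₂ (degreeDerivation 𝒜))
    (g := LinearMap.mul K H ∘ₗ degreeDerivation 𝒜 +
      (LinearMap.mul K H).compl₂ (degreeDerivation 𝒜)) ?_ x y
  refine linearMap_ext_on_components (𝒜 := 𝒜) fun i a ha =>
    linearMap_ext_on_components (𝒜 := 𝒜) fun j b hb => ?_
  simp [degreeDerivation_of_mem ha, degreeDerivation_of_mem hb,
    degreeDerivation_of_mem (SetLike.mul_mem_graded ha hb), add_smul]

theorem degreeDerivation_one : degreeDerivation 𝒜 (1 : H) = 0 := by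
  rw [degreeDerivation_of_mem (SetLike.GradedOne.one_mem (A := 𝒜)), Nat.cast_zero, zero_smul]

theorem dynkinOperator_one : dynkinOperator 𝒜 (1 : H) = 0 := by
  simp [dynkinOperator, Algebra.TensorProduct.one_def, degreeDerivation_one]

theorem antipode_of_mem_primitives {p : H} (hp : p ∈ primitives K H) :
    HopfAlgebra.antipode K p = -p := by
  have h := HopfAlgebra.mul_antipode_rTensor_comul_apply (R := K) p
  rw [mem_primitives.1 hp, counit_of_mem_primitives hp] at h
  simpa [add_eq_zero_iff_eq_neg] using h

theorem dynkinOperator_mul_of_mem_primitives (x : H) {p : H} (hp : p ∈ primitives K H) :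
    dynkinOperator 𝒜 (x * p) =
      ⁅dynkinOperator 𝒜 x, p⁆ + counit (R := K) x • degreeDerivation 𝒜 p := by
  let S : H →ₗ[K] H := HopfAlgebra.antipode K
  let D : H →ₗ[K] H := degreeDerivation 𝒜
  suffices h : ∀ t : H ⊗[K] H, LinearMap.mul' K H (map S D (t * (p ⊗ₜ 1 + 1 ⊗ₜ p))) =
      ⁅LinearMap.mul' K H (map S D t), p⁆ + LinearMap.mul' K H (S.rTensor H t) * D p by
    have key := h (comul x)
    rw [HopfAlgebra.mul_antipode_rTensor_comul_apply, ← Algebra.smul_def,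
      ← mem_primitives.1 hp, ← Bialgebra.comul_mul] at key
    exact key
  intro t
  induction t with
  | zero => simp
  | tmul a b =>
    simp only [S, D, mul_add, Algebra.TensorProduct.tmul_mul_tmul, mul_one, map_add, map_tmul,
      LinearMap.mul'_apply, HopfAlgebra.antipode_mul_antidistrib, antipode_of_mem_primitives hp,
      degreeDerivation_mul, LinearMap.rTensor_tmul, Ring.lie_def]
    noncomm_ring
  | add s t hs ht =>
    rw [add_mul, map_add, map_add, hs, ht]
    simp only [map_add, add_lie, add_mul]
    abel

theorem dynkinOperator_of_mem_primitives {p : H} (hp : p ∈ primitives K H) :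
    dynkinOperator 𝒜 p = degreeDerivation 𝒜 p := by
  have h := dynkinOperator_mul_of_mem_primitives (𝒜 := 𝒜) 1 hp
  rwa [one_mul, dynkinOperator_one, zero_lie, zero_add, Bialgebra.counit_one, one_smul] at h

variable [CharZero K] [IsConnectedGraded 𝒜] {κ : Type v}

theorem mem_of_dynkinOperator_mem (L : Submodule K H) {p : H} (hp : p ∈ primitives K H)
    (h : ∀ n, dynkinOperator 𝒜 (degreeProj 𝒜 n p : H) ∈ L) : p ∈ L := by
  classical
  rw [← DirectSum.sum_support_decompose 𝒜 p]
  refine sum_mem fun n _ => ?_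
  have hn := h n
  rw [dynkinOperator_of_mem_primitives (degreeProj_mem_primitives hp n),
    degreeDerivation_of_mem (SetLike.coe_mem _)] at hn
  obtain rfl | hn₀ := eq_or_ne n 0
  · rw [← degreeProj_apply, eq_zero_of_mem_primitives_of_mem_zero
      (degreeProj_mem_primitives hp 0) (SetLike.coe_mem _)]
    exact zero_mem L
  · exact (L.smul_mem_iff (Nat.cast_ne_zero.2 hn₀)).1 hn

variable (𝒜) in
theorem freeLieAlgebra_lift_surjective (w : κ → primitives K H)
    (homogeneous : ∀ i, SetLike.IsHomogeneousElem 𝒜 (w i : H))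
    (ind : LinearIndependent H fun i => (w i : H))
    (le : (primitives K H).toSubmodule ≤
      (Ideal.span (Set.range fun i => (w i : H))).restrictScalars K) :
    Function.Surjective (FreeLieAlgebra.lift K w) := by
  let L : LieSubalgebra K H := ((primitives K H).incl.comp (FreeLieAlgebra.lift K w)).range
  have mem_L (i : κ) : (w i : H) ∈ L := ⟨FreeLieAlgebra.of K i, by simp⟩
  have coinvariants_le_comap : coinvariants K H ≤ L.toSubmodule.comap (dynkinOperator 𝒜) := by
    refine coinvariants_le (𝒜 := 𝒜) (fun i => (w i).2) homogeneous ind le ?_ fun x hx i => ?_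
    · rw [Submodule.mem_comap, dynkinOperator_one]
      exact zero_mem _
    · rw [Submodule.mem_comap, dynkinOperator_mul_of_mem_primitives x (w i).2]
      obtain ⟨d, hd⟩ := homogeneous i
      rw [degreeDerivation_of_mem hd]
      exact add_mem (L.lie_mem hx (mem_L i)) (L.smul_mem _ (L.smul_mem _ (mem_L i)))
  intro p
  obtain ⟨u, hu⟩ : (p : H) ∈ L := mem_of_dynkinOperator_mem (𝒜 := 𝒜) L.toSubmodule p.2 fun n =>
    coinvariants_le_comap (primitives_le_coinvariants (degreeProj_mem_primitives p.2 n))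
  exact ⟨u, Subtype.ext hu⟩

theorem freeLieAlgebra_lift_injective (w : κ → primitives K H)
    (ind : LinearIndependent H fun i => (w i : H)) :
    Function.Injective (FreeLieAlgebra.lift K w) := by
  have factor : (primitives K H).incl.comp (FreeLieAlgebra.lift K w) =
      (FreeAlgebra.lift K fun i => (w i : H)).toLieHom.comp
        (FreeLieAlgebra.lift K (FreeAlgebra.ι K)) := by
    ext i : 1
    simp
  have h := (lift_injective_of_linearIndependent (Bialgebra.counitAlgHom K H)
    (fun i => counit_of_mem_primitives (w i).2) ind).comp freeLieAlgebra_lift_ι_injective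
  refine Function.Injective.of_comp (f := (primitives K H).incl) fun u v huv => h ?_
  exact (LieHom.congr_fun factor u).symm.trans (huv.trans (LieHom.congr_fun factor v))

variable (𝒜) in
include 𝒜 in
theorem isFreeLieAlgebra_primitives (free : IsFreeAlgebra K H) :
    IsFreeLieAlgebra K (primitives K H) := by
  obtain ⟨X, g, hg, counit_g⟩ := exists_free_generators free (Bialgebra.counitAlgHom K H)
  obtain ⟨κ, w, hw, indK, le⟩ := exists_homogeneous_primitives 𝒜
  have ind : LinearIndependent H w := linearIndependent_of_linearIndependent_mkQ hg counit_g
    (LinearMap.ker (counit (R := K) (A := H)) * (primitives K H).toSubmodule)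
    (fun i a ha => Submodule.mul_mem_mul ha (hw i).1) indK
  let w' (i : κ) : primitives K H := ⟨w i, (hw i).1⟩
  exact ⟨κ, ⟨(LieEquiv.ofBijective (FreeLieAlgebra.lift K w')
    ⟨freeLieAlgebra_lift_injective w' ind,
      freeLieAlgebra_lift_surjective 𝒜 w' (fun i => (hw i).2) ind le⟩).symm⟩⟩

end Dynkin

/-! ### Double posets and their two compositions -/

section Levi

variable {M : Type*} [Monoid M] {d : M → ℕ} (hmul : ∀ x y, d (x * y) = d x + d y)
  (hd : ∀ x, d x = 0 ↔ x = 1)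
include hmul hd

theorem eq_one_of_mul_eq_one_of_degree {x y : M} (h : x * y = 1) : x = 1 := by
  have degree_eq := hmul x y
  rw [h, (hd 1).2 rfl] at degree_eq
  exact (hd x).1 (by lia)

theorem isUnit_iff_eq_one_of_degree {x : M} : IsUnit x ↔ x = 1 := by
  refine ⟨fun hx => ?_, fun hx => hx ▸ isUnit_one⟩
  obtain ⟨y, hy⟩ := hx.exists_right_inv
  exact eq_one_of_mul_eq_one_of_degree hmul hd hy

theorem freeMonoid_lift_irreducible_surjective :
    Function.Surjective (FreeMonoid.lift fun a : {a : M // Irreducible a} => (a : M)) := by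
  intro x
  induction hn : d x using Nat.strong_induction_on generalizing x with
  | h n ih =>
    by_cases hx : IsUnit x
    · exact ⟨1, ((isUnit_iff_eq_one_of_degree hmul hd).1 hx).symm⟩
    by_cases hx' : Irreducible x
    · exact ⟨FreeMonoid.of ⟨x, hx'⟩, FreeMonoid.lift_eval_of _ _⟩
    obtain ⟨y, z, rfl, hy, hz⟩ : ∃ y z, x = y * z ∧ ¬ IsUnit y ∧ ¬ IsUnit z := by
      simpa [irreducible_iff, hx] using hx'
    rw [isUnit_iff_eq_one_of_degree hmul hd, ← hd] at hy hz
    rw [hmul] at hn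
    obtain ⟨v, rfl⟩ := ih _ (by lia) y rfl
    obtain ⟨w, rfl⟩ := ih _ (by lia) z rfl
    exact ⟨v * w, map_mul _ _ _⟩

theorem freeMonoid_lift_irreducible_injective
    (levi : ∀ a b x y : M, a * b = x * y → ∃ u, (a = x * u ∧ y = u * b) ∨ (x = a * u ∧ b = u * y)) :
    Function.Injective (FreeMonoid.lift fun a : {a : M // Irreducible a} => (a : M)) := by
  have ne_one (a : {a : M // Irreducible a}) (x : M) : (a : M) * x ≠ 1 := fun h =>
    a.2.ne_one (eq_one_of_mul_eq_one_of_degree hmul hd h)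
  have eq_one {a c : {a : M // Irreducible a}} {u : M} (h : (a : M) = c * u) : u = 1 :=
    (isUnit_iff_eq_one_of_degree hmul hd).1 ((a.2.isUnit_or_isUnit h).resolve_left c.2.not_isUnit)
  intro w w' h
  induction w using FreeMonoid.inductionOn' generalizing w' with
  | one =>
    induction w' using FreeMonoid.casesOn with
    | one => rfl
    | of_mul c l' =>
      rw [map_one, map_mul, FreeMonoid.lift_eval_of] at h
      exact absurd h.symm (ne_one c _)
  | of_mul a l ih =>
    induction w' using FreeMonoid.casesOn with
    | one =>
      rw [map_one, map_mul, FreeMonoid.lift_eval_of] at h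
      exact absurd h (ne_one a _)
    | of_mul c l' =>
      rw [map_mul, map_mul, FreeMonoid.lift_eval_of, FreeMonoid.lift_eval_of] at h
      obtain ⟨u, ⟨hac, hl⟩ | ⟨hac, hl⟩⟩ := levi _ _ _ _ h <;> obtain rfl := eq_one hac <;>
        rw [mul_one] at hac <;> rw [one_mul] at hl
      · rw [Subtype.ext hac, ih hl.symm]
      · rw [Subtype.ext hac, ih hl]

end Levi

namespace DoublePoset

variable {α β γ δ : Type}

theorem restrict_range_inl_comp_iso (P : DoublePoset α) (Q : DoublePoset β) :
    ((P.comp Q).restrict (Set.range Sum.inl)).Iso P :=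
  ((restrict_comp_iso P Q _ Set.univ ∅ (by simp) (by simp)).trans (comp_empty_iso _ _)).trans
    (restrict_univ_iso P)

theorem restrict_compl_range_inl_comp_iso (P : DoublePoset α) (Q : DoublePoset β) :
    ((P.comp Q).restrict (Set.range Sum.inl)ᶜ).Iso Q :=
  ((restrict_comp_iso P Q _ ∅ Set.univ (by simp) (by simp)).trans (empty_comp_iso _ _)).trans
    (restrict_univ_iso Q)

/-- Every element of `A` is smaller than every element of `B` for the second order, and not
comparable to it for the first one, as in a composition of `A` and `B`. -/
def Precedes (T : DoublePoset α) (A B : Set α) : Prop :=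
  ∀ x ∈ A, ∀ y ∈ B, T.le₂ x y ∧ ¬ T.le₁ x y ∧ ¬ T.le₁ y x

namespace Precedes

variable {T : DoublePoset α} {A B : Set α}

theorem mono {A' B' : Set α} (h : T.Precedes A B) (hA : A' ⊆ A) (hB : B' ⊆ B) :
    T.Precedes A' B' :=
  fun x hx y hy => h x (hA hx) y (hB hy)

theorem disjoint (h : T.Precedes A B) : Disjoint A B :=
  Set.disjoint_left.2 fun x hx hy => (h x hx x hy).2.1 (T.refl₁ x)

theorem not_le₂ (h : T.Precedes A B) {x y : α} (hx : x ∈ A) (hy : y ∈ B) : ¬ T.le₂ y x :=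
  fun hyx => h.disjoint.ne_of_mem hx hy (T.antisymm₂ _ _ (h x hx y hy).1 hyx)

theorem restrict_union_iso (h : T.Precedes A B) :
    (T.restrict (A ∪ B)).Iso ((T.restrict A).comp (T.restrict B)) := by
  classical
  refine Iso.symm ⟨(Equiv.Set.union h.disjoint).symm, ?_, ?_⟩
  · rintro (x | x) (y | y)
    · simp [comp, restrict, comap]
    · simpa [comp, restrict, comap] using (h _ x.2 _ y.2).2.1
    · simpa [comp, restrict, comap] using (h _ y.2 _ x.2).2.2
    · simp [comp, restrict, comap]
  · rintro (x | x) (y | y)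
    · simp [comp, restrict, comap]
    · simpa [comp, restrict, comap] using (h _ x.2 _ y.2).1
    · simpa [comp, restrict, comap] using h.not_le₂ y.2 x.2
    · simp [comp, restrict, comap]

theorem subset_or_subset (hA : T.Precedes A Aᶜ) (hB : T.Precedes B Bᶜ) : A ⊆ B ∨ B ⊆ A := by
  by_contra! h
  obtain ⟨⟨x, hxA, hxB⟩, y, hyB, hyA⟩ := Set.not_subset.1 h.1, Set.not_subset.1 h.2
  exact hA.not_le₂ hxA hyA (hB y hyB x hxB).1

end Precedes

theorem Iso.exists_precedes {T : DoublePoset α} {P : DoublePoset β} {Q : DoublePoset γ}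
    (h : T.Iso (P.comp Q)) :
    ∃ A : Set α, T.Precedes A Aᶜ ∧ (T.restrict A).Iso P ∧ (T.restrict Aᶜ).Iso Q := by
  obtain ⟨e, h₁, h₂⟩ := h
  have restrict_iso (s : Set (β ⊕ γ)) : (T.restrict (e ⁻¹' s)).Iso ((P.comp Q).restrict s) :=
    ⟨e.subtypeEquiv fun _ => Iff.rfl, fun _ _ => h₁ _ _, fun _ _ => h₂ _ _⟩
  refine ⟨e ⁻¹' Set.range Sum.inl, fun x hx y hy => ?_,
    (restrict_iso _).trans (restrict_range_inl_comp_iso P Q),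
    (restrict_iso _).trans (restrict_compl_range_inl_comp_iso P Q)⟩
  obtain ⟨a, ha⟩ := hx
  obtain ⟨b, hb⟩ : e y ∈ Set.range Sum.inr := Set.isCompl_range_inl_range_inr.compl_eq ▸ hy
  rw [h₁, h₁, h₂, ← ha, ← hb]
  simp [DoublePoset.comp]

/-- Exchange of the two orders. -/
def swap (P : DoublePoset α) : DoublePoset α where
  le₁ := P.le₂
  le₂ := P.le₁
  refl₁ := P.refl₂
  trans₁ := P.trans₂
  antisymm₁ := P.antisymm₂
  refl₂ := P.refl₁
  trans₂ := P.trans₁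
  antisymm₂ := P.antisymm₁

theorem Iso.swap {P : DoublePoset α} {Q : DoublePoset β} (h : P.Iso Q) : P.swap.Iso Q.swap := by
  obtain ⟨e, h₁, h₂⟩ := h
  exact ⟨e, h₂, h₁⟩

theorem IsPlane.swap {P : DoublePoset α} (h : P.IsPlane) : P.swap.IsPlane :=
  fun x y hxy => iff_not_comm.1 (h x y hxy)

theorem Contains.swap {P : DoublePoset α} {Q : DoublePoset β} {R : DoublePoset γ}
    (h : P.swap.Contains Q) (e : Q.swap.Iso R) : P.Contains R := by
  obtain ⟨s, hs⟩ := h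
  exact ⟨s, hs.swap.trans e⟩

theorem N₁_swap_iso : N₁.swap.Iso N₂ :=
  ⟨⟨![1, 3, 0, 2], ![2, 0, 3, 1], by decide, by decide⟩, by simp only [swap, N₁, N₂]; decide,
    by simp only [swap, N₁, N₂]; decide⟩

theorem IsWN.swap {P : DoublePoset α} (h : P.IsWN) : P.swap.IsWN :=
  ⟨h.1.swap, fun c => h.2.2 (c.swap N₁_swap_iso), fun c => h.2.1 (c.swap N₁_swap_iso.swap.symm)⟩

/-- The second composition of `P` and `Q`: on the disjoint union, every `x ∈ P` and `y ∈ Q` satisfy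
`x ≤₁ y` and are not comparable for `≤₂`. -/
def stack (P : DoublePoset α) (Q : DoublePoset β) : DoublePoset (α ⊕ β) :=
  (P.swap.comp Q.swap).swap

@[simp]
theorem stack_le₁ (P : DoublePoset α) (Q : DoublePoset β) :
    (P.stack Q).le₁ = Sum.Lex P.le₁ Q.le₁ :=
  rfl

theorem Iso.stack {P : DoublePoset α} {Q : DoublePoset β} {P' : DoublePoset γ}
    {Q' : DoublePoset δ} (h : P.Iso P') (k : Q.Iso Q') : (P.stack Q).Iso (P'.stack Q') :=
  (h.swap.comp k.swap).swap

theorem IsPlane.stack {P : DoublePoset α} {Q : DoublePoset β} (h : P.IsPlane) (k : Q.IsPlane) :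
    (P.stack Q).IsPlane :=
  (h.swap.comp k.swap).swap

theorem IsWN.stack {P : DoublePoset α} {Q : DoublePoset β} (h : P.IsWN) (k : Q.IsWN) :
    (P.stack Q).IsWN :=
  (h.swap.comp k.swap).swap

theorem empty_stack_iso [IsEmpty α] (E : DoublePoset α) (P : DoublePoset β) : (E.stack P).Iso P :=
  (empty_comp_iso E.swap P.swap).swap

theorem stack_empty_iso [IsEmpty α] (E : DoublePoset α) (P : DoublePoset β) : (P.stack E).Iso P :=
  (comp_empty_iso E.swap P.swap).swap

theorem restrict_stack_iso (P : DoublePoset α) (Q : DoublePoset β) (s : Set (α ⊕ β)) {t : Set α}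
    {u : Set β} (ht : t = Sum.inl ⁻¹' s) (hu : u = Sum.inr ⁻¹' s) :
    ((P.stack Q).restrict s).Iso ((P.restrict t).stack (Q.restrict u)) :=
  (restrict_comp_iso P.swap Q.swap s t u ht hu).swap

/-- The empty ideal. -/
def emptyIdeal (P : DoublePoset α) : P.Ideals :=
  ⟨∅, fun _ h => h.elim⟩

section Ideals

variable (P : DoublePoset α) (Q : DoublePoset β)

/-- The ideals of the second composition of `P` and `Q` that are contained in `Q`. -/
def idealRight : Q.Ideals ↪ (P.stack Q).Ideals where
  toFun J := ⟨Sum.inr '' J.1, by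
    rintro _ ⟨x, hx, rfl⟩ (y | y) hxy
    · simp at hxy
    · exact ⟨y, J.2 x hx y (by simpa using hxy), rfl⟩⟩
  inj' _ _ h := Subtype.ext (Set.image_injective.2 Sum.inr_injective (congrArg Subtype.val h))

/-- The ideals of the second composition of `P` and `Q` that contain `Q`. -/
def idealLeft : P.Ideals ↪ (P.stack Q).Ideals where
  toFun J := ⟨Sum.inl '' J.1 ∪ Set.range Sum.inr, by
    rintro _ (⟨x, hx, rfl⟩ | ⟨x, rfl⟩) (y | y) hxy
    · exact .inl ⟨y, J.2 x hx y (by simpa using hxy), rfl⟩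
    · exact .inr ⟨y, rfl⟩
    · simp at hxy
    · exact .inr ⟨y, rfl⟩⟩
  inj' J J' h := Subtype.ext <| by
    have key := congrArg (fun I : (P.stack Q).Ideals => Sum.inl ⁻¹' I.1) h
    simpa [Set.preimage_image_eq _ Sum.inl_injective] using key

variable {P Q}

theorem coe_idealRight (J : Q.Ideals) : (idealRight P Q J).1 = Sum.inr '' J.1 :=
  rfl

theorem coe_idealLeft (J : P.Ideals) :
    (idealLeft P Q J).1 = Sum.inl '' J.1 ∪ Set.range Sum.inr :=
  rfl

theorem exists_idealRight_or_exists_idealLeft (I : (P.stack Q).Ideals) :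
    (∃ J, idealRight P Q J = I) ∨ ∃ J, idealLeft P Q J = I := by
  by_cases h : ∃ x, Sum.inl x ∈ I.1
  · obtain ⟨x, hx⟩ := h
    have inr_mem (y : β) : Sum.inr y ∈ I.1 := I.2 _ hx _ (by simp)
    refine .inr ⟨⟨Sum.inl ⁻¹' I.1, fun y hy z hyz => I.2 _ hy _ (by simpa using hyz)⟩,
      Subtype.ext ((coe_idealLeft _).trans ?_)⟩
    ext (y | y) <;> simp [inr_mem]
  · push Not at h
    refine .inl ⟨⟨Sum.inr ⁻¹' I.1, fun y hy z hyz => I.2 _ hy _ (by simpa using hyz)⟩,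
      Subtype.ext ((coe_idealRight _).trans ?_)⟩
    ext (y | y) <;> simp [h]

theorem exists_idealRight_eq_idealLeft_iff {J : P.Ideals} :
    (∃ J', idealRight P Q J' = idealLeft P Q J) ↔ J = P.emptyIdeal := by
  constructor
  · rintro ⟨J', h⟩
    refine Subtype.ext (Set.eq_empty_of_forall_notMem fun x hx => ?_)
    have inl_mem : Sum.inl x ∈ (idealRight P Q J').1 := h ▸ Or.inl ⟨x, hx, rfl⟩
    simp [coe_idealRight] at inl_mem
  · rintro rfl
    refine ⟨⟨Set.univ, fun _ _ _ _ => trivial⟩,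
      Subtype.ext (((coe_idealRight _).trans ?_).trans (coe_idealLeft _).symm)⟩
    ext (y | y) <;> simp [emptyIdeal]

theorem sum_ideals_stack [Finite α] [Finite β] {M : Type*} [AddCommGroup M]
    (f : (P.stack Q).Ideals → M) :
    ∑ I, f I = ∑ J, f (idealRight P Q J) + ∑ J, f (idealLeft P Q J) -
      f (idealLeft P Q P.emptyIdeal) := by
  classical
  have union_eq : Finset.univ.map (idealRight P Q) ∪ Finset.univ.map (idealLeft P Q) =
      Finset.univ := by
    ext I
    simpa using exists_idealRight_or_exists_idealLeft I
  have inter_eq : Finset.univ.map (idealRight P Q) ∩ Finset.univ.map (idealLeft P Q) =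
      {idealLeft P Q P.emptyIdeal} := by
    ext I
    simp only [Finset.mem_inter, Finset.mem_map, Finset.mem_univ, true_and, Finset.mem_singleton]
    constructor
    · rintro ⟨hI, J, rfl⟩
      rw [exists_idealRight_eq_idealLeft_iff.1 hI]
    · rintro rfl
      exact ⟨exists_idealRight_eq_idealLeft_iff.2 rfl, _, rfl⟩
  have sum_eq := Finset.sum_union_inter (f := f) (s₁ := Finset.univ.map (idealRight P Q))
    (s₂ := Finset.univ.map (idealLeft P Q))
  rw [union_eq, inter_eq, Finset.sum_singleton, Finset.sum_map, Finset.sum_map] at sum_eq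
  rw [← sum_eq, add_sub_cancel_right]

theorem restrict_idealRight_iso (J : Q.Ideals) :
    ((P.stack Q).restrict (idealRight P Q J).1).Iso (Q.restrict J.1) :=
  (restrict_stack_iso P Q _ (t := ∅) (by simp)
    (Set.preimage_image_eq _ Sum.inr_injective).symm).trans (empty_stack_iso _ _)

theorem restrict_compl_idealRight_iso (J : Q.Ideals) :
    ((P.stack Q).restrict (idealRight P Q J).1ᶜ).Iso (P.stack (Q.restrict J.1ᶜ)) :=
  (restrict_stack_iso P Q _ (t := Set.univ) (by simp [coe_idealRight])
    (by simp [coe_idealRight, Set.preimage_image_eq _ Sum.inr_injective])).trans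
      ((restrict_univ_iso P).stack (.refl _))

theorem restrict_idealLeft_iso (J : P.Ideals) :
    ((P.stack Q).restrict (idealLeft P Q J).1).Iso ((P.restrict J.1).stack Q) :=
  (restrict_stack_iso P Q _ (u := Set.univ)
    (by simp [coe_idealLeft, Set.preimage_image_eq _ Sum.inl_injective])
    (by simp [coe_idealLeft])).trans ((Iso.refl _).stack (restrict_univ_iso Q))

theorem restrict_compl_idealLeft_iso (J : P.Ideals) :
    ((P.stack Q).restrict (idealLeft P Q J).1ᶜ).Iso (P.restrict J.1ᶜ) :=
  (restrict_stack_iso P Q _ (u := ∅)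
    (by simp [coe_idealLeft, Set.preimage_image_eq _ Sum.inl_injective])
    (by simp [coe_idealLeft])).trans (stack_empty_iso _ _)

theorem restrict_idealLeft_emptyIdeal_iso :
    ((P.stack Q).restrict (idealLeft P Q P.emptyIdeal).1).Iso Q :=
  have : IsEmpty P.emptyIdeal.1 := Set.isEmpty_coe_sort.2 rfl
  (restrict_idealLeft_iso _).trans (empty_stack_iso _ _)

theorem restrict_compl_idealLeft_emptyIdeal_iso :
    ((P.stack Q).restrict (idealLeft P Q P.emptyIdeal).1ᶜ).Iso P := by
  refine (restrict_compl_idealLeft_iso _).trans ?_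
  rw [show P.emptyIdeal.1ᶜ = Set.univ from Set.compl_empty]
  exact restrict_univ_iso P

end Ideals

end DoublePoset

/-! ### The graded Hopf algebras of double posets -/

open DoublePoset DP

namespace DP

variable {α : Type} [Finite α] {T : DoublePoset α} {A B s : Set α}

theorem card_eq_zero_iff {x : DP} : x.card = 0 ↔ x = 1 := by
  refine ⟨fun h => ?_, fun h => h ▸ HopfOf.card_one⟩
  have : IsEmpty (Fin (Quotient.out x).1) := Finite.card_eq_zero_iff.1 ((Nat.card_fin _).trans h)
  rw [← cls_rep x, cls_of_isEmpty]

theorem cls_restrict_union (h : T.Precedes A B) (hs : s = A ∪ B) :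
    cls (T.restrict s) = cls (T.restrict A) * cls (T.restrict B) := by
  rw [cls_mul_cls, hs]
  exact cls_eq_iff.2 h.restrict_union_iso

theorem exists_precedes_of_cls_eq_mul {x y : DP} (h : cls T = x * y) :
    ∃ A, T.Precedes A Aᶜ ∧ cls (T.restrict A) = x ∧ cls (T.restrict Aᶜ) = y := by
  have iso : T.Iso (x.rep.comp y.rep) :=
    cls_eq_iff.1 (by rw [h, ← cls_mul_cls, cls_rep, cls_rep])
  obtain ⟨A, hA, hx, hy⟩ := iso.exists_precedes
  exact ⟨A, hA, (cls_eq_iff.2 hx).trans (cls_rep x), (cls_eq_iff.2 hy).trans (cls_rep y)⟩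

theorem cls_restrict_eq_mul_of_subset (hA : T.Precedes A Aᶜ) (hB : T.Precedes B Bᶜ) (h : A ⊆ B) :
    cls (T.restrict B) = cls (T.restrict A) * cls (T.restrict (B \ A)) ∧
      cls (T.restrict Aᶜ) = cls (T.restrict (B \ A)) * cls (T.restrict Bᶜ) := by
  refine ⟨cls_restrict_union (hA.mono le_rfl fun _ hz => hz.2) (Set.union_sdiff_cancel h).symm,
    cls_restrict_union (hB.mono Set.sdiff_subset le_rfl) ?_⟩
  grind

theorem levi {a b x y : DP} (h : a * b = x * y) :
    ∃ u, (a = x * u ∧ y = u * b) ∨ (x = a * u ∧ b = u * y) := by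
  obtain ⟨n, T, hT⟩ : ∃ (n : ℕ) (T : DoublePoset (Fin n)), cls T = a * b := ⟨_, _, cls_rep _⟩
  obtain ⟨A, hA, rfl, rfl⟩ := exists_precedes_of_cls_eq_mul hT
  obtain ⟨B, hB, rfl, rfl⟩ := exists_precedes_of_cls_eq_mul (hT.trans h)
  obtain hAB | hBA := hA.subset_or_subset hB
  · exact ⟨_, .inr (cls_restrict_eq_mul_of_subset hA hB hAB)⟩
  · exact ⟨_, .inl (cls_restrict_eq_mul_of_subset hB hA hBA)⟩

theorem finite_setOf_card_eq (n : ℕ) : {x : DP | x.card = n}.Finite := by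
  have : Finite (DoublePoset (Fin n)) :=
    Finite.of_injective (fun P => (P.le₁, P.le₂)) fun P Q h => by
      cases P
      cases Q
      simpa using h
  refine (Set.finite_range (cls : DoublePoset (Fin n) → DP)).subset ?_
  rintro x rfl
  exact ⟨x.rep, cls_rep x⟩

end DP

namespace PosetFamily

variable {C : PosetFamily}

theorem right_mem_of_mul_mem {x y : DP} (h : x * y ∈ C.toSubmonoid) : y ∈ C.toSubmonoid := by
  obtain ⟨A, -, -, hy⟩ := exists_precedes_of_cls_eq_mul (cls_rep (x * y))
  exact hy ▸ C.restrict_rep_mem _ h _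

theorem levi {a b x y : C.toSubmonoid} (h : a * b = x * y) :
    ∃ u, (a = x * u ∧ y = u * b) ∨ (x = a * u ∧ b = u * y) := by
  obtain ⟨u, ⟨ha, hy⟩ | ⟨hx, hb⟩⟩ := DP.levi (congrArg Subtype.val h)
  · exact ⟨⟨u, right_mem_of_mul_mem (ha ▸ a.2)⟩, .inl ⟨Subtype.ext ha, Subtype.ext hy⟩⟩
  · exact ⟨⟨u, right_mem_of_mul_mem (hx ▸ x.2)⟩, .inr ⟨Subtype.ext hx, Subtype.ext hb⟩⟩

variable (C) in
/-- The monoid of the isoclasses in `C` is free on its irreducible elements. -/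
noncomputable def freeMonoidEquiv :
    FreeMonoid {a : C.toSubmonoid // Irreducible a} ≃* C.toSubmonoid :=
  have card_mul (x y : C.toSubmonoid) : (x * y).1.card = x.1.card + y.1.card :=
    HopfOf.card_mul x.1 y.1
  have card_eq_zero_iff (x : C.toSubmonoid) : x.1.card = 0 ↔ x = 1 :=
    DP.card_eq_zero_iff.trans OneMemClass.coe_eq_one
  .ofBijective _
    ⟨freeMonoid_lift_irreducible_injective card_mul card_eq_zero_iff fun _ _ _ _ => levi,
      freeMonoid_lift_irreducible_surjective card_mul card_eq_zero_iff⟩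

variable (C) in
/-- `C` is stable under the second composition. -/
def IsStackClosed : Prop :=
  ∀ x ∈ C.toSubmonoid, ∀ y ∈ C.toSubmonoid, cls (x.rep.stack y.rep) ∈ C.toSubmonoid

theorem isStackClosed_all : all.IsStackClosed := fun _ _ _ _ => trivial

theorem isStackClosed_plane : plane.IsStackClosed :=
  fun _ h _ k => (rep_cls_iso _).symm.isPlane (IsPlane.stack h k)

theorem isStackClosed_wn : wn.IsStackClosed :=
  fun _ h _ k => (rep_cls_iso _).symm.isWN (IsWN.stack h k)

theorem IsStackClosed.mem (hC : C.IsStackClosed) {α β : Type} [Finite α] [Finite β]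
    {P : DoublePoset α} {Q : DoublePoset β} (h : cls P ∈ C.toSubmonoid)
    (k : cls Q ∈ C.toSubmonoid) : cls (P.stack Q) ∈ C.toSubmonoid := by
  rw [← cls_eq_iff.2 ((rep_cls_iso P).stack (rep_cls_iso Q))]
  exact hC _ h _ k

end PosetFamily

namespace HopfOf

open Coalgebra (comul counit)

variable {K : Type u} [Field K] {C : PosetFamily}

theorem isFreeAlgebra : IsFreeAlgebra K (HopfOf K C) :=
  ⟨ULift.{u} {a : C.toSubmonoid // Irreducible a}, ⟨(MonoidAlgebra.domCongr K K
    ((FreeMonoid.freeMonoidCongr Equiv.ulift).trans C.freeMonoidEquiv).symm).trans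
    FreeAlgebra.equivMonoidAlgebraFreeMonoid.symm⟩⟩

variable (K C) in
/-- The basis of isoclasses. -/
noncomputable def basis : Module.Basis C.toSubmonoid K (HopfOf K C) :=
  MonoidAlgebra.basis C.toSubmonoid K

@[simp]
theorem basis_apply (x : C.toSubmonoid) : basis K C x = of K x :=
  MonoidAlgebra.basis_apply K x

theorem constr_elt {M : Type*} [AddCommGroup M] [Module K M] (f : C.toSubmonoid → M) {α : Type}
    [Finite α] {P : DoublePoset α} (h : cls P ∈ C.toSubmonoid) :
    (basis K C).constr K f (elt K P h) = f ⟨cls P, h⟩ := by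
  rw [elt, ← basis_apply, Module.Basis.constr_basis]

theorem of_one : of K (1 : C.toSubmonoid) = 1 :=
  MonoidAlgebra.one_def.symm

theorem of_mul (x y : C.toSubmonoid) : of K (x * y) = of K x * of K y :=
  ((MonoidAlgebra.single_mul_single ..).trans (by rw [mul_one]; rfl)).symm

theorem of_mem_degree (x : C.toSubmonoid) : of K x ∈ degree K C x.1.card :=
  Submodule.subset_span ⟨x, rfl, rfl⟩

theorem elt_mem_degree {α : Type} [Finite α] {P : DoublePoset α} (h : cls P ∈ C.toSubmonoid) :
    elt K P h ∈ degree K C (Nat.card α) :=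
  card_cls P ▸ of_mem_degree ⟨cls P, h⟩

theorem degree_le {n : ℕ} {S : Submodule K (HopfOf K C)}
    (h : ∀ x : C.toSubmonoid, x.1.card = n → of K x ∈ S) : degree K C n ≤ S := by
  refine Submodule.span_le.2 ?_
  rintro _ ⟨x, hx, rfl⟩
  exact h x hx

instance : SetLike.GradedMonoid (degree K C) where
  one_mem := by
    have key := of_mem_degree (K := K) (1 : C.toSubmonoid)
    rwa [of_one, OneMemClass.coe_one, card_one] at key
  mul_mem m n a b ha hb := by
    refine degree_le (S := (degree K C (m + n)).comap (LinearMap.mulRight K b)) ?_ ha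
    rintro x rfl
    refine degree_le (S := (degree K C (x.1.card + n)).comap (LinearMap.mulLeft K (of K x))) ?_ hb
    rintro y rfl
    change of K x * of K y ∈ degree K C _
    rw [← of_mul, ← card_mul]
    exact of_mem_degree (x * y)

variable (K C) in
/-- The map sending an isoclass to itself, in the component of its cardinality. -/
noncomputable def decomposition : HopfOf K C →ₗ[K] DirectSum ℕ fun n => degree K C n :=
  (basis K C).constr K fun x => DirectSum.of (fun n => degree K C n) x.1.card ⟨_, of_mem_degree x⟩

theorem decomposition_of (x : C.toSubmonoid) : decomposition K C (of K x) =
    DirectSum.of (fun n => degree K C n) x.1.card ⟨_, of_mem_degree x⟩ :=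
  (congrArg _ (basis_apply x).symm).trans (Module.Basis.constr_basis _ K _ x)

noncomputable instance : DirectSum.Decomposition (degree K C) :=
  .ofLinearMap _ (decomposition K C)
    ((basis K C).ext fun x => by
      rw [basis_apply, LinearMap.comp_apply, decomposition_of, ← DirectSum.lof_eq_of K,
        DirectSum.coeLinearMap_lof, LinearMap.id_apply])
    (DirectSum.linearMap_ext K fun n => (Submodule.linearMap_eq_iff_of_eq_span _ _ rfl).2 <| by
      rintro ⟨_, x, rfl, rfl⟩
      exact (congrArg (decomposition K C) (DirectSum.coeLinearMap_lof ..)).trans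
        (decomposition_of x))

noncomputable instance : GradedAlgebra (degree K C) where

instance : IsConnectedGraded (degree K C) where
  eq_algebraMap_counit {x} hx := by
    refine degree_le (S := LinearMap.eqLocus .id (Algebra.linearMap K _ ∘ₗ counit)) ?_ hx
    intro y hy
    obtain rfl : y = 1 := Subtype.ext (card_eq_zero_iff.1 hy)
    rw [LinearMap.mem_eqLocus, of_one]
    simp
  counit_eq_zero {n x} hn hx := by
    refine degree_le (S := LinearMap.ker counit) ?_ hx
    rintro y rfl
    rw [LinearMap.mem_ker, of_eq_elt, counit_elt, Nat.card_fin]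
    exact if_neg hn
  comul_mem {n x} hx := by
    refine degree_le (S := (tensorDegree _ _).comap comul) ?_ hx
    rintro y rfl
    rw [Submodule.mem_comap, of_eq_elt, comul_elt]
    refine sum_mem fun I _ => tmul_mem_tensorDegree ?_ (elt_mem_degree _) (elt_mem_degree _)
    change Nat.card (I.1ᶜ : Set _) + Nat.card I.1 = y.1.card
    rw [Nat.card_coe_set_eq, Nat.card_coe_set_eq, add_comm, Set.ncard_add_ncard_compl, Nat.card_fin]
    rfl

instance (n : ℕ) : FiniteDimensional K (degree K C n) := by
  refine FiniteDimensional.span_of_finite K (Set.Finite.subset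
    (((finite_setOf_card_eq n).preimage Subtype.val_injective.injOn).image (of (C := C) K)) ?_)
  rintro _ ⟨x, hx, rfl⟩
  exact ⟨x, hx, rfl⟩

section Stack

variable (hC : C.IsStackClosed) {α β : Type} [Finite α] [Finite β] {P : DoublePoset α}
  {Q : DoublePoset β} (h : cls P ∈ C.toSubmonoid) (k : cls Q ∈ C.toSubmonoid)

/-- The bilinear extension of the second composition. -/
noncomputable def stackMul : HopfOf K C →ₗ[K] HopfOf K C →ₗ[K] HopfOf K C :=
  (basis K C).constr K fun x => (basis K C).constr K fun y =>
    elt K (x.1.rep.stack y.1.rep) (hC _ x.2 _ y.2)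

theorem stackMul_elt :
    stackMul hC (elt K P h) (elt K Q k) = elt K (P.stack Q) (hC.mem h k) := by
  rw [stackMul, constr_elt, constr_elt]
  exact elt_congr K _ _ ((rep_cls_iso P).stack (rep_cls_iso Q))

theorem comul_stackMul_elt :
    comul (stackMul hC (elt K P h) (elt K Q k)) =
      (stackMul hC (elt K P h)).rTensor _ (comul (elt K Q k)) +
      ((stackMul hC).flip (elt K Q k)).lTensor _ (comul (elt K P h)) -
      elt K P h ⊗ₜ elt K Q k := by
  rw [stackMul_elt, comul_elt, sum_ideals_stack, comul_elt, comul_elt, map_sum, map_sum]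
  congr 2
  · refine Finset.sum_congr rfl fun J _ => ?_
    rw [LinearMap.rTensor_tmul, stackMul_elt hC h (C.restrict_mem k _),
      elt_congr K _ _ (restrict_compl_idealRight_iso J),
      elt_congr K _ _ (restrict_idealRight_iso J)]
  · refine Finset.sum_congr rfl fun J _ => ?_
    rw [LinearMap.lTensor_tmul, LinearMap.flip_apply, stackMul_elt hC (C.restrict_mem h _) k,
      elt_congr K _ _ (restrict_compl_idealLeft_iso J),
      elt_congr K _ _ (restrict_idealLeft_iso J)]
  · exact elt_congr K _ _ restrict_compl_idealLeft_emptyIdeal_iso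
  · exact elt_congr K _ _ restrict_idealLeft_emptyIdeal_iso

/-- The second composition makes `HopfOf K C` an infinitesimal bialgebra. -/
noncomputable def infinitesimalProduct : InfinitesimalProduct K (HopfOf K C) where
  op := stackMul hC
  one_op x := by
    refine LinearMap.congr_fun (g := LinearMap.id) (linearMap_ext K fun n P hP => ?_) x
    rw [one_eq_elt K DoublePoset.empty (one_mem C.toSubmonoid), stackMul_elt]
    exact elt_congr K _ _ (empty_stack_iso _ _)
  op_one x := by
    refine LinearMap.congr_fun (f := (stackMul hC).flip 1) (g := LinearMap.id)
      (linearMap_ext K fun n P hP => ?_) x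
    rw [one_eq_elt K DoublePoset.empty (one_mem C.toSubmonoid), LinearMap.flip_apply,
      stackMul_elt]
    exact elt_congr K _ _ (stack_empty_iso _ _)
  comul_op x y := by
    have key : (stackMul hC).compr₂ comul =
        LinearMap.compl₂ (LinearMap.rTensorHom (HopfOf K C) ∘ₗ stackMul hC) comul +
        (LinearMap.compl₂ (LinearMap.lTensorHom (HopfOf K C) ∘ₗ (stackMul hC).flip) comul).flip -
        TensorProduct.mk K (HopfOf K C) (HopfOf K C) :=
      linearMap_ext K fun n P hP => linearMap_ext K fun m Q hQ => comul_stackMul_elt hC hP hQ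
    exact LinearMap.congr_fun₂ key x y

end Stack

end HopfOf

theorem corollary29_general (K : Type*) [Field K] {C : PosetFamily} (hC : C.IsStackClosed) :
    (IsFreeAlgebra K (HopfOf K C) ∧ IsCofree K (HopfOf K C)) ∧
    IsSelfDual (HopfOf.degree K C) ∧
    (CharZero K → IsFreeLieAlgebra K (primitives K (HopfOf K C))) :=
  ⟨⟨HopfOf.isFreeAlgebra,
      isCofree_of_infinitesimalProduct (HopfOf.infinitesimalProduct hC) (HopfOf.degree K C)⟩,
    isSelfDual_of_infinitesimalProduct HopfOf.isFreeAlgebra (HopfOf.infinitesimalProduct hC),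
    fun _ => isFreeLieAlgebra_primitives (HopfOf.degree K C) HopfOf.isFreeAlgebra⟩

theorem corollary29 (K : Type*) [Field K] :
    ((IsFreeAlgebra K (HDP K) ∧ IsCofree K (HDP K)) ∧
      (IsFreeAlgebra K (HPP K) ∧ IsCofree K (HPP K)) ∧
      (IsFreeAlgebra K (HWNP K) ∧ IsCofree K (HWNP K))) ∧
    (IsSelfDual (HopfOf.degree K PosetFamily.all) ∧
      IsSelfDual (HopfOf.degree K PosetFamily.plane) ∧
      IsSelfDual (HopfOf.degree K PosetFamily.wn)) ∧
    (CharZero K →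
      IsFreeLieAlgebra K (primitives K (HDP K)) ∧
      IsFreeLieAlgebra K (primitives K (HPP K)) ∧
      IsFreeLieAlgebra K (primitives K (HWNP K))) := by
  obtain ⟨free_DP, dual_DP, lie_DP⟩ := corollary29_general K PosetFamily.isStackClosed_all
  obtain ⟨free_PP, dual_PP, lie_PP⟩ := corollary29_general K PosetFamily.isStackClosed_plane
  obtain ⟨free_WNP, dual_WNP, lie_WNP⟩ := corollary29_general K PosetFamily.isStackClosed_wn
  exact ⟨⟨free_DP, free_PP, free_WNP⟩, ⟨dual_DP, dual_PP, dual_WNP⟩,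
    fun h => ⟨lie_DP h, lie_PP h, lie_WNP h⟩⟩
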